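/- **Setting.** Let $g\ge 2$, let $\Gamma$ be a group of orientation-preserving isometries of the hyperbolic unit disk $\mathbb D$ acting freely, and let $\mathcal F\subset\mathbb D$ be a fundamental polygon of $\Gamma$ with $8g-4$ sides. All indices are modulo $8g-4$. The vertices are $V_i$ in counterclockwise order, side $i$ joins $V_i$ to $V_{i+1}$, and $P_i$, $Q_{i+1}\in\mathbb S=\partial\mathbb D$ are the end points of the oriented geodesic extending side $i$; the points $P_1,Q_1,P_2,Q_2,\dots,P_{8g-4},Q_{8g-4}$ are in counterclockwise order. Put $\sigma(i)=4g-i$ for odd $i$, $\sigma(i)=2-i$ for even $i$, $\rho(i)=\sigma(i)+1$ and $\tau(i)=i+4g-2$. The group $\Gamma$ is generated by Möbius transformations $T_i$ with $T_i(V_i)=V_{\rho(i)}$, $T_{\sigma(i)}T_i=\mathrm{Id}$ and $T_{\rho^3(i)}T_{\rho^2(i)}T_{\rho(i)}T_i=\mathrm{Id}$. The extension condition holds: no geodesic $P_iQ_{i+1}$ meets the interior of a set $\gamma\mathcal F$, $\gamma\in\Gamma$. For $a,b\in\mathbb S$, $[a,b]$ and $[a,b)$ denote counterclockwise arcs, and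 $(u,w)\in\mathbb S\times\mathbb S$, $u\ne w$, denotes the geodesic from $u$ to $w$. Let $A_i\in\{P_i,Q_i\}$ for all $i$ (extremal parameters), and let $G_i\in[P_i,P_{i+1}]$ be the numbers with $G_{\sigma(i)}=T_iG_{i-2}$ if $A_i=P_i$ and $G_{\sigma(i)}=T_{\tau(i)+1}G_{\tau(i)}$ if $A_i=Q_i$. Put $U_i=T_{\sigma(i)}T_{\tau(i)-1}$ and $H_i=U_iG_{\tau(i)-1}$. Let $\overline\Omega_{geo}$ be the set of geodesics $(u,w)$ that meet the closed polygon $\mathcal F$, and let $$\overline\Omega_A=\bigcup_i\,[H_{i+1},G_{i-2}]\times[P_i,Q_i]\;\cup\;[H_{i+1},G_{i-1}]\times[Q_i,P_{i+1}].$$ Let $\Omega_{geo}\subset\overline\Omega_{geo}$ be the set of geodesics that meet the interior of $\mathcal F$, or that meet $\mathcal F$ and have all of $\mathcal F$ on their closed left side, and let $$\Omega_A=\bigcup_i\,[H_{i+1},G_{i-2})\times[P_i,Q_i)\;\cup\;[H_{i+1},G_{i-1})\times[Q_i,P_{i+1}).$$ Define the lower and upper bulges and the lower and upper corners $$\mathcal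 B_i=(\Omega_{geo}\setminus\Omega_A)\cap([Q_{i+1},Q_{i+2}]\times[P_i,P_{i+1}]),\qquad \mathcal B^i=(\Omega_{geo}\setminus\Omega_A)\cap([P_{i-1},P_i]\times[Q_i,Q_{i+1}]),$$ $$\mathcal C_i=(\Omega_A\setminus\Omega_{geo})\cap([Q_{i+1},Q_{i+2}]\times[P_i,P_{i+1}]),\qquad \mathcal C^i=(\Omega_A\setminus\Omega_{geo})\cap([P_{i-1},P_i]\times[Q_i,Q_{i+1}]),$$ and let $\overline{\mathcal B}_i,\overline{\mathcal B}^i,\overline{\mathcal C}_i,\overline{\mathcal C}^i$ be the sets given by the same formulas with $\overline\Omega_{geo},\overline\Omega_A$ in place of $\Omega_{geo},\Omega_A$. Möbius transformations act on $\mathbb S\times\mathbb S$ diagonally. **Proposition.** 1. The sets $\Omega_{geo}$ and $\Omega_A$ differ from $\overline\Omega_{geo}$ and $\overline\Omega_A$ only in boundary points: $\operatorname{int}\overline\Omega_{geo}\subset\Omega_{geo}$ and $\overline\Omega_{geo}$ is the closure of $\Omega_{geo}$; likewise for $\Omega_A$ and $\overline\Omega_A$. 2. The map $\Phi$ on $\Omega_{geo}$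 that is the identity on $\Omega_{geo}\cap\Omega_A$, equal to $U_{\tau(i)+1}$ on $\mathcal B_i$ and to $U_{\tau(i)}$ on $\mathcal B^i$ for every $i$, is well defined and is a bijection from $\Omega_{geo}$ onto $\Omega_A$. For every $i$, $\Phi(\mathcal B_i)=\mathcal C^{\tau(i)+1}$ and $\Phi(\mathcal B^i)=\mathcal C_{\tau(i)-1}$. 3. For the closed domains the same holds up to boundary points: for every $i$, $U_{\tau(i)+1}(\operatorname{int}\overline{\mathcal B}_i)=\operatorname{int}\overline{\mathcal C}^{\tau(i)+1}$ and $U_{\tau(i)}(\operatorname{int}\overline{\mathcal B}^i)=\operatorname{int}\overline{\mathcal C}_{\tau(i)-1}$. -/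

import Mathlib

open Set

noncomputable section

namespace BowenSeries

/-! ### Moebius transformations of the disk and their action -/

/-- The group `SU(1,1)` of matrices `(a, b; conj b, conj a)` of determinant one.  Its elements are
the orientation-preserving isometries of the hyperbolic unit disk, each one listed twice
(`M` and `-M`). -/
def SU11 : Subgroup (Matrix.SpecialLinearGroup (Fin 2) ℂ) where
  carrier := {M | M.1 1 1 = star (M.1 0 0) ∧ M.1 1 0 = star (M.1 0 1)}
  mul_mem' := by
    rintro M M' ⟨h1, h2⟩ ⟨h1', h2'⟩
    simp only [mem_ofPred_eq, Matrix.SpecialLinearGroup.coe_mul, Matrix.mul_apply,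
      Fin.sum_univ_two, h1, h2, h1', h2', star_add, star_mul', star_star]
    constructor <;> ring
  one_mem' := by simp
  inv_mem' := by
    rintro M ⟨h1, h2⟩
    simp [Matrix.SpecialLinearGroup.coe_inv, Matrix.adjugate_fin_two, h1, h2]

/-- The Moebius transformation `z ↦ (a z + b) / (conj b z + conj a)`. -/
def mob (M : SU11) (z : ℂ) : ℂ :=
  (M.1.1 0 0 * z + M.1.1 0 1) / (M.1.1 1 0 * z + M.1.1 1 1)

theorem norm_mob (M : SU11) (z : Circle) : ‖mob M z‖ = 1 := by
  have h1 : M.1.1 1 1 = star (M.1.1 0 0) := M.2.1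
  have h2 : M.1.1 1 0 = star (M.1.1 0 1) := M.2.2
  have hdet : M.1.1 0 0 * M.1.1 1 1 - M.1.1 0 1 * M.1.1 1 0 = 1 := by
    rw [← Matrix.det_fin_two]; exact M.1.2
  unfold mob
  rw [h1, h2] at hdet ⊢
  generalize M.1.1 0 0 = a at *
  generalize M.1.1 0 1 = b at *
  have hz : (z : ℂ) * star (z : ℂ) = 1 := by
    have := Complex.mul_conj' (z : ℂ)
    rw [Circle.norm_coe] at this
    simpa using this
  have hden : star b * z + star a = z * star (a * z + b) := by
    rw [star_add, star_mul']
    linear_combination -(star a) * hz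
  have hne : a * (z : ℂ) + b ≠ 0 := by
    intro h0
    have hb : b = -(a * z) := by linear_combination h0
    rw [hb, star_neg, star_mul'] at hdet
    have : (0 : ℂ) = 1 := by linear_combination hdet + a * star a * hz
    exact zero_ne_one this
  rw [hden, norm_div, norm_mul, norm_star, Circle.norm_coe, one_mul]
  exact div_self (norm_ne_zero_iff.mpr hne)

/-- The action of a Moebius transformation on the circle at infinity. -/
def mobCircle (M : SU11) (z : Circle) : Circle :=
  ⟨mob M z, mem_sphere_zero_iff_norm.mpr (norm_mob M z)⟩

/-- The action on oriented geodesics, each one written as (starting point, end point). -/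
def mobPair (M : SU11) (p : Circle × Circle) : Circle × Circle :=
  (mobCircle M p.1, mobCircle M p.2)

/-- `M` acts on the disk as the identity, that is, `M` is `1` or `-1`. -/
def ActsAsId (M : SU11) : Prop := ∀ z : ℂ, ‖z‖ < 1 → mob M z = z

/-! ### Geodesics and arcs -/

/-- For `u ≠ w` on the unit circle, the zero set of `side u w` in the open unit disk is the geodesic
with end points `u` and `w` (the circle or line through `u` and `w` orthogonal to the unit circle),
and `side u w` is positive exactly on the left of the geodesic oriented from `u` to `w`. -/
def side (u w : Circle) (z : ℂ) : ℝ :=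
  (1 + ‖z‖ ^ 2) * (star (u : ℂ) * w).im + 2 * (star ((w : ℂ) - u) * z).im

/-- The points `a`, `b`, `c` of the circle are distinct and in counterclockwise order. -/
def Ccw (a b c : Circle) : Prop := 0 < (star ((b : ℂ) - a) * ((c : ℂ) - a)).im

/-- The closed arc `[a, b]`, counterclockwise from `a` to `b`. -/
def arcIcc (a b : Circle) : Set Circle := {x | x = a ∨ x = b ∨ Ccw a x b}

/-- The half-open arc `[a, b)`, counterclockwise from `a` to `b`. -/
def arcIco (a b : Circle) : Set Circle := {x | x ≠ b ∧ (x = a ∨ Ccw a x b)}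

/-! ### Index maps -/

section
variable {g : ℕ}

/-- The side pairing rule (parity makes sense modulo the even number `8g-4`). -/
def sigma (i : ZMod (8 * g - 4)) : ZMod (8 * g - 4) :=
  if Odd i.val then 4 * (g : ZMod (8 * g - 4)) - i else 2 - i

def rho (i : ZMod (8 * g - 4)) : ZMod (8 * g - 4) := sigma i + 1

def tau (i : ZMod (8 * g - 4)) : ZMod (8 * g - 4) := i + (4 * (g : ZMod (8 * g - 4)) - 2)

end

/-! ### The fundamental polygon -/

/-- Vertices `V i`, side-pairing transformations `T i`, and end points `P i`, `Q (i + 1)` of the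
oriented geodesics that extend the sides (side `i` joins `V i` to `V (i + 1)`). -/
structure PolygonData (g : ℕ) where
  P : ZMod (8 * g - 4) → Circle
  Q : ZMod (8 * g - 4) → Circle
  V : ZMod (8 * g - 4) → ℂ
  T : ZMod (8 * g - 4) → SU11

namespace PolygonData

variable {g : ℕ} (D : PolygonData g)

/-- The group generated by the side pairings. -/
def Gam : Subgroup SU11 := Subgroup.closure (range D.T)

/-- The closed polygon: the points of the disk on the left of, or on, all extended sides. -/
def closedPolygon : Set ℂ := {z | ‖z‖ < 1 ∧ ∀ i, 0 ≤ side (D.P i) (D.Q (i + 1)) z}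

/-- The interior of the polygon. -/
def openPolygon : Set ℂ := {z | ‖z‖ < 1 ∧ ∀ i, 0 < side (D.P i) (D.Q (i + 1)) z}

/-- `D` describes an `(8g-4)`-sided fundamental polygon with the given side pairing rule, for a
group acting freely on the disk, whose sides satisfy the extension condition. -/
structure IsFundamentalPolygon : Prop where
  /-- The points `P 1, Q 1, P 2, Q 2, …` follow each other counterclockwise, once around. -/
  order : ∃ α β : ℤ → ℝ,
    (∀ n, α n < β n ∧ β n < α (n + 1)) ∧
    (∀ n, α (n + (8 * (g : ℤ) - 4)) = α n + 2 * Real.pi) ∧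
    (∀ n, β (n + (8 * (g : ℤ) - 4)) = β n + 2 * Real.pi) ∧
    ∀ n : ℤ, D.P (n : ZMod (8 * g - 4)) = Circle.exp (α n) ∧
      D.Q (n : ZMod (8 * g - 4)) = Circle.exp (β n)
  vertex_mem : ∀ i, ‖D.V i‖ < 1
  vertex_start : ∀ i, side (D.P i) (D.Q (i + 1)) (D.V i) = 0
  vertex_end : ∀ i, side (D.P i) (D.Q (i + 1)) (D.V (i + 1)) = 0
  map_vertex : ∀ i, mob (D.T i) (D.V i) = D.V (rho i)
  pairing : ∀ i, ActsAsId (D.T (sigma i) * D.T i)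
  cycle : ∀ i, ActsAsId (D.T (rho (rho (rho i))) * D.T (rho (rho i)) * D.T (rho i) * D.T i)
  /-- The group acts freely on the disk. -/
  free : ∀ γ ∈ D.Gam, (∃ z : ℂ, ‖z‖ < 1 ∧ mob γ z = z) → ActsAsId γ
  /-- The images of the polygon cover the disk. -/
  covers : ∀ z : ℂ, ‖z‖ < 1 → ∃ γ ∈ D.Gam, mob γ z ∈ D.closedPolygon
  /-- Different images of the polygon have disjoint interiors. -/
  tiles : ∀ γ ∈ D.Gam, (∃ z ∈ D.openPolygon, mob γ z ∈ D.openPolygon) → ActsAsId γ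
  /-- The extended sides do not meet the interior of any image of the polygon. -/
  extension : ∀ γ ∈ D.Gam, ∀ i, ∀ z ∈ D.openPolygon, side (D.P i) (D.Q (i + 1)) (mob γ z) ≠ 0

/-! ### The two domains -/

/-- The defining system for the numbers `G i` attached to extremal parameters `A`. -/
def IsSystemSolution (A G : ZMod (8 * g - 4) → Circle) : Prop :=
  ∀ i, G i ∈ arcIcc (D.P i) (D.P (i + 1)) ∧
    (A i = D.P i → G (sigma i) = mobCircle (D.T i) (G (i - 2))) ∧
    (A i = D.Q i → G (sigma i) = mobCircle (D.T (tau i + 1)) (G (tau i)))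

def U (i : ZMod (8 * g - 4)) : SU11 := D.T (sigma i) * D.T (tau i - 1)

def H (G : ZMod (8 * g - 4) → Circle) (i : ZMod (8 * g - 4)) : Circle :=
  mobCircle (D.U i) (G (tau i - 1))

/-- The oriented geodesics that meet the closed polygon. -/
def OmegaGeo : Set (Circle × Circle) :=
  {p | p.1 ≠ p.2 ∧ ∃ z ∈ D.closedPolygon, side p.1 p.2 z = 0}

/-- The oriented geodesics that meet the interior of the polygon, or that meet the closed polygon
and have all of it on their left. -/
def OmegaGeoHalf : Set (Circle × Circle) :=
  {p | p.1 ≠ p.2 ∧ ((∃ z ∈ D.openPolygon, side p.1 p.2 z = 0) ∨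
    ((∃ z ∈ D.closedPolygon, side p.1 p.2 z = 0) ∧ ∀ z ∈ D.closedPolygon, 0 ≤ side p.1 p.2 z))}

/-- The arithmetic domain as a union of closed rectangles. -/
def OmegaA (G : ZMod (8 * g - 4) → Circle) : Set (Circle × Circle) :=
  ⋃ i, (arcIcc (D.H G (i + 1)) (G (i - 2)) ×ˢ arcIcc (D.P i) (D.Q i) ∪
    arcIcc (D.H G (i + 1)) (G (i - 1)) ×ˢ arcIcc (D.Q i) (D.P (i + 1)))

/-- The arithmetic domain as a union of half-open rectangles. -/
def OmegaAHalf (G : ZMod (8 * g - 4) → Circle) : Set (Circle × Circle) :=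
  ⋃ i, (arcIco (D.H G (i + 1)) (G (i - 2)) ×ˢ arcIco (D.P i) (D.Q i) ∪
    arcIco (D.H G (i + 1)) (G (i - 1)) ×ˢ arcIco (D.Q i) (D.P (i + 1)))

/-! ### Bulges, corners and the map `Phi`; `X` stands for the geometric domain and `Y` for the
arithmetic one -/

def lowerBox (i : ZMod (8 * g - 4)) : Set (Circle × Circle) :=
  arcIcc (D.Q (i + 1)) (D.Q (i + 2)) ×ˢ arcIcc (D.P i) (D.P (i + 1))

def upperBox (i : ZMod (8 * g - 4)) : Set (Circle × Circle) :=
  arcIcc (D.P (i - 1)) (D.P i) ×ˢ arcIcc (D.Q i) (D.Q (i + 1))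

def lowerBulge (X Y : Set (Circle × Circle)) (i : ZMod (8 * g - 4)) : Set (Circle × Circle) :=
  (X \ Y) ∩ D.lowerBox i

def upperBulge (X Y : Set (Circle × Circle)) (i : ZMod (8 * g - 4)) : Set (Circle × Circle) :=
  (X \ Y) ∩ D.upperBox i

def lowerCorner (X Y : Set (Circle × Circle)) (i : ZMod (8 * g - 4)) : Set (Circle × Circle) :=
  (Y \ X) ∩ D.lowerBox i

def upperCorner (X Y : Set (Circle × Circle)) (i : ZMod (8 * g - 4)) : Set (Circle × Circle) :=
  (Y \ X) ∩ D.upperBox i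

open Classical in
/-- `U (τ i + 1)` on the lower bulge `i`, `U (τ i)` on the upper bulge `i`, and the identity
elsewhere.  Where several bulges contain a point, one of them is chosen. -/
def Phi (X Y : Set (Circle × Circle)) (p : Circle × Circle) : Circle × Circle :=
  if h : ∃ i, p ∈ D.lowerBulge X Y i then mobPair (D.U (tau h.choose + 1)) p
  else if h : ∃ i, p ∈ D.upperBulge X Y i then mobPair (D.U (tau h.choose)) p
  else p

end PolygonData

end BowenSeries

end

/-! Send `z` to the Minkowski vector `((1 + |z|²) / 2, re z, im z)`. Cyclic order on the circle and
the side of a geodesic on which a point lies both become signs of one determinant, `dt`. Moebius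
transformations change it only by positive factors (`dt_mob`), and hyperbolic convexity becomes
positive linear combination (`exists_comb`, `exists_point`).

Both domains are studied through their fibres over the end point `w`. Let `w` lie in `[P i, P (i +
1))` and in `[Q j, Q (j + 1))`; then `j` is `i - 1` or `i`. Seen from `w`, the polygon stretches
exactly from `V (i + 1)` to `V j`. So `(u, w)` is in the half-open geometric domain iff `V (i + 1)`
is strictly on its left and `V j` is not (`mem_OmegaGeoHalf_iff`), and in the arithmetic one iff `u
∈ [H (i + 1), G (j - 1))` (`mem_OmegaAHalf_iff`). Each domain is thus cut out by a lower condition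
depending on `i` and an upper condition depending on `j`. The lower conditions of the two domains
can differ only for `u` in `[Q (i + 1), Q (i + 2)]`, the upper ones only for `u` in `[P (j - 1), P
j]`. These arcs are disjoint, and on each of them the other pair of conditions holds. Hence every
bulge or corner is given by an arc for `u`, an arc for `w`, and the side on which one vertex lies,
up to an isolated point at the corner of its box.

The extension condition and the cycle relation determine how `T i` moves the neighbouring end points
(`T_P_pred`, `T_Q`). Consequently `U k` sends `P (τ k - 1)`, `P (τ k)`, `Q (τ k)`, `Q (τ k + 1)`, `V
(τ k)` to `Q k`, `Q (k + 1)`, `P (k - 1)`, `P k`, `V k`. Moreover `U k` and `U (τ k)` are inverse on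
the circle (`U_U_tau`), so `H (τ k)` goes to `G (k - 1)`. The conditions for the lower bulge `τ k -
1` thereby turn literally into those for the upper corner `k`, and the conditions for the upper
bulge `τ k` into those for the lower corner `k - 1`.

Bulges and corners exhaust the differences of the domains (`exists_bulge`, `exists_corner`). Lower
boxes never meet upper ones, and neighbouring upper bulges, or lower corners, share at most one
point, on which the two maps in question agree; this makes `Phi` well defined and bijective. For the
closed domains it is enough that the differences of the closed and of the half-open sets have the
same interior (`interior_sdiff_eq`). -/

namespace BowenSeries

/-! ### The triple product -/

/-- The determinant of the three vectors `((1 + |z|²) / 2, re z, im z)` of Minkowski space. -/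
noncomputable def dt (x y z : ℂ) : ℝ :=
  (1 + (x.re ^ 2 + x.im ^ 2)) / 2 * (y.re * z.im - y.im * z.re) -
  (1 + (y.re ^ 2 + y.im ^ 2)) / 2 * (x.re * z.im - x.im * z.re) +
  (1 + (z.re ^ 2 + z.im ^ 2)) / 2 * (x.re * y.im - x.im * y.re)

theorem dt_cyc (x y z : ℂ) : dt x y z = dt y z x := by unfold dt; ring

theorem dt_swap (x y z : ℂ) : dt x y z = -dt y x z := by unfold dt; ring

theorem dt_swap' (x y z : ℂ) : dt x y z = -dt x z y := by unfold dt; ring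

theorem dt_self (x z : ℂ) : dt x x z = 0 := by unfold dt; ring

theorem dt_self'' (x z : ℂ) : dt x z x = 0 := by unfold dt; ring

theorem circle_sq (a : Circle) : (a : ℂ).re ^ 2 + (a : ℂ).im ^ 2 = 1 := by
  have := Circle.normSq_coe a
  rw [Complex.normSq_apply] at this
  linarith

theorem norm_sq_eq (z : ℂ) : ‖z‖ ^ 2 = z.re ^ 2 + z.im ^ 2 := by
  rw [← Complex.normSq_eq_norm_sq, Complex.normSq_apply]; ring

theorem side_eq (u w : Circle) (z : ℂ) : side u w z = 2 * dt u w z := by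
  have hu := circle_sq u
  have hw := circle_sq w
  simp only [side, dt, norm_sq_eq, hu, hw, Complex.star_def, Complex.mul_im, Complex.conj_re,
    Complex.conj_im, Complex.sub_re, Complex.sub_im]
  ring

theorem ccw_iff (a b c : Circle) : Ccw a b c ↔ 0 < dt a b c := by
  have ha := circle_sq a
  have hb := circle_sq b
  have hc := circle_sq c
  simp only [Ccw, dt, ha, hb, hc, Complex.star_def, Complex.mul_im, Complex.conj_re,
    Complex.conj_im, Complex.sub_re, Complex.sub_im]
  ring_nf

/-- Expansion of a product of triple products in the plane transversal to `v`. -/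
theorem dt_plucker (v w p q z : ℂ) :
    dt v w z * dt p q v = dt w q v * dt v p z + dt p w v * dt v q z := by
  unfold dt; ring

/-! ### Positive combinations in Minkowski space -/

/-- For unit vectors, `1 - a·b` times `1 + a·b` or times `a + b` is a multiple of the cross product
`a × b`. After multiplication by the non-zero number `1 - a·b` the claim is therefore a multiple of
the incidence relation `h`. -/
theorem comb_aux {a1 a2 b1 b2 x1 x2 : ℝ} (ha : a1 ^ 2 + a2 ^ 2 = 1) (hb : b1 ^ 2 + b2 ^ 2 = 1)
    (h : (1 + 1) / 2 * (b1 * x2 - b2 * x1) - (1 + 1) / 2 * (a1 * x2 - a2 * x1) +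
      (1 + (x1 ^ 2 + x2 ^ 2)) / 2 * (a1 * b2 - a2 * b1) = 0)
    (hD : (a1 - b1) ^ 2 + (a2 - b2) ^ 2 ≠ 0) :
    (1 + (x1 ^ 2 + x2 ^ 2)) * (1 + (a1 * b1 + a2 * b2)) =
      2 * (x1 * (a1 + b1) + x2 * (a2 + b2)) := by
  have f1 : (1 - (a1 * b1 + a2 * b2)) * (1 + (a1 * b1 + a2 * b2)) = (a1 * b2 - a2 * b1) ^ 2 := by
    linear_combination (-(b1 ^ 2 + b2 ^ 2)) * ha - hb
  have f2 : (1 - (a1 * b1 + a2 * b2)) * (a1 + b1) = (a1 * b2 - a2 * b1) * (b2 - a2) := by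
    linear_combination (-b1) * ha - a1 * hb
  have f3 : (1 - (a1 * b1 + a2 * b2)) * (a2 + b2) = (a1 * b2 - a2 * b1) * (a1 - b1) := by
    linear_combination (-b2) * ha - a2 * hb
  have hs : 1 - (a1 * b1 + a2 * b2) ≠ 0 := fun h0 ↦ hD (by linear_combination ha + hb + 2 * h0)
  apply mul_left_cancel₀ hs
  linear_combination (1 + (x1 ^ 2 + x2 ^ 2)) * f1 - 2 * x1 * f2 - 2 * x2 * f3 +
    2 * (a1 * b2 - a2 * b1) * h

/-- One coordinate of `|a - b|² x = |x - b|² a + |x - a|² b`. The squared distances are, up to a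
common factor, the Minkowski products of the vectors of `x`, `a`, `b`; such products with the
light-like vectors of `a` and `b` read off the coefficients. -/
theorem comb_aux' {a1 a2 b1 b2 x1 x2 : ℝ} (ha : a1 ^ 2 + a2 ^ 2 = 1) (hb : b1 ^ 2 + b2 ^ 2 = 1)
    (h : (1 + 1) / 2 * (b1 * x2 - b2 * x1) - (1 + 1) / 2 * (a1 * x2 - a2 * x1) +
      (1 + (x1 ^ 2 + x2 ^ 2)) / 2 * (a1 * b2 - a2 * b1) = 0)
    (hD : (a1 - b1) ^ 2 + (a2 - b2) ^ 2 ≠ 0) :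
    x1 * ((a1 - b1) ^ 2 + (a2 - b2) ^ 2) = ((x1 - b1) ^ 2 + (x2 - b2) ^ 2) * a1 +
      ((x1 - a1) ^ 2 + (x2 - a2) ^ 2) * b1 := by
  have hs : 1 - (a1 * b1 + a2 * b2) ≠ 0 := fun h0 ↦ hD (by linear_combination ha + hb + 2 * h0)
  have e1 : x1 * ((a1 - b1) ^ 2 + (a2 - b2) ^ 2) = x1 * (2 * (1 - (a1 * b1 + a2 * b2))) := by
    linear_combination x1 * (ha + hb)
  have e2 : ((x1 - b1) ^ 2 + (x2 - b2) ^ 2) * a1 + ((x1 - a1) ^ 2 + (x2 - a2) ^ 2) * b1 =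
      (1 + (x1 ^ 2 + x2 ^ 2)) * (a1 + b1) - 2 * (x1 * b1 + x2 * b2) * a1 -
      2 * (x1 * a1 + x2 * a2) * b1 := by
    linear_combination a1 * hb + b1 * ha
  have f2 : (1 - (a1 * b1 + a2 * b2)) * (a1 + b1) = (a1 * b2 - a2 * b1) * (b2 - a2) := by
    linear_combination (-b1) * ha - a1 * hb
  have k1 : a1 * a2 + b1 * b2 = (a1 * b1 + a2 * b2) * (b2 * a1 + a2 * b1) := by
    linear_combination (-(b1 * b2)) * ha - a1 * a2 * hb
  have k2 : (a2 - b2) ^ 2 = (1 - (a1 * b1 + a2 * b2)) ^ 2 +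
      2 * (1 - (a1 * b1 + a2 * b2)) * (a1 * b1) := by
    linear_combination b1 ^ 2 * ha + (1 - a2 ^ 2) * hb
  rw [e1, e2]
  apply mul_left_cancel₀ hs
  linear_combination (-(1 + (x1 ^ 2 + x2 ^ 2))) * f2 - 2 * (b2 - a2) * h - 2 * x1 * k2 + 2 * x2 * k1

/-- A point of the geodesic from `a` to `b` is a positive combination of its end points. -/
theorem exists_comb {a b : Circle} {v : ℂ} (hv : ‖v‖ < 1) (hab : a ≠ b) (h : dt a b v = 0) :
    ∃ c d : ℝ, 0 < c ∧ 0 < d ∧ ∀ y z, dt v y z = c * dt a y z + d * dt b y z := by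
  have ha := circle_sq a
  have hb := circle_sq b
  have hne : (a : ℂ) ≠ b := fun h ↦ hab (Circle.ext h)
  have pos : ∀ x y : ℂ, x ≠ y → 0 < (x.re - y.re) ^ 2 + (x.im - y.im) ^ 2 := by
    intro x y hxy
    rcases eq_or_ne x.re y.re with h1 | h1
    · have h2 : x.im ≠ y.im := fun h2 ↦ hxy (Complex.ext h1 h2)
      have := sq_pos_of_ne_zero (sub_ne_zero.2 h2)
      positivity
    · have := sq_pos_of_ne_zero (sub_ne_zero.2 h1)
      positivity
  have hD := pos _ _ hne
  have nv : ∀ x : Circle, v ≠ x := by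
    rintro x rfl
    exact hv.ne (Circle.norm_coe x)
  have h1 := pos _ _ (nv a)
  have h2 := pos _ _ (nv b)
  refine ⟨_, _, div_pos h2 hD, div_pos h1 hD, fun y z ↦ ?_⟩
  unfold dt at h ⊢
  rw [ha, hb] at h
  rw [ha, hb]
  generalize (a : ℂ).re = a1 at *
  generalize (a : ℂ).im = a2 at *
  generalize (b : ℂ).re = b1 at *
  generalize (b : ℂ).im = b2 at *
  generalize v.re = x1 at *
  generalize v.im = x2 at *
  have e0 := comb_aux ha hb h hD.ne'
  have e1 := comb_aux' ha hb h hD.ne'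
  -- The second coordinate is the first one after a quarter turn of the plane.
  have e2 := comb_aux' (a1 := a2) (a2 := -a1) (b1 := b2) (b2 := -b1) (x1 := x2) (x2 := -x1)
    (by linarith) (by linarith) (by linear_combination h)
    (by rw [show (-a1 - -b1) ^ 2 = (a1 - b1) ^ 2 by ring, add_comm]; exact hD.ne')
  have hD' := hD.ne'
  have e0' : (1 + (x1 ^ 2 + x2 ^ 2)) / 2 = ((x1 - b1) ^ 2 + (x2 - b2) ^ 2) / ((a1 - b1) ^ 2 + (a2 - b2) ^ 2) +
      ((x1 - a1) ^ 2 + (x2 - a2) ^ 2) / ((a1 - b1) ^ 2 + (a2 - b2) ^ 2) := by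
    rw [← add_div, div_eq_div_iff two_ne_zero hD']
    linear_combination (-2) * e0 + (x1 ^ 2 + x2 ^ 2 - 1) * (ha + hb)
  have e1' : x1 = ((x1 - b1) ^ 2 + (x2 - b2) ^ 2) / ((a1 - b1) ^ 2 + (a2 - b2) ^ 2) * a1 +
      ((x1 - a1) ^ 2 + (x2 - a2) ^ 2) / ((a1 - b1) ^ 2 + (a2 - b2) ^ 2) * b1 := by
    rw [div_mul_eq_mul_div, div_mul_eq_mul_div, ← add_div, eq_div_iff hD']
    exact e1
  have e2' : x2 = ((x1 - b1) ^ 2 + (x2 - b2) ^ 2) / ((a1 - b1) ^ 2 + (a2 - b2) ^ 2) * a2 +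
      ((x1 - a1) ^ 2 + (x2 - a2) ^ 2) / ((a1 - b1) ^ 2 + (a2 - b2) ^ 2) * b2 := by
    rw [div_mul_eq_mul_div, div_mul_eq_mul_div, ← add_div, eq_div_iff hD']
    linear_combination e2
  generalize ((x1 - b1) ^ 2 + (x2 - b2) ^ 2) / ((a1 - b1) ^ 2 + (a2 - b2) ^ 2) = c at *
  generalize ((x1 - a1) ^ 2 + (x2 - a2) ^ 2) / ((a1 - b1) ^ 2 + (a2 - b2) ^ 2) = d at *
  rw [e0']
  linear_combination ((1 + (z.re ^ 2 + z.im ^ 2)) / 2 * y.im - (1 + (y.re ^ 2 + y.im ^ 2)) / 2 * z.im) * e1' + ((1 + (y.re ^ 2 + y.im ^ 2)) / 2 * z.re - (1 + (z.re ^ 2 + z.im ^ 2)) / 2 * y.re) * e2'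

/-- On the circle `dt` is twice the signed area of the triangle. The product of half-angle sines
lets its sign be read off from lifts of the points to the real line. -/
theorem dt_exp (x y z : ℝ) : dt (Circle.exp x) (Circle.exp y) (Circle.exp z) =
    4 * Real.sin ((y - x) / 2) * Real.sin ((z - y) / 2) * Real.sin ((z - x) / 2) := by
  unfold dt
  rw [circle_sq, circle_sq, circle_sq]
  simp only [Circle.coe_exp, Complex.exp_ofReal_mul_I_re, Complex.exp_ofReal_mul_I_im]
  have key : ∀ p q : ℝ, Real.sin (2 * q) + Real.sin (2 * p) - Real.sin (2 * (p + q)) =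
      4 * Real.sin p * Real.sin q * Real.sin (p + q) := by
    intro p q
    rw [Real.sin_two_mul, Real.sin_two_mul, Real.sin_two_mul, Real.sin_add, Real.cos_add]
    have h1 := Real.sin_sq_add_cos_sq p
    have h2 := Real.sin_sq_add_cos_sq q
    grind
  have := key ((y - x) / 2) ((z - y) / 2)
  rw [show (y - x) / 2 + (z - y) / 2 = (z - x) / 2 by ring] at this
  rw [← this, mul_div_cancel₀ _ two_ne_zero, mul_div_cancel₀ _ two_ne_zero,
    mul_div_cancel₀ _ two_ne_zero, Real.sin_sub, Real.sin_sub, Real.sin_sub]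
  ring

/-- A positive combination of two points of the disk in the Minkowski model. -/
theorem exists_point {v v' : ℂ} (hv : ‖v‖ < 1) (hv' : ‖v'‖ < 1) {l m : ℝ} (hl : 0 < l)
    (hm : 0 < m) : ∃ z : ℂ, ‖z‖ < 1 ∧ ∃ s : ℝ, 0 < s ∧
      ∀ x y, s * dt x y z = l * dt x y v + m * dt x y v' := by
  have hv2 : v.re ^ 2 + v.im ^ 2 < 1 := by
    rw [← norm_sq_eq]; nlinarith [norm_nonneg v]
  have hv2' : v'.re ^ 2 + v'.im ^ 2 < 1 := by
    rw [← norm_sq_eq]; nlinarith [norm_nonneg v']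
  set t := l * ((1 + (v.re ^ 2 + v.im ^ 2)) / 2) + m * ((1 + (v'.re ^ 2 + v'.im ^ 2)) / 2) with ht
  set a := l * v.re + m * v'.re with ha
  set b := l * v.im + m * v'.im with hb
  have htp : 0 < t := by positivity
  -- The future time-like cone is convex: both vectors are time-like, and `h3` bounds their mixed
  -- term.
  have key : a ^ 2 + b ^ 2 < t ^ 2 := by
    have h1 : v.re ^ 2 + v.im ^ 2 < ((1 + (v.re ^ 2 + v.im ^ 2)) / 2) ^ 2 := by
      nlinarith [sq_pos_of_pos (sub_pos.2 hv2)]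
    have h1' : v'.re ^ 2 + v'.im ^ 2 < ((1 + (v'.re ^ 2 + v'.im ^ 2)) / 2) ^ 2 := by
      nlinarith [sq_pos_of_pos (sub_pos.2 hv2')]
    have h3 : v.re * v'.re + v.im * v'.im ≤
        (1 + (v.re ^ 2 + v.im ^ 2)) / 2 * ((1 + (v'.re ^ 2 + v'.im ^ 2)) / 2) := by
      nlinarith [sq_nonneg (v.re - v'.re), sq_nonneg (v.im - v'.im),
        mul_pos (sub_pos.2 hv2) (sub_pos.2 hv2')]
    rw [ht, ha, hb]
    nlinarith [mul_lt_mul_of_pos_left h1 (sq_pos_of_pos hl),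
      mul_lt_mul_of_pos_left h1' (sq_pos_of_pos hm), mul_le_mul_of_nonneg_left h3 (mul_pos hl hm).le]
  -- `r` is the Minkowski length of `(t, a, b)`. Projecting the vector back to the disk gives `(a,
  -- b) / (t + r)`, with scaling factor `t + r`.
  obtain ⟨r, hr, hr2⟩ : ∃ r : ℝ, 0 < r ∧ r ^ 2 = t ^ 2 - (a ^ 2 + b ^ 2) :=
    ⟨√(t ^ 2 - (a ^ 2 + b ^ 2)), Real.sqrt_pos.2 (by linarith), Real.sq_sqrt (by linarith)⟩
  have htr : t + r ≠ 0 := by positivity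
  have hs : (1 + ((a / (t + r)) ^ 2 + (b / (t + r)) ^ 2)) / 2 = t / (t + r) := by
    field_simp
    linear_combination hr2
  refine ⟨⟨a / (t + r), b / (t + r)⟩, ?_, t + r, by positivity, fun x y ↦ ?_⟩
  · have h : ‖(⟨a / (t + r), b / (t + r)⟩ : ℂ)‖ ^ 2 < 1 := by
      rw [norm_sq_eq]
      have : t / (t + r) < 1 := by rw [div_lt_one (by positivity)]; linarith
      simp only
      linarith
    nlinarith [norm_nonneg (⟨a / (t + r), b / (t + r)⟩ : ℂ)]
  · unfold dt
    simp only [hs]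
    have : (t + r) * (t / (t + r)) = t := by field_simp
    have h1 : (t + r) * (a / (t + r)) = a := by field_simp
    have h2 : (t + r) * (b / (t + r)) = b := by field_simp
    generalize t / (t + r) = t' at *
    generalize a / (t + r) = a' at *
    generalize b / (t + r) = b' at *
    calc _ = (1 + (x.re ^ 2 + x.im ^ 2)) / 2 * (y.re * ((t + r) * b') - y.im * ((t + r) * a')) -
        (1 + (y.re ^ 2 + y.im ^ 2)) / 2 * (x.re * ((t + r) * b') - x.im * ((t + r) * a')) +
        ((t + r) * t') * (x.re * y.im - x.im * y.re) := by ring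
      _ = _ := by rw [this, h1, h2, ht, ha, hb]; ring

/-! ### Moebius transformations and the triple product -/

theorem norm_coe_le (u : Circle) : ‖(u : ℂ)‖ ≤ 1 := (Circle.norm_coe u).le

theorem su11_det (M : SU11) : M.1.1 0 0 * star (M.1.1 0 0) - M.1.1 0 1 * star (M.1.1 0 1) = 1 := by
  have hdet : M.1.1 0 0 * M.1.1 1 1 - M.1.1 0 1 * M.1.1 1 0 = 1 := by
    rw [← Matrix.det_fin_two]; exact M.1.2
  rwa [M.2.1, M.2.2] at hdet

theorem su11_det_re (M : SU11) : (M.1.1 0 0).re ^ 2 + (M.1.1 0 0).im ^ 2 -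
    ((M.1.1 0 1).re ^ 2 + (M.1.1 0 1).im ^ 2) = 1 := by
  have h := congrArg Complex.re (su11_det M)
  simp only [Complex.star_def, Complex.sub_re, Complex.mul_re, Complex.conj_re, Complex.conj_im,
    Complex.one_re] at h
  linear_combination h

/-- The square of the absolute value of the denominator of a Moebius transformation. -/
noncomputable def den (M : SU11) (z : ℂ) : ℝ := Complex.normSq (M.1.1 1 0 * z + M.1.1 1 1)

/-- The determinant forces `|a| > |b|`, so `conj b * z` cannot cancel `conj a` when `|z| ≤ 1`. -/
theorem den_ne (M : SU11) {z : ℂ} (hz : ‖z‖ ≤ 1) : M.1.1 1 0 * z + M.1.1 1 1 ≠ 0 := by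
  rw [M.2.1, M.2.2]
  intro h
  have hd := su11_det_re M
  rw [← norm_sq_eq, ← norm_sq_eq] at hd
  have h1 : ‖M.1.1 0 0‖ = ‖M.1.1 0 1‖ * ‖z‖ := by
    have : star (M.1.1 0 0) = -(star (M.1.1 0 1) * z) := by linear_combination h
    rw [← norm_star, this, norm_neg, norm_mul, norm_star]
  have h2 : ‖M.1.1 0 0‖ ≤ ‖M.1.1 0 1‖ := by
    rw [h1]; exact mul_le_of_le_one_right (norm_nonneg _) hz
  nlinarith [norm_nonneg (M.1.1 0 0), norm_nonneg (M.1.1 0 1)]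

theorem den_pos (M : SU11) {z : ℂ} (hz : ‖z‖ ≤ 1) : 0 < den M z :=
  Complex.normSq_pos.2 (den_ne M hz)

/-- The determinant of a product of matrices of size three. -/
theorem det_mul_three (l : Fin 3 → Fin 3 → ℝ) (x y z : Fin 3 → ℝ) (x' y' z' : Fin 3 → ℝ)
    (hx : ∀ i, x' i = l i 0 * x 0 + l i 1 * x 1 + l i 2 * x 2)
    (hy : ∀ i, y' i = l i 0 * y 0 + l i 1 * y 1 + l i 2 * y 2)
    (hz : ∀ i, z' i = l i 0 * z 0 + l i 1 * z 1 + l i 2 * z 2) :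
    x' 0 * (y' 1 * z' 2 - y' 2 * z' 1) - y' 0 * (x' 1 * z' 2 - x' 2 * z' 1) +
      z' 0 * (x' 1 * y' 2 - x' 2 * y' 1) =
    (l 0 0 * (l 1 1 * l 2 2 - l 1 2 * l 2 1) - l 0 1 * (l 1 0 * l 2 2 - l 1 2 * l 2 0) +
      l 0 2 * (l 1 0 * l 2 1 - l 1 1 * l 2 0)) *
    (x 0 * (y 1 * z 2 - y 2 * z 1) - y 0 * (x 1 * z 2 - x 2 * z 1) +
      z 0 * (x 1 * y 2 - x 2 * y 1)) := by
  simp only [hx, hy, hz]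
  ring

/-- The vector of Minkowski space that belongs to a complex number. -/
noncomputable def hat (z : ℂ) : Fin 3 → ℝ := ![(1 + (z.re ^ 2 + z.im ^ 2)) / 2, z.re, z.im]

/-- The matrix of a Moebius transformation acting on Minkowski space. -/
noncomputable def lor (a b : ℂ) : Fin 3 → Fin 3 → ℝ :=
  ![![a.re ^ 2 + a.im ^ 2 + b.re ^ 2 + b.im ^ 2, 2 * (a.re * b.re + a.im * b.im),
      2 * (a.re * b.im - a.im * b.re)],
    ![2 * (a.re * b.re - a.im * b.im), a.re ^ 2 - a.im ^ 2 + (b.re ^ 2 - b.im ^ 2),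
      -2 * a.re * a.im + 2 * b.re * b.im],
    ![2 * (a.re * b.im + a.im * b.re), 2 * a.re * a.im + 2 * b.re * b.im,
      a.re ^ 2 - a.im ^ 2 - (b.re ^ 2 - b.im ^ 2)]]

theorem hat_mob (M : SU11) {z : ℂ} (hz : ‖z‖ ≤ 1) (i : Fin 3) :
    den M z * hat (mob M z) i = lor (M.1.1 0 0) (M.1.1 0 1) i 0 * hat z 0 +
      lor (M.1.1 0 0) (M.1.1 0 1) i 1 * hat z 1 + lor (M.1.1 0 0) (M.1.1 0 1) i 2 * hat z 2 := by
  have hd := (den_pos M hz).ne'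
  unfold den at hd ⊢
  unfold mob
  rw [M.2.1, M.2.2] at *
  have hn := su11_det_re M
  generalize M.1.1 0 0 = a at *
  generalize M.1.1 0 1 = b at *
  have hre : (((a * z + b) / (star b * z + star a)).re) =
      ((a * z + b) * star (star b * z + star a)).re / Complex.normSq (star b * z + star a) := by
    simp [Complex.div_re]; ring
  have him : (((a * z + b) / (star b * z + star a)).im) =
      ((a * z + b) * star (star b * z + star a)).im / Complex.normSq (star b * z + star a) := by
    simp [Complex.div_im]; ring
  have hsq : (((a * z + b) / (star b * z + star a)).re) ^ 2 +
      (((a * z + b) / (star b * z + star a)).im) ^ 2 =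
      Complex.normSq (a * z + b) / Complex.normSq (star b * z + star a) := by
    rw [← norm_sq_eq, ← Complex.normSq_eq_norm_sq, Complex.normSq_div]
  fin_cases i
  · simp only [hat, lor, hsq, Fin.zero_eta, Matrix.cons_val]
    field_simp
    simp only [Complex.normSq_apply, Complex.add_re, Complex.add_im, Complex.mul_re,
      Complex.mul_im, Complex.star_def, Complex.conj_re, Complex.conj_im]
    ring
  · simp only [hat, lor, hre, Fin.mk_one, Matrix.cons_val]
    field_simp
    simp only [Complex.add_re, Complex.add_im, Complex.mul_re,
      Complex.mul_im, Complex.star_def, Complex.conj_re, Complex.conj_im]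
    ring
  · simp only [hat, lor, him, Fin.reduceFinMk, Matrix.cons_val]
    field_simp
    simp only [Complex.add_re, Complex.add_im, Complex.mul_re,
      Complex.mul_im, Complex.star_def, Complex.conj_re, Complex.conj_im]
    ring

/-- In Minkowski space the transformation is linear up to the scalar `den`, and its matrix has
determinant `(|a|² - |b|²)³ = 1`. -/
theorem dt_mob (M : SU11) {x y z : ℂ} (hx : ‖x‖ ≤ 1) (hy : ‖y‖ ≤ 1) (hz : ‖z‖ ≤ 1) :
    den M x * den M y * den M z * dt (mob M x) (mob M y) (mob M z) = dt x y z := by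
  have h := det_mul_three (lor (M.1.1 0 0) (M.1.1 0 1)) (hat x) (hat y) (hat z)
    (fun i ↦ den M x * hat (mob M x) i) (fun i ↦ den M y * hat (mob M y) i)
    (fun i ↦ den M z * hat (mob M z) i) (hat_mob M hx) (hat_mob M hy) (hat_mob M hz)
  have hn := su11_det_re M
  have hl : ∀ a b : ℂ, lor a b 0 0 * (lor a b 1 1 * lor a b 2 2 - lor a b 1 2 * lor a b 2 1) -
      lor a b 0 1 * (lor a b 1 0 * lor a b 2 2 - lor a b 1 2 * lor a b 2 0) +
      lor a b 0 2 * (lor a b 1 0 * lor a b 2 1 - lor a b 1 1 * lor a b 2 0) =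
      (a.re ^ 2 + a.im ^ 2 - (b.re ^ 2 + b.im ^ 2)) ^ 3 := by
    intro a b
    simp only [lor, Matrix.cons_val]
    ring
  rw [hl, hn, one_pow, one_mul] at h
  have e : ∀ x y z, dt x y z = hat x 0 * (hat y 1 * hat z 2 - hat y 2 * hat z 1) -
      hat y 0 * (hat x 1 * hat z 2 - hat x 2 * hat z 1) +
      hat z 0 * (hat x 1 * hat y 2 - hat x 2 * hat y 1) := fun x y z ↦ rfl
  rw [e x y z, ← h, e]
  ring

theorem dt_mob_pos (M : SU11) {x y z : ℂ} (hx : ‖x‖ ≤ 1) (hy : ‖y‖ ≤ 1) (hz : ‖z‖ ≤ 1) :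
    0 < dt (mob M x) (mob M y) (mob M z) ↔ 0 < dt x y z := by
  rw [← dt_mob M hx hy hz]
  exact (mul_pos_iff_of_pos_left
    (mul_pos (mul_pos (den_pos M hx) (den_pos M hy)) (den_pos M hz))).symm

theorem dt_mob_eq_zero (M : SU11) {x y z : ℂ} (hx : ‖x‖ ≤ 1) (hy : ‖y‖ ≤ 1) (hz : ‖z‖ ≤ 1) :
    dt (mob M x) (mob M y) (mob M z) = 0 ↔ dt x y z = 0 := by
  have := (mul_pos (mul_pos (den_pos M hx) (den_pos M hy)) (den_pos M hz)).ne'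
  rw [← dt_mob M hx hy hz]
  simp [this]

theorem coe_mobCircle (M : SU11) (z : Circle) : (mobCircle M z : ℂ) = mob M z := rfl

theorem side_mob_pos (M : SU11) (u w : Circle) {z : ℂ} (hz : ‖z‖ < 1) :
    0 < side (mobCircle M u) (mobCircle M w) (mob M z) ↔ 0 < side u w z := by
  have := dt_mob_pos M (norm_coe_le u) (norm_coe_le w) hz.le
  rw [side_eq, side_eq, coe_mobCircle, coe_mobCircle]
  simpa using this

theorem ccw_mob (M : SU11) (a b c : Circle) :
    Ccw (mobCircle M a) (mobCircle M b) (mobCircle M c) ↔ Ccw a b c := by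
  rw [ccw_iff, ccw_iff]
  exact dt_mob_pos M (norm_coe_le a) (norm_coe_le b) (norm_coe_le c)

theorem mob_mul (M N : SU11) {z : ℂ} (hz : ‖z‖ ≤ 1) : mob (M * N) z = mob M (mob N z) := by
  have h := den_ne N hz
  unfold mob
  simp only [Subgroup.coe_mul, Matrix.SpecialLinearGroup.coe_mul, Matrix.mul_apply,
    Fin.sum_univ_two]
  have e1 : M.1.1 0 0 * ((N.1.1 0 0 * z + N.1.1 0 1) / (N.1.1 1 0 * z + N.1.1 1 1)) + M.1.1 0 1 =
      ((M.1.1 0 0 * N.1.1 0 0 + M.1.1 0 1 * N.1.1 1 0) * z +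
        (M.1.1 0 0 * N.1.1 0 1 + M.1.1 0 1 * N.1.1 1 1)) / (N.1.1 1 0 * z + N.1.1 1 1) := by
    rw [eq_div_iff h, add_mul, mul_assoc, div_mul_cancel₀ _ h]; ring
  have e2 : M.1.1 1 0 * ((N.1.1 0 0 * z + N.1.1 0 1) / (N.1.1 1 0 * z + N.1.1 1 1)) + M.1.1 1 1 =
      ((M.1.1 1 0 * N.1.1 0 0 + M.1.1 1 1 * N.1.1 1 0) * z +
        (M.1.1 1 0 * N.1.1 0 1 + M.1.1 1 1 * N.1.1 1 1)) / (N.1.1 1 0 * z + N.1.1 1 1) := by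
    rw [eq_div_iff h, add_mul, mul_assoc, div_mul_cancel₀ _ h]; ring
  rw [e1, e2, div_div_div_cancel_right₀ h]

theorem mobCircle_mul (M N : SU11) (z : Circle) :
    mobCircle (M * N) z = mobCircle M (mobCircle N z) :=
  Circle.ext (mob_mul M N (norm_coe_le z))

theorem mob_one (z : ℂ) : mob 1 z = z := by simp [mob]

theorem mobCircle_one (z : Circle) : mobCircle 1 z = z := Circle.ext (mob_one _)

/-- Carries the identity from the open disk to its boundary: the fixed-point equation at `0` and `1
/ 2` already forces the matrix to be scalar. -/
theorem mob_eq_of_actsAsId {M : SU11} (h : ActsAsId M) {z : ℂ} (hz : ‖z‖ ≤ 1) : mob M z = z := by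
  have key : ∀ z : ℂ, ‖z‖ < 1 → M.1.1 0 0 * z + M.1.1 0 1 = z * (M.1.1 1 0 * z + M.1.1 1 1) :=
    fun z hz ↦ (div_eq_iff (den_ne M hz.le)).1 (h z hz)
  have h0 := key 0 (by simp)
  have h1 := key (1 / 2) (by norm_num)
  have h2 := key (-1 / 2) (by norm_num)
  have hb : M.1.1 0 1 = 0 := by linear_combination h0
  have hc : M.1.1 1 0 = 0 := by rw [M.2.2, hb, star_zero]
  have hd : M.1.1 0 0 = M.1.1 1 1 := by
    rw [hb, hc] at h1
    linear_combination 2 * h1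
  unfold mob
  rw [div_eq_iff (den_ne M hz), hb, hc, hd]
  ring

theorem mobCircle_eq_of_actsAsId {M : SU11} (h : ActsAsId M) (z : Circle) : mobCircle M z = z :=
  Circle.ext (mob_eq_of_actsAsId h (norm_coe_le z))

theorem mobCircle_inv_apply (M : SU11) (z : Circle) : mobCircle M⁻¹ (mobCircle M z) = z := by
  rw [← mobCircle_mul, inv_mul_cancel, mobCircle_one]

theorem mobCircle_apply_inv (M : SU11) (z : Circle) : mobCircle M (mobCircle M⁻¹ z) = z := by
  rw [← mobCircle_mul, mul_inv_cancel, mobCircle_one]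

theorem mobCircle_injective (M : SU11) : Function.Injective (mobCircle M) :=
  Function.LeftInverse.injective (mobCircle_inv_apply M)

theorem mob_norm_lt (M : SU11) {z : ℂ} (hz : ‖z‖ < 1) : ‖mob M z‖ < 1 := by
  have hd := su11_det_re M
  have hne := den_ne M hz.le
  have hz2 : z.re ^ 2 + z.im ^ 2 < 1 := by rw [← norm_sq_eq]; nlinarith [norm_nonneg z]
  unfold mob
  rw [norm_div, div_lt_one (norm_pos_iff.2 hne)]
  refine lt_of_pow_lt_pow_left₀ 2 (norm_nonneg _) ?_
  rw [norm_sq_eq, norm_sq_eq, M.2.1, M.2.2]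
  simp only [Complex.add_re, Complex.add_im, Complex.mul_re,
      Complex.mul_im, Complex.star_def, Complex.conj_re, Complex.conj_im]
  nlinarith

theorem continuous_mobCircle (M : SU11) : Continuous (mobCircle M) := by
  refine Continuous.subtype_mk ?_ _
  unfold mob
  refine Continuous.div (by fun_prop) (by fun_prop) fun z ↦ den_ne M (norm_coe_le z)

/-- A Moebius transformation as a homeomorphism of the space of pairs. -/
noncomputable def mobPairHomeo (M : SU11) : Circle × Circle ≃ₜ Circle × Circle where
  toFun := mobPair M
  invFun := mobPair M⁻¹
  left_inv p := Prod.ext (mobCircle_inv_apply M p.1) (mobCircle_inv_apply M p.2)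
  right_inv p := Prod.ext (mobCircle_apply_inv M p.1) (mobCircle_apply_inv M p.2)
  continuous_toFun := ((continuous_mobCircle M).comp continuous_fst).prodMk
    ((continuous_mobCircle M).comp continuous_snd)
  continuous_invFun := ((continuous_mobCircle M⁻¹).comp continuous_fst).prodMk
    ((continuous_mobCircle M⁻¹).comp continuous_snd)

/-! ### Arcs and their lifts to the real line -/

theorem exists_lift (w : Circle) (x : ℝ) :
    ∃ y, x ≤ y ∧ y < x + 2 * Real.pi ∧ Circle.exp y = w := by
  refine ⟨toIcoMod Real.two_pi_pos x (Complex.arg w), (toIcoMod_mem_Ico _ _ _).1,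
    (toIcoMod_mem_Ico _ _ _).2, ?_⟩
  rw [toIcoMod, Circle.periodic_exp.sub_zsmul_eq, Circle.exp_arg]

theorem exp_inj_of_lt {x y : ℝ} (h : Circle.exp x = Circle.exp y) (h1 : x < y + 2 * Real.pi)
    (h2 : y < x + 2 * Real.pi) : x = y := by
  obtain ⟨m, rfl⟩ := Circle.exp_eq_exp.1 h
  have hpi := Real.two_pi_pos
  have a1 : (m : ℝ) < 1 := by nlinarith
  have a2 : (-1 : ℝ) < m := by nlinarith
  have : m = 0 := by
    have b1 : m < 1 := by exact_mod_cast a1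
    have b2 : -1 < m := by exact_mod_cast a2
    omega
  simp [this]

theorem exp_ne_of_lt {x y : ℝ} (h1 : x < y) (h2 : y < x + 2 * Real.pi) :
    Circle.exp x ≠ Circle.exp y :=
  fun h ↦ h1.ne (exp_inj_of_lt h (by linarith [Real.two_pi_pos]) h2)

theorem sin_half_pos {x : ℝ} (h1 : 0 < x) (h2 : x < 2 * Real.pi) : 0 < Real.sin (x / 2) :=
  Real.sin_pos_of_pos_of_lt_pi (by linarith) (by linarith)

theorem sin_half_nonneg {x : ℝ} (h1 : 0 ≤ x) (h2 : x ≤ 2 * Real.pi) : 0 ≤ Real.sin (x / 2) :=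
  Real.sin_nonneg_of_nonneg_of_le_pi (by linarith) (by linarith)

theorem dt_exp_pos {x y z : ℝ} (h1 : x < y) (h2 : y < z) (h3 : z < x + 2 * Real.pi) :
    0 < dt (Circle.exp x) (Circle.exp y) (Circle.exp z) := by
  rw [dt_exp]
  have a1 := sin_half_pos (sub_pos.2 h1) (by linarith)
  have a2 := sin_half_pos (sub_pos.2 h2) (by linarith)
  have a3 := sin_half_pos (sub_pos.2 (h1.trans h2)) (by linarith)
  positivity

theorem dt_exp_nonneg {x y z : ℝ} (h1 : x ≤ y) (h2 : y ≤ z) (h3 : z ≤ x + 2 * Real.pi) :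
    0 ≤ dt (Circle.exp x) (Circle.exp y) (Circle.exp z) := by
  rw [dt_exp]
  have a1 := sin_half_nonneg (sub_nonneg.2 h1) (by linarith)
  have a2 := sin_half_nonneg (sub_nonneg.2 h2) (by linarith)
  have a3 := sin_half_nonneg (sub_nonneg.2 (h1.trans h2)) (by linarith)
  positivity

/-- Once all lifts lie in one period starting at `x`, cyclic order is linear order. This is the
dictionary behind all later arguments with lifts. -/
theorem ccw_exp {x y z : ℝ} (h1 : x ≤ y) (h2 : y < x + 2 * Real.pi) (h3 : x ≤ z)
    (h4 : z < x + 2 * Real.pi) :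
    Ccw (Circle.exp x) (Circle.exp y) (Circle.exp z) ↔ x < y ∧ y < z := by
  rw [ccw_iff]
  constructor
  · intro h
    by_contra hn
    have hle : x = y ∨ z ≤ y := by
      rcases h1.eq_or_lt with h | h
      · exact .inl h
      · exact .inr (not_lt.1 fun h' ↦ hn ⟨h, h'⟩)
    rcases hle with rfl | hle
    · rw [dt_self] at h; exact lt_irrefl _ h
    · rw [dt_swap'] at h
      linarith [dt_exp_nonneg h3 hle h2.le]
  · rintro ⟨a, b⟩
    exact dt_exp_pos a b h4

theorem mem_arcIcc_exp {a b : ℝ} (h1 : a ≤ b) (h2 : b < a + 2 * Real.pi) (w : Circle) :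
    w ∈ arcIcc (Circle.exp a) (Circle.exp b) ↔ ∃ x, a ≤ x ∧ x ≤ b ∧ Circle.exp x = w := by
  constructor
  · rintro (rfl | rfl | h)
    · exact ⟨a, le_rfl, h1, rfl⟩
    · exact ⟨b, h1, le_rfl, rfl⟩
    · obtain ⟨x, hx1, hx2, rfl⟩ := exists_lift w a
      rw [ccw_exp hx1 hx2 h1 h2] at h
      exact ⟨x, hx1, h.2.le, rfl⟩
  · rintro ⟨x, hx1, hx2, rfl⟩
    rcases hx1.eq_or_lt with rfl | hx1
    · exact .inl rfl
    rcases hx2.eq_or_lt with rfl | hx2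
    · exact .inr (.inl rfl)
    · exact .inr (.inr ((ccw_exp hx1.le (hx2.trans h2) h1 h2).2 ⟨hx1, hx2⟩))

theorem mem_arcIco_exp {a b : ℝ} (h1 : a ≤ b) (h2 : b < a + 2 * Real.pi) (w : Circle) :
    w ∈ arcIco (Circle.exp a) (Circle.exp b) ↔ ∃ x, a ≤ x ∧ x < b ∧ Circle.exp x = w := by
  constructor
  · rintro ⟨hb, rfl | h⟩
    · exact ⟨a, le_rfl, h1.lt_of_ne fun h ↦ hb (by rw [h]), rfl⟩
    · obtain ⟨x, hx1, hx2, rfl⟩ := exists_lift w a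
      rw [ccw_exp hx1 hx2 h1 h2] at h
      exact ⟨x, hx1, h.2, rfl⟩
  · rintro ⟨x, hx1, hx2, rfl⟩
    refine ⟨exp_ne_of_lt hx2 (by linarith), ?_⟩
    rcases hx1.eq_or_lt with rfl | hx1
    · exact .inl rfl
    · exact .inr ((ccw_exp hx1.le (hx2.trans h2) h1 h2).2 ⟨hx1, hx2⟩)

theorem arcIcc_exp {a b : ℝ} (h1 : a ≤ b) (h2 : b < a + 2 * Real.pi) :
    arcIcc (Circle.exp a) (Circle.exp b) = Circle.exp '' Icc a b := by
  ext w
  rw [mem_arcIcc_exp h1 h2]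
  simp [and_assoc]

theorem arcIco_exp {a b : ℝ} (h1 : a ≤ b) (h2 : b < a + 2 * Real.pi) :
    arcIco (Circle.exp a) (Circle.exp b) = Circle.exp '' Ico a b := by
  ext w
  rw [mem_arcIco_exp h1 h2]
  simp [and_assoc]

theorem isClosed_arcIcc (a b : Circle) : IsClosed (arcIcc a b) := by
  obtain ⟨x, -, -, rfl⟩ := exists_lift a 0
  obtain ⟨y, h1, h2, rfl⟩ := exists_lift b x
  rw [arcIcc_exp h1 h2]
  exact (isCompact_Icc.image Circle.exp.continuous).isClosed

theorem arcIco_subset_arcIcc (a b : Circle) : arcIco a b ⊆ arcIcc a b := by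
  rintro x ⟨-, h | h⟩
  · exact .inl h
  · exact .inr (.inr h)

/-- For `a = b` the half-open arc is empty while the closed one is `{a}`, hence the hypothesis. -/
theorem closure_arcIco {a b : Circle} (hab : a ≠ b) : closure (arcIco a b) = arcIcc a b := by
  apply subset_antisymm
  · exact closure_minimal (arcIco_subset_arcIcc a b) (isClosed_arcIcc a b)
  · obtain ⟨x, -, -, rfl⟩ := exists_lift a 0
    obtain ⟨y, h1, h2, rfl⟩ := exists_lift b x
    have h1' : x ≠ y := fun h ↦ hab (by rw [h])
    rw [arcIcc_exp h1 h2, arcIco_exp h1 h2, ← closure_Ico h1']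
    exact image_closure_subset_closure_image Circle.exp.continuous

theorem mobCircle_image_arcIcc (M : SU11) (a b : Circle) {x : Circle} :
    mobCircle M x ∈ arcIcc (mobCircle M a) (mobCircle M b) ↔ x ∈ arcIcc a b := by
  simp only [arcIcc, mem_ofPred_eq, (mobCircle_injective M).eq_iff, ccw_mob]

theorem mobCircle_image_arcIco (M : SU11) (a b : Circle) {x : Circle} :
    mobCircle M x ∈ arcIco (mobCircle M a) (mobCircle M b) ↔ x ∈ arcIco a b := by
  simp only [arcIco, mem_ofPred_eq, (mobCircle_injective M).eq_iff, ccw_mob, ne_eq]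

theorem dt_eq_zero {a b c : Circle} (hab : a ≠ b) (h : dt a b c = 0) : c = a ∨ c = b := by
  obtain ⟨x, -, -, rfl⟩ := exists_lift a 0
  obtain ⟨y, hy1, hy2, rfl⟩ := exists_lift b x
  obtain ⟨z, hz1, hz2, rfl⟩ := exists_lift c x
  have hxy : x < y := hy1.lt_of_ne fun h ↦ hab (by rw [h])
  by_contra hn
  push Not at hn
  have hxz : x < z := hz1.lt_of_ne fun h ↦ hn.1 (by rw [h])
  rcases lt_trichotomy y z with h1 | h1 | h1
  · exact (dt_exp_pos hxy h1 hz2).ne' h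
  · exact hn.2 (by rw [h1])
  · have := dt_exp_pos hxz h1 hy2
    rw [dt_swap', h] at this
    simp at this

/-- The geodesic through `v` with end points `exp x` and `exp y`, compared with a geodesic whose
end points lie on one side of it. -/
theorem dt_nonneg_of_line {x y s t : ℝ} {v : ℂ} (hv : ‖v‖ < 1)
    (h : dt (Circle.exp x) (Circle.exp y) v = 0) (hy : y < x + 2 * Real.pi)
    (hs : x ≤ s) (hst : s < t) (ht : t ≤ y) : 0 ≤ dt (Circle.exp s) (Circle.exp t) v := by
  obtain ⟨c, d, hc, hd, hcd⟩ := exists_comb hv (exp_ne_of_lt (by linarith : x < y) hy) h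
  rw [dt_cyc, dt_cyc, hcd]
  have h1 := dt_exp_nonneg hs hst.le (by linarith)
  have h2 := dt_exp_nonneg hst.le ht (by linarith)
  rw [dt_cyc, dt_cyc] at h2
  positivity

theorem dt_pos_of_line {x y s t : ℝ} {v : ℂ} (hv : ‖v‖ < 1)
    (h : dt (Circle.exp x) (Circle.exp y) v = 0) (hy : y < x + 2 * Real.pi)
    (hs : x ≤ s) (hst : s < t) (ht : t ≤ y) (hne : x < s ∨ t < y) :
    0 < dt (Circle.exp s) (Circle.exp t) v := by
  obtain ⟨c, d, hc, hd, hcd⟩ := exists_comb hv (exp_ne_of_lt (by linarith : x < y) hy) h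
  rw [dt_cyc, dt_cyc, hcd]
  have h1 := dt_exp_nonneg hs hst.le (by linarith)
  have h2 := dt_exp_nonneg hst.le ht (by linarith)
  rw [dt_cyc, dt_cyc] at h2
  rcases hne with hne | hne
  · have h1 := dt_exp_pos hne hst (by linarith)
    positivity
  · have h2 := dt_exp_pos hst hne (by linarith)
    rw [dt_cyc, dt_cyc] at h2
    positivity

/-- Two geodesics with the same starting point through a point coincide. -/
theorem eq_of_dt_eq_zero {a b c : Circle} {v : ℂ} (hv : ‖v‖ < 1) (hab : a ≠ b) (hac : a ≠ c)
    (hb : dt a b v = 0) (hc : dt a c v = 0) : b = c := by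
  obtain ⟨k, l, hk, hl, hkl⟩ := exists_comb hv hab hb
  rw [dt_cyc, dt_cyc, hkl, dt_self, mul_zero, zero_add, mul_eq_zero] at hc
  rcases hc with hc | hc
  · exact absurd hc hl.ne'
  · rw [dt_cyc] at hc
    rcases dt_eq_zero hac hc with h | h
    · exact absurd h.symm hab
    · exact h

/-- Cyclic transitivity. -/
theorem ccw_trans {a b c d : Circle} (h1 : Ccw a b c) (h2 : Ccw a c d) : Ccw b c d := by
  obtain ⟨x, -, -, rfl⟩ := exists_lift a 0
  obtain ⟨y, hy1, hy2, rfl⟩ := exists_lift b x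
  obtain ⟨z, hz1, hz2, rfl⟩ := exists_lift c x
  obtain ⟨t, ht1, ht2, rfl⟩ := exists_lift d x
  rw [ccw_exp hy1 hy2 hz1 hz2] at h1
  rw [ccw_exp hz1 hz2 ht1 ht2] at h2
  rw [ccw_iff]
  exact dt_exp_pos h1.2 h2.2 (by linarith)

/-! ### Index arithmetic -/

section
variable {g : ℕ}

theorem eight_mul_sub_four (hg : 2 ≤ g) : (8 * (g : ZMod (8 * g - 4)) - 4) = 0 := by
  have h : ((8 * g - 4 : ℕ) : ZMod (8 * g - 4)) = 0 := ZMod.natCast_self _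
  rw [Nat.cast_sub (by omega)] at h
  exact_mod_cast h

/-- Since `8g - 4` is even, parity is reduction to `ZMod 2`, where statements about it can be
decided by inspection. -/
theorem odd_val_iff (hg : 2 ≤ g) (i : ZMod (8 * g - 4)) :
    Odd i.val ↔ ZMod.castHom (show 2 ∣ 8 * g - 4 by omega) (ZMod 2) i = 1 := by
  have : NeZero (8 * g - 4) := ⟨by omega⟩
  rw [ZMod.castHom_apply, ← ZMod.natCast_val, ZMod.natCast_eq_one_iff_odd]

theorem odd_val_sub (hg : 2 ≤ g) (i : ZMod (8 * g - 4)) :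
    Odd (4 * (g : ZMod (8 * g - 4)) - i).val ↔ Odd i.val := by
  rw [odd_val_iff hg, odd_val_iff hg, map_sub, map_mul]
  generalize ZMod.castHom (show 2 ∣ 8 * g - 4 by omega) (ZMod 2) i = x
  rw [show (4 : ZMod (8 * g - 4)) = ((4 : ℕ) : ZMod (8 * g - 4)) by norm_cast, map_natCast,
    show ((4 : ℕ) : ZMod 2) = 0 from rfl, zero_mul]
  revert x; decide

theorem odd_val_sub' (hg : 2 ≤ g) (i : ZMod (8 * g - 4)) : Odd (2 - i).val ↔ Odd i.val := by
  rw [odd_val_iff hg, odd_val_iff hg, map_sub]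
  generalize ZMod.castHom (show 2 ∣ 8 * g - 4 by omega) (ZMod 2) i = x
  rw [show (2 : ZMod (8 * g - 4)) = ((2 : ℕ) : ZMod (8 * g - 4)) by norm_cast, map_natCast,
    show ((2 : ℕ) : ZMod 2) = 0 from rfl]
  revert x; decide

theorem odd_val_add_one (hg : 2 ≤ g) (i : ZMod (8 * g - 4)) : Odd (i + 1).val ↔ ¬ Odd i.val := by
  rw [odd_val_iff hg, odd_val_iff hg, map_add, map_one]
  generalize ZMod.castHom (show 2 ∣ 8 * g - 4 by omega) (ZMod 2) i = x
  revert x; decide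

theorem sigma_of_odd {i : ZMod (8 * g - 4)} (h : Odd i.val) : sigma i = 4 * g - i := if_pos h

theorem sigma_of_not_odd {i : ZMod (8 * g - 4)} (h : ¬ Odd i.val) : sigma i = 2 - i := if_neg h

theorem odd_sigma (hg : 2 ≤ g) (i : ZMod (8 * g - 4)) : Odd (sigma i).val ↔ Odd i.val := by
  by_cases h : Odd i.val
  · rw [sigma_of_odd h, odd_val_sub hg]
  · rw [sigma_of_not_odd h, odd_val_sub' hg]

theorem sigma_sigma (hg : 2 ≤ g) (i : ZMod (8 * g - 4)) : sigma (sigma i) = i := by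
  by_cases h : Odd i.val
  · rw [sigma_of_odd ((odd_sigma hg i).2 h), sigma_of_odd h]; ring
  · rw [sigma_of_not_odd (fun h' ↦ h ((odd_sigma hg i).1 h')), sigma_of_not_odd h]; ring

theorem tau_tau (hg : 2 ≤ g) (i : ZMod (8 * g - 4)) : tau (tau i) = i := by
  unfold tau
  linear_combination eight_mul_sub_four hg

theorem odd_tau_sub_one (hg : 2 ≤ g) (i : ZMod (8 * g - 4)) : Odd (tau i - 1).val ↔ ¬ Odd i.val := by
  rw [← odd_val_sub hg, show 4 * (g : ZMod (8 * g - 4)) - (tau i - 1) = 2 - i + 1 by unfold tau; ring,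
    odd_val_add_one hg, odd_val_sub' hg]

/-- `τ i - 1` differs from `i` by the odd number `4g - 3`, so `sigma` uses its other branch there,
and the two values agree modulo `8g - 4`. The relation `rho ∘ rho = tau` and the form of `U` both
rest on this. -/
theorem sigma_tau_sub_one (hg : 2 ≤ g) (i : ZMod (8 * g - 4)) :
    sigma (tau i - 1) = sigma i + 1 := by
  by_cases h : Odd i.val
  · rw [sigma_of_odd h, sigma_of_not_odd (fun h' ↦ (odd_tau_sub_one hg i).1 h' h)]
    unfold tau
    linear_combination -eight_mul_sub_four hg
  · rw [sigma_of_not_odd h, sigma_of_odd ((odd_tau_sub_one hg i).2 h)]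
    unfold tau
    ring

theorem rho_rho (hg : 2 ≤ g) (i : ZMod (8 * g - 4)) : rho (rho i) = tau i := by
  have h := congrArg sigma (sigma_tau_sub_one hg i)
  rw [sigma_sigma hg] at h
  unfold rho
  rw [← h, sub_add_cancel]

theorem rho_tau (hg : 2 ≤ g) (i : ZMod (8 * g - 4)) : rho (tau i) = sigma (i - 1) := by
  have := sigma_tau_sub_one hg (tau i)
  rw [tau_tau hg] at this
  exact this.symm

theorem rho_rho_rho_rho (hg : 2 ≤ g) (i : ZMod (8 * g - 4)) : rho (rho (rho (rho i))) = i := by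
  rw [rho_rho hg, rho_rho hg, tau_tau hg]

theorem tau_add_one (i : ZMod (8 * g - 4)) : tau (i + 1) = tau i + 1 := by unfold tau; ring

end

namespace PolygonData

variable {g : ℕ} {D : PolygonData g}

/-! ### The end points of the sides on the real line -/

/-- A lift of the sequence `P 1, Q 1, P 2, Q 2, …` to the real line. -/
structure IsLift (D : PolygonData g) (e : ℤ → ℝ) : Prop where
  mono : StrictMono e
  per : ∀ n : ℤ, e (n + 2 * (8 * (g : ℤ) - 4)) = e n + 2 * Real.pi
  P_eq : ∀ n : ℤ, D.P (n : ZMod (8 * g - 4)) = Circle.exp (e (2 * n))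
  Q_eq : ∀ n : ℤ, D.Q (n : ZMod (8 * g - 4)) = Circle.exp (e (2 * n + 1))

theorem IsFundamentalPolygon.exists_isLift (hD : D.IsFundamentalPolygon) : ∃ e, IsLift D e := by
  obtain ⟨α, β, h1, h2, h3, h4⟩ := hD.order
  refine ⟨fun N ↦ if Even N then α (N / 2) else β (N / 2), ?_, ?_, ?_, ?_⟩
  · refine strictMono_int_of_lt_succ fun N ↦ ?_
    obtain ⟨k, rfl | rfl⟩ := Int.even_or_odd' N
    · have a1 : ¬ Even (2 * k + 1) := by simp
      have a2 : (2 * k + 1) / 2 = k := by omega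
      have a3 : 2 * k / 2 = k := by omega
      simpa only [even_two_mul, if_true, a1, if_false, a2, a3] using (h1 k).1
    · have a1 : ¬ Even (2 * k + 1) := by simp
      have a4 : 2 * k + 1 + 1 = 2 * (k + 1) := by ring
      have a2 : (2 * k + 1) / 2 = k := by omega
      have a3 : 2 * (k + 1) / 2 = k + 1 := by omega
      simpa only [a4, even_two_mul, if_true, a1, if_false, a2, a3] using (h1 k).2
  · intro N
    have a1 : Even (N + 2 * (8 * (g : ℤ) - 4)) ↔ Even N := by simp [Int.even_add]
    have a2 : (N + 2 * (8 * (g : ℤ) - 4)) / 2 = N / 2 + (8 * (g : ℤ) - 4) := by omega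
    simp only [a1, a2, h2, h3]
    split_ifs <;> rfl
  · intro n
    have a3 : 2 * n / 2 = n := by omega
    simp only [even_two_mul, if_true, a3, (h4 n).1]
  · intro n
    have a1 : ¬ Even (2 * n + 1) := by simp
    have a2 : (2 * n + 1) / 2 = n := by omega
    simp only [a1, if_false, a2, (h4 n).2]

namespace IsLift

variable {e : ℤ → ℝ}

theorem P_at (L : IsLift D e) {i : ZMod (8 * g - 4)} (n : ℤ) (h : (n : ZMod (8 * g - 4)) = i) :
    D.P i = Circle.exp (e (2 * n)) := by rw [← h, L.P_eq]

theorem Q_at (L : IsLift D e) {i : ZMod (8 * g - 4)} (n : ℤ) (h : (n : ZMod (8 * g - 4)) = i) :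
    D.Q i = Circle.exp (e (2 * n + 1)) := by rw [← h, L.Q_eq]

theorem lt_per (L : IsLift D e) {m n : ℤ} (h : m < n + 2 * (8 * (g : ℤ) - 4)) : e m < e n + 2 * Real.pi := by
  rw [← L.per]; exact L.mono h

theorem le_per (L : IsLift D e) {m n : ℤ} (h : m ≤ n + 2 * (8 * (g : ℤ) - 4)) : e m ≤ e n + 2 * Real.pi := by
  rw [← L.per]; exact L.mono.monotone h

theorem dt_pos (L : IsLift D e) {a b c : ℤ} (h1 : a < b) (h2 : b < c) (h3 : c < a + 2 * (8 * (g : ℤ) - 4)) :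
    0 < dt (Circle.exp (e a)) (Circle.exp (e b)) (Circle.exp (e c)) :=
  dt_exp_pos (L.mono h1) (L.mono h2) (L.lt_per h3)

end IsLift

/-! ### The vertices -/

/-- Indices modulo `8g - 4` are compared as integers by placing their representatives in a common
window. -/
theorem exists_int_rep (hg : 2 ≤ g) (i : ZMod (8 * g - 4)) (n : ℤ) :
    ∃ k : ℤ, n ≤ k ∧ k < n + (8 * (g : ℤ) - 4) ∧ (k : ZMod (8 * g - 4)) = i := by
  have : NeZero (8 * g - 4) := ⟨by omega⟩
  refine ⟨n + (i - n : ZMod (8 * g - 4)).val, by omega, ?_, ?_⟩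
  · have := (i - n : ZMod (8 * g - 4)).val_lt
    omega
  · push_cast
    rw [ZMod.natCast_zmod_val]
    ring

theorem intCast_add_period (hg : 2 ≤ g) (n : ℤ) :
    ((n + (8 * (g : ℤ) - 4) : ℤ) : ZMod (8 * g - 4)) = n := by
  push_cast
  linear_combination eight_mul_sub_four hg

theorem IsFundamentalPolygon.line_start (hD : D.IsFundamentalPolygon) (i : ZMod (8 * g - 4)) :
    dt (D.P i) (D.Q (i + 1)) (D.V i) = 0 := by
  have := hD.vertex_start i
  rw [side_eq] at this
  linarith

theorem IsFundamentalPolygon.line_end (hD : D.IsFundamentalPolygon) (i : ZMod (8 * g - 4)) :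
    dt (D.P (i - 1)) (D.Q i) (D.V i) = 0 := by
  have := hD.vertex_end (i - 1)
  rw [side_eq, sub_add_cancel] at this
  linarith

theorem IsFundamentalPolygon.line_start_exp (hD : D.IsFundamentalPolygon) {e : ℤ → ℝ}
    (L : IsLift D e) {i : ZMod (8 * g - 4)} {n : ℤ} (hn : (n : ZMod (8 * g - 4)) = i) :
    dt (Circle.exp (e (2 * n))) (Circle.exp (e (2 * n + 3))) (D.V i) = 0 := by
  have := hD.line_start i
  rwa [L.P_at n hn, L.Q_at (n + 1) (by push_cast; rw [hn]),
    show 2 * (n + 1) + 1 = 2 * n + 3 by ring] at this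

theorem IsFundamentalPolygon.line_end_exp (hD : D.IsFundamentalPolygon) {e : ℤ → ℝ}
    (L : IsLift D e) {i : ZMod (8 * g - 4)} {n : ℤ} (hn : (n : ZMod (8 * g - 4)) = i) :
    dt (Circle.exp (e (2 * n - 2))) (Circle.exp (e (2 * n + 1))) (D.V i) = 0 := by
  have := hD.line_end i
  rwa [L.Q_at n hn, L.P_at (n - 1) (by push_cast; rw [hn]),
    show 2 * (n - 1) = 2 * n - 2 by ring] at this

/-- The same geodesic read backwards, up to the next lift of its starting point, as an increasing
pair of lifts is needed for the complementary arc. -/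
theorem IsFundamentalPolygon.line_start_exp' (hD : D.IsFundamentalPolygon) {e : ℤ → ℝ}
    (L : IsLift D e) {i : ZMod (8 * g - 4)} {n : ℤ} (hn : (n : ZMod (8 * g - 4)) = i) :
    dt (Circle.exp (e (2 * n + 3))) (Circle.exp (e (2 * n) + 2 * Real.pi)) (D.V i) = 0 := by
  rw [Circle.exp_add_two_pi, dt_swap, hD.line_start_exp L hn, neg_zero]

theorem IsFundamentalPolygon.line_end_exp' (hD : D.IsFundamentalPolygon) {e : ℤ → ℝ}
    (L : IsLift D e) {i : ZMod (8 * g - 4)} {n : ℤ} (hn : (n : ZMod (8 * g - 4)) = i) :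
    dt (Circle.exp (e (2 * n + 1))) (Circle.exp (e (2 * n - 2) + 2 * Real.pi)) (D.V i) = 0 := by
  rw [Circle.exp_add_two_pi, dt_swap, hD.line_end_exp L hn, neg_zero]

/-- One of the two sides through `V k` has a complementary arc containing both end points of side
`j`, so that `V k` is to the left of side `j`. -/
theorem IsFundamentalPolygon.vertex_pos (hD : D.IsFundamentalPolygon) (hg : 2 ≤ g)
    {j k : ZMod (8 * g - 4)} (h1 : j ≠ k) (h2 : j + 1 ≠ k) :
    0 < dt (D.P j) (D.Q (j + 1)) (D.V k) := by
  obtain ⟨e, L⟩ := hD.exists_isLift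
  obtain ⟨n, rfl⟩ := ZMod.intCast_surjective k
  obtain ⟨r, hr1, hr2, rfl⟩ := exists_int_rep hg j n
  rw [L.P_at r rfl, L.Q_at (r + 1) (by push_cast; rfl), show 2 * (r + 1) + 1 = 2 * r + 3 by ring]
  have a1 : r ≠ n := fun h ↦ h1 (by rw [h])
  have a2 : r + 1 ≠ n + (8 * (g : ℤ) - 4) := by
    intro h
    apply h2
    rw [← intCast_add_period hg n, ← h]
    push_cast; rfl
  -- The extension of side `k + 1` crosses that of side `k`, so in this case the comparison must be
  -- made with side `k - 1`.
  by_cases hr : r = n + 1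
  · refine dt_pos_of_line (hD.vertex_mem _) (hD.line_end_exp' L rfl) ?_ (L.mono (by omega)).le
      (L.mono (by omega)) (L.le_per (by omega)) (.inl (L.mono (by omega)))
    linarith [L.mono (show 2 * n - 2 < 2 * n + 1 by omega)]
  · refine dt_pos_of_line (hD.vertex_mem _) (hD.line_start_exp' L rfl) ?_ (L.mono (by omega)).le
      (L.mono (by omega)) (L.le_per (by omega)) (.inl (L.mono (by omega)))
    linarith [L.mono (show 2 * n < 2 * n + 3 by omega)]

theorem IsFundamentalPolygon.vertex_nonneg (hD : D.IsFundamentalPolygon) (hg : 2 ≤ g)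
    (j k : ZMod (8 * g - 4)) : 0 ≤ dt (D.P j) (D.Q (j + 1)) (D.V k) := by
  by_cases h1 : j = k
  · subst h1; exact (hD.line_start j).ge
  by_cases h2 : j + 1 = k
  · subst h2
    have := hD.line_end (j + 1)
    rw [add_sub_cancel_right] at this
    exact this.ge
  · exact (hD.vertex_pos hg h1 h2).le

theorem mem_closedPolygon {z : ℂ} :
    z ∈ D.closedPolygon ↔ ‖z‖ < 1 ∧ ∀ i, 0 ≤ dt (D.P i) (D.Q (i + 1)) z := by
  simp only [closedPolygon, mem_ofPred_eq, side_eq]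
  simp

theorem mem_openPolygon {z : ℂ} :
    z ∈ D.openPolygon ↔ ‖z‖ < 1 ∧ ∀ i, 0 < dt (D.P i) (D.Q (i + 1)) z := by
  simp only [openPolygon, mem_ofPred_eq, side_eq]
  simp

theorem openPolygon_subset : D.openPolygon ⊆ D.closedPolygon :=
  fun _ hz ↦ ⟨hz.1, fun i ↦ (hz.2 i).le⟩

theorem IsFundamentalPolygon.vertex_mem_closedPolygon (hD : D.IsFundamentalPolygon) (hg : 2 ≤ g)
    (k : ZMod (8 * g - 4)) : D.V k ∈ D.closedPolygon :=
  mem_closedPolygon.2 ⟨hD.vertex_mem k, fun j ↦ hD.vertex_nonneg hg j k⟩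

/-- A geodesic separating two points of the polygon meets the polygon. -/
theorem exists_mem_closedPolygon {x y v v' : ℂ} (hv : v ∈ D.closedPolygon)
    (hv' : v' ∈ D.closedPolygon) (h : dt x y v ≤ 0) (h' : 0 ≤ dt x y v') :
    ∃ z ∈ D.closedPolygon, dt x y z = 0 := by
  rcases h.eq_or_lt with h | h
  · exact ⟨v, hv, h⟩
  rcases h'.eq_or_lt with h' | h'
  · exact ⟨v', hv', h'.symm⟩
  rw [mem_closedPolygon] at hv hv'
  -- The weights `dt x y v'` and `-dt x y v` are chosen to cancel `dt x y` on the combination.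
  obtain ⟨z, hz, s, hs, hsz⟩ := exists_point hv.1 hv'.1 h' (neg_pos.2 h)
  refine ⟨z, mem_closedPolygon.2 ⟨hz, fun i ↦ ?_⟩, ?_⟩
  · refine nonneg_of_mul_nonneg_right (?_ : 0 ≤ s * _) hs
    rw [hsz]
    exact add_nonneg (mul_nonneg h'.le (hv.2 i)) (mul_nonneg (neg_pos.2 h).le (hv'.2 i))
  · refine (mul_eq_zero.1 ((hsz x y).trans ?_)).resolve_left hs.ne'
    ring

theorem exists_mem_openPolygon {x y v v' : ℂ} (hv : v ∈ D.closedPolygon)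
    (hv' : v' ∈ D.closedPolygon) (h : dt x y v < 0) (h' : 0 < dt x y v')
    (hp : ∀ i, 0 < dt (D.P i) (D.Q (i + 1)) v ∨ 0 < dt (D.P i) (D.Q (i + 1)) v') :
    ∃ z ∈ D.openPolygon, dt x y z = 0 := by
  rw [mem_closedPolygon] at hv hv'
  obtain ⟨z, hz, s, hs, hsz⟩ := exists_point hv.1 hv'.1 h' (neg_pos.2 h)
  refine ⟨z, mem_openPolygon.2 ⟨hz, fun i ↦ ?_⟩, ?_⟩
  · refine pos_of_mul_pos_right (?_ : 0 < s * _) hs.le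
    rw [hsz]
    rcases hp i with hi | hi
    · exact add_pos_of_pos_of_nonneg (mul_pos h' hi) (mul_nonneg (neg_pos.2 h).le (hv'.2 i))
    · exact add_pos_of_nonneg_of_pos (mul_nonneg h'.le (hv.2 i)) (mul_pos (neg_pos.2 h) hi)
  · refine (mul_eq_zero.1 ((hsz x y).trans ?_)).resolve_left hs.ne'
    ring

theorem natCast_ne_zero (hg : 2 ≤ g) {n : ℕ} (h0 : 0 < n) (h : n < 12) :
    ((n : ℕ) : ZMod (8 * g - 4)) ≠ 0 := by
  rw [Ne, ZMod.natCast_eq_zero_iff]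
  exact fun hd ↦ absurd (Nat.le_of_dvd h0 hd) (by omega)

/-- `V (k - 1)` and `V (k + 1)` lie on no common side, so points strictly between them are interior
to the polygon. -/
theorem IsFundamentalPolygon.vertex_pos_or (hD : D.IsFundamentalPolygon) (hg : 2 ≤ g)
    (i k : ZMod (8 * g - 4)) : 0 < dt (D.P i) (D.Q (i + 1)) (D.V (k - 1)) ∨
      0 < dt (D.P i) (D.Q (i + 1)) (D.V (k + 1)) := by
  have h1 := natCast_ne_zero (g := g) hg (n := 1) (by norm_num) (by norm_num)
  have h2 := natCast_ne_zero (g := g) hg (n := 2) (by norm_num) (by norm_num)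
  have h3 := natCast_ne_zero (g := g) hg (n := 3) (by norm_num) (by norm_num)
  push_cast at h1 h2 h3
  by_cases ha : i = k - 1
  · refine .inr (hD.vertex_pos hg ?_ ?_)
    · rw [ha]; intro h; exact h2 (by linear_combination -h)
    · rw [ha]; intro h; exact h1 (by linear_combination -h)
  by_cases hb : i + 1 = k - 1
  · refine .inr (hD.vertex_pos hg ?_ ?_)
    · intro h; exact h3 (by linear_combination hb - h)
    · intro h; exact h2 (by linear_combination hb - h)
  · exact .inl (hD.vertex_pos hg ha hb)

theorem IsFundamentalPolygon.openPolygon_nonempty (hD : D.IsFundamentalPolygon) (hg : 2 ≤ g) :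
    D.openPolygon.Nonempty := by
  have h1 := hD.vertex_mem_closedPolygon hg (0 - 1)
  have h2 := hD.vertex_mem_closedPolygon hg (0 + 1)
  rw [mem_closedPolygon] at h1 h2
  obtain ⟨z, hz, s, hs, hsz⟩ := exists_point h1.1 h2.1 one_pos one_pos
  refine ⟨z, mem_openPolygon.2 ⟨hz, fun i ↦ ?_⟩⟩
  refine pos_of_mul_pos_right (?_ : 0 < s * _) hs.le
  rw [hsz, one_mul, one_mul]
  rcases hD.vertex_pos_or hg i 0 with hi | hi
  · exact add_pos_of_pos_of_nonneg hi (h2.2 i)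
  · exact add_pos_of_nonneg_of_pos (h1.2 i) hi

/-- The vertices of side `i` follow each other along the side in the direction of its
orientation. -/
theorem IsFundamentalPolygon.exists_side_factor (hD : D.IsFundamentalPolygon) (hg : 2 ≤ g)
    (i : ZMod (8 * g - 4)) : ∃ κ : ℝ, 0 < κ ∧
      ∀ r, dt (D.V i) (D.V (i + 1)) r = κ * dt (D.P i) (D.Q (i + 1)) r := by
  obtain ⟨e, L⟩ := hD.exists_isLift
  obtain ⟨n, rfl⟩ := ZMod.intCast_surjective i
  have hP : D.P n = Circle.exp (e (2 * n)) := L.P_at n rfl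
  have hQ : D.Q (n + 1) = Circle.exp (e (2 * n + 3)) := by
    rw [L.Q_at (n + 1) (by push_cast; rfl), show 2 * (n + 1) + 1 = 2 * n + 3 by ring]
  have hP' : D.P (n - 1) = Circle.exp (e (2 * n - 2)) := by
    rw [L.P_at (n - 1) (by push_cast; rfl), show 2 * (n - 1) = 2 * n - 2 by ring]
  have hQ' : D.Q n = Circle.exp (e (2 * n + 1)) := L.Q_at n rfl
  have hA : 0 < dt (D.P (n - 1)) (D.P n) (D.Q n) := by
    rw [hP, hP', hQ']; exact L.dt_pos (by omega) (by omega) (by omega)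
  have hB : 0 < dt (D.P (n - 1)) (D.Q n) (D.Q (n + 1)) := by
    rw [hQ, hP', hQ']; exact L.dt_pos (by omega) (by omega) (by omega)
  have hne : D.P n ≠ D.Q (n + 1) := by
    rw [hP, hQ]; exact exp_ne_of_lt (L.mono (by omega)) (L.lt_per (by omega))
  have l1 := hD.line_start n
  have l2 : dt (D.P n) (D.Q (n + 1)) (D.V (n + 1)) = 0 := by
    have := hD.line_end ((n : ZMod (8 * g - 4)) + 1)
    rwa [add_sub_cancel_right] at this
  obtain ⟨c, d, hc, hd, h⟩ := exists_comb (hD.vertex_mem _) hne l1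
  obtain ⟨c', d', hc', hd', h'⟩ := exists_comb (hD.vertex_mem _) hne l2
  have m1 : c * -dt (D.P (n - 1)) (D.P n) (D.Q n) + d * dt (D.P (n - 1)) (D.Q n) (D.Q (n + 1)) = 0 := by
    have := hD.line_end n
    rwa [dt_cyc, dt_cyc, h, dt_cyc, dt_swap', dt_cyc (D.Q (n + 1) : ℂ)] at this
  have m2 : 0 < c' * -dt (D.P (n - 1)) (D.P n) (D.Q n) +
      d' * dt (D.P (n - 1)) (D.Q n) (D.Q (n + 1)) := by
    have h1 := natCast_ne_zero (g := g) hg (n := 1) (by norm_num) (by norm_num)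
    have h2 := natCast_ne_zero (g := g) hg (n := 2) (by norm_num) (by norm_num)
    push_cast at h1 h2
    have := hD.vertex_pos hg (j := n - 1) (k := n + 1) (fun h ↦ h2 (by linear_combination -h))
      (fun h ↦ h1 (by linear_combination -h))
    rwa [sub_add_cancel, dt_cyc, dt_cyc, h', dt_cyc, dt_swap', dt_cyc (D.Q (n + 1) : ℂ)] at this
  -- `V i` and `V (i + 1)` have coordinates `(c, d)` and `(c', d')` with respect to the end points
  -- of the side, so `κ` is their determinant. It is positive because `V i` lies on side `i - 1`
  -- (`m1`) and `V (i + 1)` strictly to its left (`m2`).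
  refine ⟨c * d' - d * c', ?_, fun r ↦ ?_⟩
  · generalize dt (D.P (n - 1)) (D.P n) (D.Q n) = A at *
    generalize dt (D.P (n - 1)) (D.Q n) (D.Q (n + 1)) = B at *
    have : 0 < (c * d' - d * c') * B := by
      have := mul_pos hc m2
      nlinarith
    exact pos_of_mul_pos_left this hB.le
  · have q1 := h' (D.P n) r
    have q2 := h' (D.Q (n + 1)) r
    rw [dt_self] at q1 q2
    linear_combination h (D.V (n + 1)) r + c * dt_swap (D.P n) (D.V (n + 1)) r +
      d * dt_swap (D.Q (n + 1)) (D.V (n + 1)) r - c * q1 - d * q2 -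
      c * d' * dt_swap (D.Q (n + 1)) (D.P n) r

/-! ### The images of the end points under the side pairings -/

theorem IsFundamentalPolygon.T_sigma_T (hD : D.IsFundamentalPolygon) (i : ZMod (8 * g - 4))
    (x : Circle) : mobCircle (D.T (sigma i)) (mobCircle (D.T i) x) = x := by
  rw [← mobCircle_mul]
  exact mobCircle_eq_of_actsAsId (hD.pairing i) x

theorem IsFundamentalPolygon.T_T_sigma (hD : D.IsFundamentalPolygon) (hg : 2 ≤ g)
    (i : ZMod (8 * g - 4)) (x : Circle) :
    mobCircle (D.T i) (mobCircle (D.T (sigma i)) x) = x := by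
  have := hD.T_sigma_T (sigma i) x
  rwa [sigma_sigma hg] at this

theorem IsFundamentalPolygon.mob_T_sigma_T (hD : D.IsFundamentalPolygon) (i : ZMod (8 * g - 4))
    {z : ℂ} (hz : ‖z‖ < 1) : mob (D.T (sigma i)) (mob (D.T i) z) = z := by
  rw [← mob_mul _ _ hz.le]
  exact hD.pairing i z hz

theorem IsFundamentalPolygon.T_V (hD : D.IsFundamentalPolygon) (i : ZMod (8 * g - 4)) :
    mob (D.T i) (D.V i) = D.V (sigma i + 1) := hD.map_vertex i

theorem IsFundamentalPolygon.T_V_succ (hD : D.IsFundamentalPolygon) (hg : 2 ≤ g)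
    (i : ZMod (8 * g - 4)) : mob (D.T i) (D.V (i + 1)) = D.V (sigma i) := by
  have h := hD.T_V (sigma i)
  rw [sigma_sigma hg] at h
  have h' := hD.mob_T_sigma_T (sigma i) (hD.vertex_mem (sigma i))
  rwa [sigma_sigma hg, h] at h'

theorem IsFundamentalPolygon.P_ne_Q (hD : D.IsFundamentalPolygon) (hg : 2 ≤ g)
    (i : ZMod (8 * g - 4)) : D.P i ≠ D.Q (i + 1) := by
  obtain ⟨e, L⟩ := hD.exists_isLift
  obtain ⟨n, rfl⟩ := ZMod.intCast_surjective i
  rw [L.P_at n rfl, L.Q_at (n + 1) (by push_cast; rfl)]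
  exact exp_ne_of_lt (L.mono (by omega)) (L.lt_per (by omega))

/-- Two vertices determine their geodesic: on the light cone, the vectors in the plane they span are
those of the end points of the side. -/
theorem IsFundamentalPolygon.line_vertices (hD : D.IsFundamentalPolygon) (hg : 2 ≤ g)
    (i : ZMod (8 * g - 4)) {u v : Circle} (huv : u ≠ v) (h1 : dt u v (D.V i) = 0)
    (h2 : dt u v (D.V (i + 1)) = 0) : u = D.P i ∨ u = D.Q (i + 1) := by
  obtain ⟨κ, hκ, h⟩ := hD.exists_side_factor hg i
  obtain ⟨c, d, hc, hd, hcd⟩ := exists_comb (hD.vertex_mem i) huv h1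
  have e := hcd (D.V (i + 1)) u
  rw [dt_self'', mul_zero, zero_add, dt_cyc (v : ℂ), dt_cyc _ (u : ℂ), h2, mul_zero, h] at e
  exact dt_eq_zero (hD.P_ne_Q hg i) ((mul_eq_zero.1 e).resolve_left hκ.ne')

/-- `T i` exchanges the order of the vertices of side `i` when it moves them to side `σ i`, so it
maps one extended side to the other with orientation reversed. -/
theorem IsFundamentalPolygon.T_P_and_T_Q_succ (hD : D.IsFundamentalPolygon) (hg : 2 ≤ g)
    (i : ZMod (8 * g - 4)) : mobCircle (D.T i) (D.P i) = D.Q (sigma i + 1) ∧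
      mobCircle (D.T i) (D.Q (i + 1)) = D.P (sigma i) := by
  have hne : mobCircle (D.T i) (D.P i) ≠ mobCircle (D.T i) (D.Q (i + 1)) :=
    fun h ↦ hD.P_ne_Q hg i (mobCircle_injective _ h)
  have l1 : dt (mobCircle (D.T i) (D.P i)) (mobCircle (D.T i) (D.Q (i + 1)))
      (D.V (sigma i + 1)) = 0 := by
    rw [← hD.T_V]
    exact (dt_mob_eq_zero (D.T i) (norm_coe_le _) (norm_coe_le _) (hD.vertex_mem i).le).2
      (hD.line_start i)
  have l2 : dt (mobCircle (D.T i) (D.P i)) (mobCircle (D.T i) (D.Q (i + 1)))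
      (D.V (sigma i)) = 0 := by
    rw [← hD.T_V_succ hg]
    refine (dt_mob_eq_zero (D.T i) (norm_coe_le _) (norm_coe_le _) (hD.vertex_mem _).le).2 ?_
    have := hD.line_end (i + 1)
    rwa [add_sub_cancel_right] at this
  have l1' := l1
  have l2' := l2
  rw [dt_swap, neg_eq_zero] at l1' l2'
  have hu := hD.line_vertices hg (sigma i) hne l2 l1
  have hv := hD.line_vertices hg (sigma i) hne.symm l2' l1'
  rcases hu with hu | hu
  · have hv := hv.resolve_left fun h ↦ hne (hu.trans h.symm)
    -- If the orientation were kept, the image of `V (i + 2)` would lie to the left of side `σ i` by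
    -- its end points, and to the right by its vertices.
    exfalso
    obtain ⟨κ, hκ, h⟩ := hD.exists_side_factor hg i
    obtain ⟨κ', hκ', h'⟩ := hD.exists_side_factor hg (sigma i)
    have h1 := natCast_ne_zero (g := g) hg (n := 1) (by norm_num) (by norm_num)
    have h2 := natCast_ne_zero (g := g) hg (n := 2) (by norm_num) (by norm_num)
    push_cast at h1 h2
    have hr := hD.vertex_pos hg (j := i) (k := i + 2) (fun h ↦ h2 (by linear_combination -h))
      (fun h ↦ h1 (by linear_combination -h))
    have a1 : 0 < dt (D.V i) (D.V (i + 1)) (D.V (i + 2)) := by rw [h]; positivity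
    have a2 := (dt_mob_pos (D.T i) (hD.vertex_mem i).le (hD.vertex_mem _).le
      (hD.vertex_mem _).le).2 a1
    have a3 := (dt_mob_pos (D.T i) (norm_coe_le _) (norm_coe_le _) (hD.vertex_mem _).le).2 hr
    rw [← coe_mobCircle, ← coe_mobCircle, hu, hv] at a3
    rw [hD.T_V, hD.T_V_succ hg, dt_swap, h'] at a2
    nlinarith [mul_pos hκ' a3]
  · exact ⟨hu, hv.resolve_right fun h ↦ hne (hu.trans h.symm)⟩

theorem IsFundamentalPolygon.T_P (hD : D.IsFundamentalPolygon) (hg : 2 ≤ g)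
    (i : ZMod (8 * g - 4)) : mobCircle (D.T i) (D.P i) = D.Q (sigma i + 1) :=
  (hD.T_P_and_T_Q_succ hg i).1

theorem IsFundamentalPolygon.T_Q_succ (hD : D.IsFundamentalPolygon) (hg : 2 ≤ g)
    (i : ZMod (8 * g - 4)) : mobCircle (D.T i) (D.Q (i + 1)) = D.P (sigma i) :=
  (hD.T_P_and_T_Q_succ hg i).2

theorem IsFundamentalPolygon.T_line_start (hD : D.IsFundamentalPolygon) (i : ZMod (8 * g - 4)) :
    dt (mobCircle (D.T i) (D.P (i - 1))) (mobCircle (D.T i) (D.Q i)) (D.V (sigma i + 1)) = 0 := by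
  rw [← hD.T_V]
  exact (dt_mob_eq_zero (D.T i) (norm_coe_le _) (norm_coe_le _) (hD.vertex_mem i).le).2
    (hD.line_end i)

/-- The image of the extension of side `i - 1` does not enter the polygon. -/
theorem IsFundamentalPolygon.not_mem_openPolygon (hD : D.IsFundamentalPolygon) (hg : 2 ≤ g)
    (i : ZMod (8 * g - 4)) {z : ℂ} (hz : z ∈ D.openPolygon) :
    dt (mobCircle (D.T i) (D.P (i - 1))) (mobCircle (D.T i) (D.Q i)) z ≠ 0 := by
  have hT : D.T (sigma i) ∈ D.Gam := Subgroup.subset_closure ⟨_, rfl⟩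
  have h := hD.extension _ hT (i - 1) z hz
  rw [side_eq, sub_add_cancel] at h
  intro h0
  have hz' : mob (D.T i) (mob (D.T (sigma i)) z) = z := by
    have := hD.mob_T_sigma_T (sigma i) hz.1
    rwa [sigma_sigma hg] at this
  rw [← hz'] at h0
  have := (dt_mob_eq_zero (D.T i) (norm_coe_le _) (norm_coe_le _) (mob_norm_lt _ hz.1).le).1 h0
  rw [this] at h
  simp at h

/-- The image of the extension of side `i - 1` passes through `V k`, `k = σ i + 1`. If it started
strictly between `P k` and `Q k`, it would separate `V (k - 1)` from `V (k + 1)` and enter the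
polygon, against the extension condition. -/
theorem IsFundamentalPolygon.not_ccw_T_P (hD : D.IsFundamentalPolygon) (hg : 2 ≤ g)
    (i : ZMod (8 * g - 4)) :
    ¬ Ccw (D.P (sigma i + 1)) (mobCircle (D.T i) (D.P (i - 1))) (D.Q (sigma i + 1)) := by
  have hl := hD.T_line_start i
  have hn := fun z hz ↦ hD.not_mem_openPolygon hg i (z := z) hz
  have hXY : mobCircle (D.T i) (D.P (i - 1)) ≠ mobCircle (D.T i) (D.Q i) := by
    intro h
    have := hD.P_ne_Q hg (i - 1)
    rw [sub_add_cancel] at this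
    exact this (mobCircle_injective _ h)
  generalize mobCircle (D.T i) (D.P (i - 1)) = X at *
  generalize mobCircle (D.T i) (D.Q i) = Y at *
  generalize sigma i + 1 = k at *
  intro hX
  obtain ⟨e, L⟩ := hD.exists_isLift
  obtain ⟨n, rfl⟩ := ZMod.intCast_surjective k
  have hP : D.P n = Circle.exp (e (2 * n)) := L.P_at n rfl
  have hQ : D.Q n = Circle.exp (e (2 * n + 1)) := L.Q_at n rfl
  have hQ' : D.Q (n + 1) = Circle.exp (e (2 * n + 3)) := by
    rw [L.Q_at (n + 1) (by push_cast; rfl), show 2 * (n + 1) + 1 = 2 * n + 3 by ring]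
  have hP' : D.P (n - 1) = Circle.exp (e (2 * n - 2)) := by
    rw [L.P_at (n - 1) (by push_cast; rfl), show 2 * (n - 1) = 2 * n - 2 by ring]
  have a1 : 0 < dt (D.P n) X (D.Q (n + 1)) ∧ 0 < dt (D.P (n - 1)) X (D.Q n) := by
    obtain ⟨x, hx1, hx2, rfl⟩ := exists_lift X (e (2 * n))
    rw [hP, hQ, ccw_exp hx1 hx2 (L.mono (by omega)).le (L.lt_per (by omega))] at hX
    rw [hP, hQ, hP', hQ']
    exact ⟨dt_exp_pos hX.1 (hX.2.trans (L.mono (by omega))) (L.lt_per (by omega)),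
      dt_exp_pos ((L.mono (by omega)).trans hX.1) hX.2 (L.lt_per (by omega))⟩
  rw [dt_swap', dt_swap' (D.P (n - 1) : ℂ)] at a1
  obtain ⟨c, d, hc, hd, hcd⟩ := exists_comb (hD.vertex_mem n) hXY hl
  obtain ⟨κ, hκ, h⟩ := hD.exists_side_factor hg n
  obtain ⟨κ', hκ', h'⟩ := hD.exists_side_factor hg (n - 1)
  rw [sub_add_cancel] at h'
  have b1 : 0 < dt Y X (D.V (n + 1)) := by
    have e1 := hcd X (D.V (n + 1))
    rw [dt_self, mul_zero, zero_add, dt_swap', h] at e1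
    have : 0 < d * dt Y X (D.V (n + 1)) := by rw [← e1]; nlinarith [mul_pos hκ a1.1]
    exact pos_of_mul_pos_right this hd.le
  have b2 : dt Y X (D.V (n - 1)) < 0 := by
    have e1 := hcd X (D.V (n - 1))
    rw [dt_self, mul_zero, zero_add, ← dt_cyc, h'] at e1
    have : 0 < d * -dt Y X (D.V (n - 1)) := by nlinarith [mul_pos hκ' a1.2]
    linarith [pos_of_mul_pos_right this hd.le]
  obtain ⟨z, hz, hz0⟩ := exists_mem_openPolygon (hD.vertex_mem_closedPolygon hg _)
    (hD.vertex_mem_closedPolygon hg _) b2 b1 fun j ↦ hD.vertex_pos_or hg j n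
  refine hn z hz ?_
  rw [dt_swap, hz0, neg_zero]

theorem IsFundamentalPolygon.ccw_T_P (hD : D.IsFundamentalPolygon) (hg : 2 ≤ g)
    (i : ZMod (8 * g - 4)) :
    Ccw (mobCircle (D.T i) (D.P (i - 1))) (D.Q (sigma i + 1)) (D.P (sigma i)) := by
  rw [← hD.T_P hg, ← hD.T_Q_succ hg, ccw_mob]
  obtain ⟨e, L⟩ := hD.exists_isLift
  obtain ⟨n, rfl⟩ := ZMod.intCast_surjective i
  rw [L.P_at n rfl, L.Q_at (n + 1) (by push_cast; rfl), L.P_at (n - 1) (by push_cast; rfl), ccw_iff]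
  exact L.dt_pos (by omega) (by omega) (by omega)

/-- The lift of the image of `P (i - 1)`. -/
theorem IsFundamentalPolygon.exists_lift_T_P (hD : D.IsFundamentalPolygon) (hg : 2 ≤ g)
    {e : ℤ → ℝ} (L : IsLift D e) (i : ZMod (8 * g - 4)) {n : ℤ}
    (hn : (n : ZMod (8 * g - 4)) = sigma i + 1) :
    ∃ x, e (2 * n - 2) < x ∧ x ≤ e (2 * n) ∧
      Circle.exp x = mobCircle (D.T i) (D.P (i - 1)) := by
  have h1 := hD.not_ccw_T_P hg i
  have h2 := hD.ccw_T_P hg i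
  obtain ⟨x, hx1, hx2, hx⟩ := exists_lift (mobCircle (D.T i) (D.P (i - 1))) (e (2 * n - 2))
  rw [← hx, L.P_at n hn, L.Q_at n hn] at h1
  rw [← hx, L.P_at (i := sigma i) (n - 1) (by push_cast; rw [hn]; ring), L.Q_at n hn,
    show 2 * (n - 1) = 2 * n - 2 by ring, ccw_iff, dt_cyc, dt_cyc, ← ccw_iff,
    ccw_exp hx1 hx2 (L.mono (by omega)).le (L.lt_per (by omega))] at h2
  refine ⟨x, h2.1, not_lt.1 fun h ↦ h1 ?_, hx⟩
  exact (ccw_exp h.le (by linarith [L.mono (show 2 * n - 2 < 2 * n by omega)])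
    (L.mono (by omega)).le (L.lt_per (by omega))).2 ⟨h, h2.2⟩

/-- The image geodesic and the extension of side `σ i + 1` pass through the same vertex. As the
former does not start after `P (σ i + 1)`, it cannot end beyond `Q (σ i + 2)`. -/
theorem IsFundamentalPolygon.not_ccw_T_Q (hD : D.IsFundamentalPolygon) (hg : 2 ≤ g)
    (i : ZMod (8 * g - 4)) :
    ¬ Ccw (D.Q (sigma i + 2)) (mobCircle (D.T i) (D.Q i)) (D.P (sigma i)) := by
  have hl := hD.T_line_start i
  obtain ⟨e, L⟩ := hD.exists_isLift
  obtain ⟨n, hn⟩ := ZMod.intCast_surjective (sigma i + 1)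
  obtain ⟨x, hx1, hx2, hx⟩ := hD.exists_lift_T_P hg L i hn
  rw [← hx] at hl
  obtain ⟨y, hy1, hy2, hy⟩ := exists_lift (mobCircle (D.T i) (D.Q i)) (e (2 * n + 3))
  rw [← hy] at hl ⊢
  have p1 := L.mono (show 2 * n + 1 < 2 * n + 3 by omega)
  have p2 := L.mono (show 2 * n - 2 < 2 * n + 1 by omega)
  have p3 := L.lt_per (show 2 * n + 3 < 2 * n - 2 + 2 * (8 * (g : ℤ) - 4) by omega)
  have p4 := L.mono (show 2 * n < 2 * n + 1 by omega)
  rw [L.Q_at (i := sigma i + 2) (n + 1) (by push_cast; rw [hn]; ring),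
    L.P_at (i := sigma i) (n - 1) (by push_cast; rw [hn]; ring),
    show 2 * (n + 1) + 1 = 2 * n + 3 by ring, show 2 * (n - 1) = 2 * n - 2 by ring,
    ← Circle.exp_add_two_pi (e (2 * n - 2)), ccw_exp hy1 hy2 p3.le (by linarith)]
  rintro ⟨h1, h2⟩
  have := dt_pos_of_line (hD.vertex_mem _) (hD.line_start_exp' L hn) (by linarith) h1.le
    (show y < x + 2 * Real.pi by linarith) (by linarith) (.inl h1)
  rw [Circle.exp_add_two_pi, dt_swap, hl] at this
  simp at this

theorem IsFundamentalPolygon.cycle_apply (hD : D.IsFundamentalPolygon) (i : ZMod (8 * g - 4))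
    (x : Circle) : mobCircle (D.T (rho (rho (rho i)))) (mobCircle (D.T (rho (rho i)))
      (mobCircle (D.T (rho i)) (mobCircle (D.T i) x))) = x := by
  rw [← mobCircle_mul, ← mobCircle_mul, ← mobCircle_mul]
  exact mobCircle_eq_of_actsAsId (hD.cycle i) x

/-- By `exists_lift_T_P` the image is at or before `P (σ i + 1)`. The cycle relation excludes a
strict inequality: the last pairing sends `Q (ρ³ i + 1)` to `P (i - 1)`, so the first three must
send `P (i - 1)` to `Q (ρ³ i + 1)`. A deviation at the first vertex is carried on by `T (ρ i)` and
contradicts `not_ccw_T_Q` at `ρ² i`. -/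
theorem IsFundamentalPolygon.T_P_pred (hD : D.IsFundamentalPolygon) (hg : 2 ≤ g)
    (i : ZMod (8 * g - 4)) : mobCircle (D.T i) (D.P (i - 1)) = D.P (sigma i + 1) := by
  have hc := hD.cycle_apply i (D.P (i - 1))
  have h3 : mobCircle (D.T (rho (rho (rho i)))) (D.Q (rho (rho (rho i)) + 1)) = D.P (i - 1) := by
    rw [hD.T_Q_succ hg, eq_sub_of_add_eq (rho_rho_rho_rho hg i)]
  have hX3 := mobCircle_injective _ (hc.trans h3.symm)
  have hQ2 := hD.not_ccw_T_Q hg (rho (rho i))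
  rw [← hD.T_Q_succ hg, show sigma (rho (rho i)) + 2 = rho (rho (rho i)) + 1 by
    rw [show rho (rho (rho i)) = sigma (rho (rho i)) + 1 from rfl]; ring, ← hX3, ccw_mob] at hQ2
  by_contra hne
  obtain ⟨e, L⟩ := hD.exists_isLift
  obtain ⟨n, hn⟩ := ZMod.intCast_surjective (sigma i + 1)
  obtain ⟨x, hx1, hx2, hx⟩ := hD.exists_lift_T_P hg L i hn
  have hx3 : x < e (2 * n) := hx2.lt_of_ne fun h ↦ hne (by rw [← hx, h, L.P_at n hn])
  have c1 : Ccw (D.Q (rho i + 1)) (mobCircle (D.T i) (D.P (i - 1))) (D.P (rho i)) := by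
    rw [← hx, L.P_at (i := rho i) n hn, L.Q_at (i := rho i + 1) (n + 1) (by push_cast; rw [hn]; rfl),
      ← Circle.exp_add_two_pi x, ← Circle.exp_add_two_pi (e (2 * n)), ccw_iff]
    have p3 := L.lt_per (show 2 * (n + 1) + 1 < 2 * n - 2 + 2 * (8 * (g : ℤ) - 4) by omega)
    have p4 := L.mono (show 2 * n < 2 * (n + 1) + 1 by omega)
    exact dt_exp_pos (by linarith) (by linarith) (by linarith)
  rw [← ccw_mob (D.T (rho i)), hD.T_Q_succ hg, hD.T_P hg] at c1
  refine hQ2 (ccw_trans c1 ?_)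
  obtain ⟨m, hm⟩ := ZMod.intCast_surjective (rho (rho i))
  have hm' : (m : ZMod (8 * g - 4)) = sigma (rho i) + 1 := hm
  rw [L.P_at (i := sigma (rho i)) (m - 1) (by push_cast; rw [hm']; ring), L.Q_at (i := rho (rho i)) m hm,
    L.Q_at (m + 1) (by push_cast; rw [hm]), ccw_iff]
  exact L.dt_pos (by omega) (by omega) (by omega)

/-- Now both geodesics through `V (σ i + 1)` have the same starting point, so their end points agree
as well. -/
theorem IsFundamentalPolygon.T_Q (hD : D.IsFundamentalPolygon) (hg : 2 ≤ g)
    (i : ZMod (8 * g - 4)) : mobCircle (D.T i) (D.Q i) = D.Q (sigma i + 2) := by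
  have hl := hD.T_line_start i
  have h1 := hD.P_ne_Q hg (i - 1)
  rw [sub_add_cancel] at h1
  have h2 := fun h ↦ h1 (mobCircle_injective (D.T i) h)
  rw [hD.T_P_pred hg] at hl h2
  have h3 := hD.line_start (sigma i + 1)
  have h4 := hD.P_ne_Q hg (sigma i + 1)
  rw [show sigma i + 1 + 1 = sigma i + 2 by ring] at h3 h4
  exact eq_of_dt_eq_zero (hD.vertex_mem _) h2 h4 hl h3

theorem IsFundamentalPolygon.T_P_succ (hD : D.IsFundamentalPolygon) (hg : 2 ≤ g)
    (i : ZMod (8 * g - 4)) : mobCircle (D.T i) (D.P (i + 1)) = D.P (sigma i - 1) := by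
  have h := hD.T_P_pred hg (sigma i)
  rw [sigma_sigma hg] at h
  rw [← h, hD.T_T_sigma hg]

theorem IsFundamentalPolygon.T_Q_add_two (hD : D.IsFundamentalPolygon) (hg : 2 ≤ g)
    (i : ZMod (8 * g - 4)) : mobCircle (D.T i) (D.Q (i + 2)) = D.Q (sigma i) := by
  have h := hD.T_Q hg (sigma i)
  rw [sigma_sigma hg] at h
  rw [← h, hD.T_T_sigma hg]

/-! ### The transformations `U k` -/

theorem U_apply (k : ZMod (8 * g - 4)) (x : Circle) :
    mobCircle (D.U k) x = mobCircle (D.T (sigma k)) (mobCircle (D.T (tau k - 1)) x) :=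
  mobCircle_mul _ _ _

theorem IsFundamentalPolygon.U_P_pred (hD : D.IsFundamentalPolygon) (hg : 2 ≤ g)
    (k : ZMod (8 * g - 4)) : mobCircle (D.U k) (D.P (tau k - 1)) = D.Q k := by
  rw [U_apply, hD.T_P hg, sigma_tau_sub_one hg, show sigma k + 1 + 1 = sigma k + 2 by ring,
    hD.T_Q_add_two hg, sigma_sigma hg]

theorem IsFundamentalPolygon.U_P (hD : D.IsFundamentalPolygon) (hg : 2 ≤ g)
    (k : ZMod (8 * g - 4)) : mobCircle (D.U k) (D.P (tau k)) = D.Q (k + 1) := by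
  have h := hD.T_P_succ hg (tau k - 1)
  rw [sub_add_cancel, sigma_tau_sub_one hg, add_sub_cancel_right] at h
  rw [U_apply, h, hD.T_P hg, sigma_sigma hg]

theorem IsFundamentalPolygon.U_Q (hD : D.IsFundamentalPolygon) (hg : 2 ≤ g)
    (k : ZMod (8 * g - 4)) : mobCircle (D.U k) (D.Q (tau k)) = D.P (k - 1) := by
  have h := hD.T_Q_succ hg (tau k - 1)
  rw [sub_add_cancel, sigma_tau_sub_one hg] at h
  rw [U_apply, h, hD.T_P_succ hg, sigma_sigma hg]

theorem IsFundamentalPolygon.U_Q_succ (hD : D.IsFundamentalPolygon) (hg : 2 ≤ g)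
    (k : ZMod (8 * g - 4)) : mobCircle (D.U k) (D.Q (tau k + 1)) = D.P k := by
  have h := hD.T_Q_add_two hg (tau k - 1)
  rw [show tau k - 1 + 2 = tau k + 1 by ring, sigma_tau_sub_one hg] at h
  rw [U_apply, h, hD.T_Q_succ hg, sigma_sigma hg]

theorem IsFundamentalPolygon.U_V (hD : D.IsFundamentalPolygon) (hg : 2 ≤ g)
    (k : ZMod (8 * g - 4)) : mob (D.U k) (D.V (tau k)) = D.V k := by
  have h := hD.T_V_succ hg (tau k - 1)
  rw [sub_add_cancel, sigma_tau_sub_one hg] at h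
  rw [U, mob_mul _ _ (hD.vertex_mem _).le, h, hD.T_V_succ hg, sigma_sigma hg]

/-- `U k * U (τ k)` spells the inverse of the cycle word at `k`, because `ρ k = σ (τ k - 1)`, `ρ² k
= τ k` and `ρ³ k = σ (k - 1)`. -/
theorem IsFundamentalPolygon.U_U_tau (hD : D.IsFundamentalPolygon) (hg : 2 ≤ g)
    (k : ZMod (8 * g - 4)) (x : Circle) :
    mobCircle (D.U k) (mobCircle (D.U (tau k)) x) = x := by
  rw [U_apply, U_apply, tau_tau hg]
  set y := mobCircle (D.T (sigma k)) (mobCircle (D.T (tau k - 1))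
    (mobCircle (D.T (sigma (tau k))) (mobCircle (D.T (k - 1)) x))) with hy
  have h := hD.cycle_apply k y
  have e1 : rho k = sigma (tau k - 1) := (sigma_tau_sub_one hg k).symm
  rw [rho_rho hg k, rho_tau hg, e1, hy, hD.T_T_sigma hg, hD.T_sigma_T, hD.T_T_sigma hg,
    hD.T_sigma_T] at h
  exact h.symm

/-! ### Cells of the circle -/

theorem exists_mem_Ico_succ (e : ℤ → ℝ) {t : ℝ} (h0 : e 0 ≤ t) (k : ℕ) (h : t < e k) :
    ∃ N : ℤ, e N ≤ t ∧ t < e (N + 1) := by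
  induction k with
  | zero => exact absurd h (not_lt.2 (by simpa using h0))
  | succ k ih =>
    by_cases hk : t < e k
    · exact ih hk
    · exact ⟨k, not_lt.1 hk, by exact_mod_cast h⟩

namespace IsLift

variable {e : ℤ → ℝ}

theorem mem_PP (L : IsLift D e) (hg : 2 ≤ g) {i : ZMod (8 * g - 4)} {n : ℤ}
    (hn : (n : ZMod (8 * g - 4)) = i) (w : Circle) : w ∈ arcIcc (D.P i) (D.P (i + 1)) ↔
      ∃ x, e (2 * n) ≤ x ∧ x ≤ e (2 * n + 2) ∧ Circle.exp x = w := by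
  rw [L.P_at n hn, L.P_at (n + 1) (by push_cast; rw [hn]), show 2 * (n + 1) = 2 * n + 2 by ring,
    mem_arcIcc_exp (L.mono (by omega)).le (L.lt_per (by omega))]

theorem mem_PP' (L : IsLift D e) (hg : 2 ≤ g) {i : ZMod (8 * g - 4)} {n : ℤ}
    (hn : (n : ZMod (8 * g - 4)) = i) (w : Circle) : w ∈ arcIco (D.P i) (D.P (i + 1)) ↔
      ∃ x, e (2 * n) ≤ x ∧ x < e (2 * n + 2) ∧ Circle.exp x = w := by
  rw [L.P_at n hn, L.P_at (n + 1) (by push_cast; rw [hn]), show 2 * (n + 1) = 2 * n + 2 by ring,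
    mem_arcIco_exp (L.mono (by omega)).le (L.lt_per (by omega))]

theorem mem_QQ (L : IsLift D e) (hg : 2 ≤ g) {i : ZMod (8 * g - 4)} {n : ℤ}
    (hn : (n : ZMod (8 * g - 4)) = i) (w : Circle) : w ∈ arcIcc (D.Q i) (D.Q (i + 1)) ↔
      ∃ x, e (2 * n + 1) ≤ x ∧ x ≤ e (2 * n + 3) ∧ Circle.exp x = w := by
  rw [L.Q_at n hn, L.Q_at (n + 1) (by push_cast; rw [hn]),
    show 2 * (n + 1) + 1 = 2 * n + 3 by ring,
    mem_arcIcc_exp (L.mono (by omega)).le (L.lt_per (by omega))]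

theorem mem_QQ' (L : IsLift D e) (hg : 2 ≤ g) {i : ZMod (8 * g - 4)} {n : ℤ}
    (hn : (n : ZMod (8 * g - 4)) = i) (w : Circle) : w ∈ arcIco (D.Q i) (D.Q (i + 1)) ↔
      ∃ x, e (2 * n + 1) ≤ x ∧ x < e (2 * n + 3) ∧ Circle.exp x = w := by
  rw [L.Q_at n hn, L.Q_at (n + 1) (by push_cast; rw [hn]),
    show 2 * (n + 1) + 1 = 2 * n + 3 by ring,
    mem_arcIco_exp (L.mono (by omega)).le (L.lt_per (by omega))]

theorem mem_PQ' (L : IsLift D e) (hg : 2 ≤ g) {i : ZMod (8 * g - 4)} {n : ℤ}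
    (hn : (n : ZMod (8 * g - 4)) = i) (w : Circle) : w ∈ arcIco (D.P i) (D.Q i) ↔
      ∃ x, e (2 * n) ≤ x ∧ x < e (2 * n + 1) ∧ Circle.exp x = w := by
  rw [L.P_at n hn, L.Q_at n hn, mem_arcIco_exp (L.mono (by omega)).le (L.lt_per (by omega))]

theorem mem_QP' (L : IsLift D e) (hg : 2 ≤ g) {i : ZMod (8 * g - 4)} {n : ℤ}
    (hn : (n : ZMod (8 * g - 4)) = i) (w : Circle) : w ∈ arcIco (D.Q i) (D.P (i + 1)) ↔
      ∃ x, e (2 * n + 1) ≤ x ∧ x < e (2 * n + 2) ∧ Circle.exp x = w := by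
  rw [L.P_at (n + 1) (by push_cast; rw [hn]), L.Q_at n hn, show 2 * (n + 1) = 2 * n + 2 by ring,
    mem_arcIco_exp (L.mono (by omega)).le (L.lt_per (by omega))]

end IsLift

theorem IsFundamentalPolygon.exists_cell (hD : D.IsFundamentalPolygon) (hg : 2 ≤ g) (w : Circle) :
    ∃ i, w ∈ arcIco (D.P i) (D.Q i) ∨ w ∈ arcIco (D.Q i) (D.P (i + 1)) := by
  obtain ⟨e, L⟩ := hD.exists_isLift
  obtain ⟨t, h1, h2, rfl⟩ := exists_lift w (e 0)
  obtain ⟨N, hN1, hN2⟩ := exists_mem_Ico_succ e h1 (2 * (8 * g - 4)) (by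
    rw [← L.per] at h2
    convert h2 using 2
    omega)
  obtain ⟨n, rfl | rfl⟩ := Int.even_or_odd' N
  · exact ⟨n, .inl ((L.mem_PQ' hg rfl _).2 ⟨t, hN1, hN2, rfl⟩)⟩
  · exact ⟨n, .inr ((L.mem_QP' hg rfl _).2 ⟨t, hN1, by rwa [add_assoc, one_add_one_eq_two] at hN2, rfl⟩)⟩

theorem IsFundamentalPolygon.PQ_subset (hD : D.IsFundamentalPolygon) (hg : 2 ≤ g)
    {i : ZMod (8 * g - 4)} {w : Circle} (h : w ∈ arcIco (D.P i) (D.Q i)) :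
    w ∈ arcIco (D.P i) (D.P (i + 1)) ∧ w ∈ arcIco (D.Q (i - 1)) (D.Q (i - 1 + 1)) := by
  obtain ⟨e, L⟩ := hD.exists_isLift
  obtain ⟨n, hn⟩ := ZMod.intCast_surjective i
  obtain ⟨x, h1, h2, rfl⟩ := (L.mem_PQ' hg hn _).1 h
  refine ⟨(L.mem_PP' hg hn _).2 ⟨x, h1, h2.trans (L.mono (by omega)), rfl⟩,
    (L.mem_QQ' hg (n := n - 1) (by push_cast; rw [hn]) _).2
      ⟨x, (L.mono (by omega)).le.trans h1, ?_, rfl⟩⟩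
  rwa [show 2 * (n - 1) + 3 = 2 * n + 1 by ring]

theorem IsFundamentalPolygon.QP_subset (hD : D.IsFundamentalPolygon) (hg : 2 ≤ g)
    {i : ZMod (8 * g - 4)} {w : Circle} (h : w ∈ arcIco (D.Q i) (D.P (i + 1))) :
    w ∈ arcIco (D.P i) (D.P (i + 1)) ∧ w ∈ arcIco (D.Q i) (D.Q (i + 1)) := by
  obtain ⟨e, L⟩ := hD.exists_isLift
  obtain ⟨n, hn⟩ := ZMod.intCast_surjective i
  obtain ⟨x, h1, h2, rfl⟩ := (L.mem_QP' hg hn _).1 h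
  exact ⟨(L.mem_PP' hg hn _).2 ⟨x, (L.mono (by omega)).le.trans h1, h2, rfl⟩,
    (L.mem_QQ' hg hn _).2 ⟨x, h1, h2.trans (L.mono (by omega)), rfl⟩⟩

theorem IsFundamentalPolygon.PP_unique (hD : D.IsFundamentalPolygon) (hg : 2 ≤ g)
    {i j : ZMod (8 * g - 4)} {w : Circle} (hi : w ∈ arcIco (D.P i) (D.P (i + 1)))
    (hj : w ∈ arcIco (D.P j) (D.P (j + 1))) : i = j := by
  obtain ⟨e, L⟩ := hD.exists_isLift
  obtain ⟨n, hn⟩ := ZMod.intCast_surjective i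
  -- The window straddles `n`, so that the two lifts of `w` differ by less than a full turn and must
  -- be equal.
  obtain ⟨k, hk1, hk2, hk⟩ := exists_int_rep hg j (n - 5)
  obtain ⟨x, h1, h2, rfl⟩ := (L.mem_PP' hg hn _).1 hi
  obtain ⟨y, h3, h4, h5⟩ := (L.mem_PP' hg hk _).1 hj
  have := exp_inj_of_lt h5 (by
    linarith [L.le_per (show 2 * k + 2 ≤ 2 * n + 2 * (8 * (g : ℤ) - 4) by omega)]) (by
    linarith [L.le_per (show 2 * n + 2 ≤ 2 * k + 2 * (8 * (g : ℤ) - 4) by omega)])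
  subst this
  have a1 := L.mono.lt_iff_lt.1 (h1.trans_lt h4)
  have a2 := L.mono.lt_iff_lt.1 (h3.trans_lt h2)
  rw [← hn, ← hk, show n = k by omega]

theorem IsFundamentalPolygon.QQ_unique (hD : D.IsFundamentalPolygon) (hg : 2 ≤ g)
    {i j : ZMod (8 * g - 4)} {w : Circle} (hi : w ∈ arcIco (D.Q i) (D.Q (i + 1)))
    (hj : w ∈ arcIco (D.Q j) (D.Q (j + 1))) : i = j := by
  obtain ⟨e, L⟩ := hD.exists_isLift
  obtain ⟨n, hn⟩ := ZMod.intCast_surjective i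
  obtain ⟨k, hk1, hk2, hk⟩ := exists_int_rep hg j (n - 5)
  obtain ⟨x, h1, h2, rfl⟩ := (L.mem_QQ' hg hn _).1 hi
  obtain ⟨y, h3, h4, h5⟩ := (L.mem_QQ' hg hk _).1 hj
  have := exp_inj_of_lt h5 (by
    linarith [L.le_per (show 2 * k + 3 ≤ 2 * n + 1 + 2 * (8 * (g : ℤ) - 4) by omega)]) (by
    linarith [L.le_per (show 2 * n + 3 ≤ 2 * k + 1 + 2 * (8 * (g : ℤ) - 4) by omega)])
  subst this
  have a1 := L.mono.lt_iff_lt.1 (h1.trans_lt h4)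
  have a2 := L.mono.lt_iff_lt.1 (h3.trans_lt h2)
  rw [← hn, ← hk, show n = k by omega]

/-- Every point lies in exactly one arc `[P i, P (i + 1))` and one arc `[Q j, Q (j + 1))`. -/
theorem IsFundamentalPolygon.exists_cells (hD : D.IsFundamentalPolygon) (hg : 2 ≤ g) (w : Circle) :
    ∃ i j, w ∈ arcIco (D.P i) (D.P (i + 1)) ∧ w ∈ arcIco (D.Q j) (D.Q (j + 1)) := by
  obtain ⟨i, h | h⟩ := hD.exists_cell hg w
  · exact ⟨i, i - 1, hD.PQ_subset hg h⟩
  · exact ⟨i, i, hD.QP_subset hg h⟩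

theorem IsFundamentalPolygon.cell_cases (hD : D.IsFundamentalPolygon) (hg : 2 ≤ g)
    {i j : ZMod (8 * g - 4)} {w : Circle} (hi : w ∈ arcIco (D.P i) (D.P (i + 1)))
    (hj : w ∈ arcIco (D.Q j) (D.Q (j + 1))) :
    (j = i - 1 ∧ w ∈ arcIco (D.P i) (D.Q i)) ∨ (j = i ∧ w ∈ arcIco (D.Q i) (D.P (i + 1))) := by
  obtain ⟨k, h | h⟩ := hD.exists_cell hg w
  · have h' := hD.PQ_subset hg h
    obtain rfl := hD.PP_unique hg hi h'.1
    exact .inl ⟨hD.QQ_unique hg hj h'.2, h⟩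
  · have h' := hD.QP_subset hg h
    obtain rfl := hD.PP_unique hg hi h'.1
    exact .inr ⟨hD.QQ_unique hg hj h'.2, h⟩

/-! ### The arithmetic domain over a cell -/

/-- Both kinds of rectangles obey one formula: the left end of the fibre depends only on the arc
between `P`'s, the right end only on the arc between `Q`'s. This separates lower from upper
conditions. -/
theorem IsFundamentalPolygon.mem_OmegaAHalf_iff (hD : D.IsFundamentalPolygon) (hg : 2 ≤ g)
    {i j : ZMod (8 * g - 4)} {w : Circle} (hi : w ∈ arcIco (D.P i) (D.P (i + 1)))
    (hj : w ∈ arcIco (D.Q j) (D.Q (j + 1))) (G : ZMod (8 * g - 4) → Circle) (u : Circle) :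
    (u, w) ∈ D.OmegaAHalf G ↔ u ∈ arcIco (D.H G (i + 1)) (G (j - 1)) := by
  simp only [OmegaAHalf, mem_iUnion, mem_union, mem_prod]
  constructor
  · rintro ⟨k, ⟨hu, hw⟩ | ⟨hu, hw⟩⟩
    · have h' := hD.PQ_subset hg hw
      obtain rfl := hD.PP_unique hg hi h'.1
      obtain rfl := hD.QQ_unique hg hj h'.2
      rwa [sub_sub, one_add_one_eq_two]
    · have h' := hD.QP_subset hg hw
      obtain rfl := hD.PP_unique hg hi h'.1
      obtain rfl := hD.QQ_unique hg hj h'.2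
      exact hu
  · intro hu
    rcases hD.cell_cases hg hi hj with ⟨rfl, h⟩ | ⟨rfl, h⟩
    · rw [sub_sub, one_add_one_eq_two] at hu
      exact ⟨i, .inl ⟨hu, h⟩⟩
    · exact ⟨j, .inr ⟨hu, h⟩⟩

theorem IsFundamentalPolygon.H_mem (hD : D.IsFundamentalPolygon) (hg : 2 ≤ g)
    {G : ZMod (8 * g - 4) → Circle} (hG : ∀ i, G i ∈ arcIcc (D.P i) (D.P (i + 1)))
    (i : ZMod (8 * g - 4)) : D.H G i ∈ arcIcc (D.Q i) (D.Q (i + 1)) := by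
  have h := (mobCircle_image_arcIcc (D.U i) _ _).2 (hG (tau i - 1))
  rwa [sub_add_cancel, hD.U_P_pred hg, hD.U_P hg] at h

/-! ### The geometric domain over a cell -/

/-- Divided by `|u - w|² |z - w|²`, the number `dt u w z` is, up to a constant, the difference of
the horizontal coordinates of `u` and `z` in the half-plane model with `w` at infinity. The identity
says that differences add up. -/
theorem dt_cocycle (u v z : ℂ) (w : Circle) :
    dt u w v * ((z.re - (w : ℂ).re) ^ 2 + (z.im - (w : ℂ).im) ^ 2) +
    dt v w z * ((u.re - (w : ℂ).re) ^ 2 + (u.im - (w : ℂ).im) ^ 2) =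
    dt u w z * ((v.re - (w : ℂ).re) ^ 2 + (v.im - (w : ℂ).im) ^ 2) := by
  have hw := circle_sq w
  have hN (z : ℂ) : (z.re - (w : ℂ).re) ^ 2 + (z.im - (w : ℂ).im) ^ 2 =
      1 + (z.re ^ 2 + z.im ^ 2) - 2 * ((w : ℂ).re * z.re + (w : ℂ).im * z.im) := by
    linear_combination hw
  have key : dt u w v * (1 + (z.re ^ 2 + z.im ^ 2) - 2 * ((w : ℂ).re * z.re + (w : ℂ).im * z.im)) +
    dt v w z * (1 + (u.re ^ 2 + u.im ^ 2) - 2 * ((w : ℂ).re * u.re + (w : ℂ).im * u.im)) -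
    dt u w z * (1 + (v.re ^ 2 + v.im ^ 2) - 2 * ((w : ℂ).re * v.re + (w : ℂ).im * v.im)) =
    dt u v z * ((w : ℂ).re ^ 2 + (w : ℂ).im ^ 2 - 1) := by
    unfold dt
    ring
  rw [hw] at key
  simp only [hN]
  linarith

theorem dist_pos (w : Circle) {z : ℂ} (h : z ≠ w) :
    0 < (z.re - (w : ℂ).re) ^ 2 + (z.im - (w : ℂ).im) ^ 2 := by
  by_contra hn
  have h1 : (z.re - (w : ℂ).re) ^ 2 = 0 := by
    nlinarith [sq_nonneg (z.re - (w : ℂ).re), sq_nonneg (z.im - (w : ℂ).im)]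
  have h2 : (z.im - (w : ℂ).im) ^ 2 = 0 := by
    nlinarith [sq_nonneg (z.re - (w : ℂ).re), sq_nonneg (z.im - (w : ℂ).im)]
  exact h (Complex.ext (by linarith [pow_eq_zero_iff two_ne_zero |>.1 h1])
    (by linarith [pow_eq_zero_iff two_ne_zero |>.1 h2]))

theorem ne_coe_of_norm_lt (w : Circle) {z : ℂ} (h : ‖z‖ < 1) : z ≠ w := by
  rintro rfl
  exact h.ne (Circle.norm_coe w)

/-- Seen from a point `v` of the disk, `w` lies between `p` and `q`. -/
theorem exists_fan {x y s r t : ℝ} {v : ℂ} (hv : ‖v‖ < 1)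
    (h : dt (Circle.exp x) (Circle.exp y) v = 0) (hy : y < x + 2 * Real.pi)
    (hs : x ≤ s) (hsr : s ≤ r) (hrt : r ≤ t) (hst : s < t) (ht : t ≤ y) (hne : x < s ∨ t < y) :
    ∃ a b : ℝ, 0 ≤ a ∧ 0 ≤ b ∧ 0 < a + b ∧ ∀ z : ℂ,
      dt v (Circle.exp r) z = a * dt v (Circle.exp s) z + b * dt v (Circle.exp t) z := by
  have h0 := dt_pos_of_line hv h hy hs hst ht hne
  have h1 : 0 ≤ dt (Circle.exp r) (Circle.exp t) v := by
    rcases hrt.eq_or_lt with rfl | h'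
    · rw [dt_self]
    · exact dt_nonneg_of_line hv h hy (hs.trans hsr) h' ht
  have h2 : 0 ≤ dt (Circle.exp s) (Circle.exp r) v := by
    rcases hsr.eq_or_lt with rfl | h'
    · rw [dt_self]
    · exact dt_nonneg_of_line hv h hy hs h' (hrt.trans ht)
  have h3 : 0 < dt (Circle.exp r) (Circle.exp t) v + dt (Circle.exp s) (Circle.exp r) v := by
    rcases hrt.eq_or_lt with rfl | h'
    · rw [dt_self, zero_add]; exact h0
    · refine add_pos_of_pos_of_nonneg (dt_pos_of_line hv h hy (hs.trans hsr) h' ht ?_) h2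
      exact hne.imp_left fun h ↦ h.trans_le hsr
  refine ⟨_ / _, _ / _, div_nonneg h1 h0.le, div_nonneg h2 h0.le, ?_, fun z ↦ ?_⟩
  · rw [← add_div]; exact div_pos h3 h0
  · have := dt_plucker v (Circle.exp r) (Circle.exp s) (Circle.exp t) z
    field_simp
    linarith

theorem comb_nonneg {a b x y : ℝ} (ha : 0 ≤ a) (hb : 0 ≤ b) (hx : 0 ≤ x) (hy : 0 ≤ y) :
    0 ≤ a * x + b * y := by positivity

theorem comb_pos {a b x y : ℝ} (ha : 0 ≤ a) (hb : 0 ≤ b) (hab : 0 < a + b) (hx : 0 < x)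
    (hy : 0 < y) : 0 < a * x + b * y := by
  rcases ha.eq_or_lt with rfl | ha
  · rw [zero_add] at hab; positivity
  · positivity

theorem exists_line_factor {v : ℂ} (hv : ‖v‖ < 1) {a b : Circle} (hab : a ≠ b)
    (h : dt a b v = 0) : ∃ c d : ℝ, 0 < c ∧ 0 < d ∧ ∀ z : ℂ,
      dt v a z = -(c * dt a b z) ∧ dt v b z = d * dt a b z := by
  obtain ⟨c, d, hc, hd, hcd⟩ := exists_comb hv hab h
  refine ⟨d, c, hd, hc, fun z ↦ ⟨?_, ?_⟩⟩
  · rw [hcd, dt_self, dt_swap b a z]; ring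
  · rw [hcd, dt_self]; ring

/-- Sides `i` and `i + 1` meet at `V (i + 1)` and start at `P i` and `P (i + 1)`. The geodesic from
`w` through the vertex runs between them, so the linear form defining it is, up to sign, a
non-negative combination of theirs; it supports the polygon. -/
theorem IsFundamentalPolygon.exists_fan_P (hD : D.IsFundamentalPolygon) (hg : 2 ≤ g)
    {i : ZMod (8 * g - 4)} {w : Circle} (hw : w ∈ arcIcc (D.P i) (D.P (i + 1))) :
    ∃ a b : ℝ, 0 ≤ a ∧ 0 ≤ b ∧ 0 < a + b ∧ ∀ z : ℂ,
      -dt (D.V (i + 1)) w z = a * dt (D.P i) (D.Q (i + 1)) z +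
        b * dt (D.P (i + 1)) (D.Q (i + 1 + 1)) z := by
  obtain ⟨e, L⟩ := hD.exists_isLift
  obtain ⟨n, hn⟩ := ZMod.intCast_surjective i
  have hn1 : ((n + 1 : ℤ) : ZMod (8 * g - 4)) = i + 1 := by push_cast; rw [hn]
  obtain ⟨r, h1, h2, rfl⟩ := (L.mem_PP hg hn _).1 hw
  have hv := hD.vertex_mem (i + 1)
  have hl := hD.line_end_exp L hn1
  rw [show 2 * (n + 1) - 2 = 2 * n by ring, show 2 * (n + 1) + 1 = 2 * n + 3 by ring] at hl
  obtain ⟨a, b, ha, hb, hab, H⟩ := exists_fan hv hl (L.lt_per (by omega)) le_rfl h1 h2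
    (L.mono (by omega)) (L.mono (by omega)).le (.inr (L.mono (by omega)))
  have h3 := hD.line_end (i + 1)
  rw [add_sub_cancel_right] at h3
  obtain ⟨c, _, hc, -, hc'⟩ := exists_line_factor hv (hD.P_ne_Q hg i) h3
  obtain ⟨d, _, hd, -, hd'⟩ := exists_line_factor hv (hD.P_ne_Q hg (i + 1)) (hD.line_start (i + 1))
  refine ⟨a * c, b * d, by positivity, by positivity, comb_pos ha hb hab hc hd, fun z ↦ ?_⟩
  have hP : D.P (i + 1) = Circle.exp (e (2 * n + 2)) := by
    rw [L.P_at _ hn1, show 2 * (n + 1) = 2 * n + 2 by ring]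
  rw [H z, ← L.P_at n hn, ← hP, (hc' z).1, (hd' z).1]
  ring

/-- The mirror image: sides `j - 1` and `j` meet at `V j` and end at `Q j` and `Q (j + 1)`. -/
theorem IsFundamentalPolygon.exists_fan_Q (hD : D.IsFundamentalPolygon) (hg : 2 ≤ g)
    {j : ZMod (8 * g - 4)} {w : Circle} (hw : w ∈ arcIcc (D.Q j) (D.Q (j + 1))) :
    ∃ a b : ℝ, 0 ≤ a ∧ 0 ≤ b ∧ 0 < a + b ∧ ∀ z : ℂ,
      dt (D.V j) w z = a * dt (D.P (j - 1)) (D.Q (j - 1 + 1)) z +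
        b * dt (D.P j) (D.Q (j + 1)) z := by
  obtain ⟨e, L⟩ := hD.exists_isLift
  obtain ⟨n, hn⟩ := ZMod.intCast_surjective j
  have hn1 : ((n + 1 : ℤ) : ZMod (8 * g - 4)) = j + 1 := by push_cast; rw [hn]
  obtain ⟨r, h1, h2, rfl⟩ := (L.mem_QQ hg hn _).1 hw
  have hv := hD.vertex_mem j
  obtain ⟨a, b, ha, hb, hab, H⟩ := exists_fan hv (hD.line_start_exp L hn) (L.lt_per (by omega))
    (L.mono (by omega)).le h1 h2 (L.mono (by omega)) le_rfl (.inl (L.mono (by omega)))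
  have h3 := hD.line_end j
  have h4 := hD.P_ne_Q hg (j - 1)
  rw [sub_add_cancel] at h4 ⊢
  obtain ⟨_, c, -, hc, hc'⟩ := exists_line_factor hv h4 h3
  obtain ⟨_, d, -, hd, hd'⟩ := exists_line_factor hv (hD.P_ne_Q hg j) (hD.line_start j)
  refine ⟨a * c, b * d, by positivity, by positivity, comb_pos ha hb hab hc hd, fun z ↦ ?_⟩
  have hQ : D.Q (j + 1) = Circle.exp (e (2 * n + 3)) := by
    rw [L.Q_at _ hn1, show 2 * (n + 1) + 1 = 2 * n + 3 by ring]
  rw [H z, ← L.Q_at n hn, ← hQ, (hc' z).2, (hd' z).2]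
  ring

/-- Seen from the end point `w` of a geodesic, `V (i + 1)` is the rightmost point of the polygon. -/
theorem IsFundamentalPolygon.dt_right_nonpos (hD : D.IsFundamentalPolygon) (hg : 2 ≤ g)
    {i : ZMod (8 * g - 4)} {w : Circle} (hw : w ∈ arcIcc (D.P i) (D.P (i + 1))) {z : ℂ}
    (hz : z ∈ D.closedPolygon) : dt (D.V (i + 1)) w z ≤ 0 := by
  obtain ⟨a, b, ha, hb, -, h⟩ := hD.exists_fan_P hg hw
  have := comb_nonneg ha hb ((mem_closedPolygon.1 hz).2 i) ((mem_closedPolygon.1 hz).2 (i + 1))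
  linarith [h z]

theorem IsFundamentalPolygon.dt_right_neg (hD : D.IsFundamentalPolygon) (hg : 2 ≤ g)
    {i : ZMod (8 * g - 4)} {w : Circle} (hw : w ∈ arcIcc (D.P i) (D.P (i + 1))) {z : ℂ}
    (hz : z ∈ D.openPolygon) : dt (D.V (i + 1)) w z < 0 := by
  obtain ⟨a, b, ha, hb, hab, h⟩ := hD.exists_fan_P hg hw
  have := comb_pos ha hb hab ((mem_openPolygon.1 hz).2 i) ((mem_openPolygon.1 hz).2 (i + 1))
  linarith [h z]

/-- Seen from the end point `w` of a geodesic, `V j` is the leftmost point of the polygon. -/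
theorem IsFundamentalPolygon.dt_left_nonneg (hD : D.IsFundamentalPolygon) (hg : 2 ≤ g)
    {j : ZMod (8 * g - 4)} {w : Circle} (hw : w ∈ arcIcc (D.Q j) (D.Q (j + 1))) {z : ℂ}
    (hz : z ∈ D.closedPolygon) : 0 ≤ dt (D.V j) w z := by
  obtain ⟨a, b, ha, hb, -, h⟩ := hD.exists_fan_Q hg hw
  rw [h z]
  exact comb_nonneg ha hb ((mem_closedPolygon.1 hz).2 _) ((mem_closedPolygon.1 hz).2 _)

theorem mem_OmegaGeo {u w : Circle} :
    (u, w) ∈ D.OmegaGeo ↔ u ≠ w ∧ ∃ z ∈ D.closedPolygon, dt u w z = 0 := by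
  simp [OmegaGeo, side_eq]

theorem mem_OmegaGeoHalf {u w : Circle} :
    (u, w) ∈ D.OmegaGeoHalf ↔ u ≠ w ∧ ((∃ z ∈ D.openPolygon, dt u w z = 0) ∨
      ((∃ z ∈ D.closedPolygon, dt u w z = 0) ∧ ∀ z ∈ D.closedPolygon, 0 ≤ dt u w z)) := by
  simp [OmegaGeoHalf, side_eq]

theorem OmegaGeoHalf_subset : D.OmegaGeoHalf ⊆ D.OmegaGeo := by
  rintro p ⟨h, ⟨z, hz, h'⟩ | ⟨h', -⟩⟩
  · exact ⟨h, z, openPolygon_subset hz, h'⟩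
  · exact ⟨h, h'⟩

/-- The polygon is convex and, seen from `w`, spans the angle between `V (i + 1)` and `V j`. A
geodesic ending at `w` meets it iff it does not leave both vertices strictly on one side. -/
theorem IsFundamentalPolygon.mem_OmegaGeo_iff (hD : D.IsFundamentalPolygon) (hg : 2 ≤ g)
    {i j : ZMod (8 * g - 4)} {u w : Circle} (hi : w ∈ arcIcc (D.P i) (D.P (i + 1)))
    (hj : w ∈ arcIcc (D.Q j) (D.Q (j + 1))) (huw : u ≠ w) :
    (u, w) ∈ D.OmegaGeo ↔ 0 ≤ dt u w (D.V (i + 1)) ∧ dt u w (D.V j) ≤ 0 := by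
  rw [mem_OmegaGeo]
  constructor
  · rintro ⟨-, z, hz, h⟩
    have hN := dist_pos w (ne_coe_of_norm_lt w hz.1)
    have hNu := dist_pos w (z := u) (fun h ↦ huw (Subtype.ext h))
    constructor
    · have h1 := dt_cocycle u (D.V (i + 1)) z w
      rw [h, zero_mul] at h1
      have h2 := hD.dt_right_nonpos hg hi hz
      by_contra hn
      nlinarith [mul_neg_of_neg_of_pos (not_le.1 hn) hN, mul_nonneg (neg_nonneg.2 h2) hNu.le]
    · have h1 := dt_cocycle u (D.V j) z w
      rw [h, zero_mul] at h1
      have h2 := hD.dt_left_nonneg hg hj hz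
      by_contra hn
      nlinarith [mul_pos (not_le.1 hn) hN, mul_nonneg h2 hNu.le]
  · rintro ⟨h1, h2⟩
    exact ⟨huw, exists_mem_closedPolygon (hD.vertex_mem_closedPolygon hg _)
      (hD.vertex_mem_closedPolygon hg _) h2 h1⟩

/-- A geodesic through `V (i + 1)` has the polygon on its right and is excluded; one through `V j`
has it on its left and is kept. Hence one inequality is strict and the other is not. -/
theorem IsFundamentalPolygon.mem_OmegaGeoHalf_iff (hD : D.IsFundamentalPolygon) (hg : 2 ≤ g)
    {i j : ZMod (8 * g - 4)} {u w : Circle} (hi : w ∈ arcIcc (D.P i) (D.P (i + 1)))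
    (hj : w ∈ arcIcc (D.Q j) (D.Q (j + 1))) (huw : u ≠ w) :
    (u, w) ∈ D.OmegaGeoHalf ↔ 0 < dt u w (D.V (i + 1)) ∧ dt u w (D.V j) ≤ 0 := by
  have hNu := dist_pos w (z := u) (fun h ↦ huw (Subtype.ext h))
  have hNv (k) := dist_pos w (ne_coe_of_norm_lt w (hD.vertex_mem k))
  constructor
  · intro h
    obtain ⟨h1, h2⟩ := (hD.mem_OmegaGeo_iff hg hi hj huw).1 (OmegaGeoHalf_subset h)
    refine ⟨h1.lt_of_ne fun h0 ↦ ?_, h2⟩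
    obtain ⟨-, ⟨z, hz, h3⟩ | ⟨-, h3⟩⟩ := mem_OmegaGeoHalf.1 h
    · have h4 := dt_cocycle u (D.V (i + 1)) z w
      rw [h3, ← h0, zero_mul, zero_mul, zero_add] at h4
      exact (mul_neg_of_neg_of_pos (hD.dt_right_neg hg hi hz) hNu).ne h4
    · obtain ⟨z, hz⟩ := hD.openPolygon_nonempty hg
      have h4 := dt_cocycle u (D.V (i + 1)) z w
      rw [← h0, zero_mul, zero_add] at h4
      have h5 := mul_neg_of_neg_of_pos (hD.dt_right_neg hg hi hz) hNu
      have h6 := mul_nonneg (h3 z (openPolygon_subset hz)) (hNv (i + 1)).le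
      linarith
  · rintro ⟨h1, h2⟩
    rw [mem_OmegaGeoHalf]
    refine ⟨huw, ?_⟩
    rcases h2.eq_or_lt with h2 | h2
    · refine .inr ⟨⟨_, hD.vertex_mem_closedPolygon hg j, h2⟩, fun z hz ↦ ?_⟩
      have h4 := dt_cocycle u (D.V j) z w
      rw [h2, zero_mul, zero_add] at h4
      have h5 := mul_nonneg (hD.dt_left_nonneg hg hj hz) hNu.le
      rw [h4] at h5
      exact nonneg_of_mul_nonneg_left h5 (hNv j)
    · left
      obtain ⟨z, hz⟩ := hD.openPolygon_nonempty hg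
      have hz' := (mem_openPolygon.1 hz).2
      rcases lt_trichotomy (dt u w z) 0 with h | h | h
      · exact exists_mem_openPolygon (openPolygon_subset hz) (hD.vertex_mem_closedPolygon hg _) h h1
          fun k ↦ .inl (hz' k)
      · exact ⟨z, hz, h⟩
      · exact exists_mem_openPolygon (hD.vertex_mem_closedPolygon hg _) (openPolygon_subset hz) h2 h
          fun k ↦ .inr (hz' k)

open scoped Topology

/-! ### Closures and interiors of the arithmetic domain -/

theorem finite_index (hg : 2 ≤ g) : Finite (ZMod (8 * g - 4)) := by
  have : NeZero (8 * g - 4) := ⟨by omega⟩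
  infer_instance

theorem IsFundamentalPolygon.P_ne_Q_self (hD : D.IsFundamentalPolygon) (hg : 2 ≤ g)
    (i : ZMod (8 * g - 4)) : D.P i ≠ D.Q i := by
  obtain ⟨e, L⟩ := hD.exists_isLift
  obtain ⟨n, hn⟩ := ZMod.intCast_surjective i
  rw [L.P_at n hn, L.Q_at n hn]
  exact exp_ne_of_lt (L.mono (by omega)) (L.lt_per (by omega))

theorem IsFundamentalPolygon.Q_ne_P_succ (hD : D.IsFundamentalPolygon) (hg : 2 ≤ g)
    (i : ZMod (8 * g - 4)) : D.Q i ≠ D.P (i + 1) := by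
  obtain ⟨e, L⟩ := hD.exists_isLift
  obtain ⟨n, hn⟩ := ZMod.intCast_surjective i
  rw [L.P_at (n + 1) (by push_cast; rw [hn]), L.Q_at n hn]
  exact exp_ne_of_lt (L.mono (by omega)) (L.lt_per (by omega))

theorem IsLift.exists_H {e : ℤ → ℝ} (L : IsLift D e) (hD : D.IsFundamentalPolygon) (hg : 2 ≤ g)
    {G : ZMod (8 * g - 4) → Circle} (hG : ∀ i, G i ∈ arcIcc (D.P i) (D.P (i + 1)))
    {i : ZMod (8 * g - 4)} {n : ℤ} (hn : (n : ZMod (8 * g - 4)) = i) :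
    ∃ h, e (2 * n + 1) ≤ h ∧ h ≤ e (2 * n + 3) ∧ Circle.exp h = D.H G i :=
  (L.mem_QQ hg hn _).1 (hD.H_mem hg hG i)

/-- The arcs over the cells of the circle, in terms of lifts. -/
theorem IsLift.exists_H_G {e : ℤ → ℝ} (L : IsLift D e) (hD : D.IsFundamentalPolygon) (hg : 2 ≤ g)
    {G : ZMod (8 * g - 4) → Circle} (hG : ∀ i, G i ∈ arcIcc (D.P i) (D.P (i + 1)))
    {i k : ZMod (8 * g - 4)} {n m : ℤ} (hn : (n : ZMod (8 * g - 4)) = i)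
    (hm : (m : ZMod (8 * g - 4)) = k) (h1 : n < m + 2 * (4 * (g : ℤ) - 2) - 1)
    (h2 : m < n) :
    ∃ h γ, e (2 * n + 1) ≤ h ∧ h ≤ e (2 * n + 3) ∧ e (2 * m) + 2 * Real.pi ≤ γ ∧
      γ ≤ e (2 * m + 2) + 2 * Real.pi ∧ h < γ ∧ γ < h + 2 * Real.pi ∧
      Circle.exp h = D.H G i ∧ Circle.exp γ = G k := by
  obtain ⟨h, a1, a2, a3⟩ := L.exists_H hD hg hG hn
  obtain ⟨γ, b1, b2, b3⟩ := (L.mem_PP hg hm _).1 (hG k)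
  refine ⟨h, γ + 2 * Real.pi, a1, a2, by linarith, by linarith, ?_, ?_, a3, ?_⟩
  · linarith [L.lt_per (show 2 * n + 3 < 2 * m + 2 * (8 * (g : ℤ) - 4) by omega)]
  · linarith [L.mono (show 2 * m + 2 < 2 * n + 1 by omega)]
  · rw [Circle.exp_add_two_pi, b3]

theorem IsFundamentalPolygon.H_ne_G (hD : D.IsFundamentalPolygon) (hg : 2 ≤ g)
    {G : ZMod (8 * g - 4) → Circle} (hG : ∀ i, G i ∈ arcIcc (D.P i) (D.P (i + 1)))
    (i : ZMod (8 * g - 4)) : D.H G (i + 1) ≠ G (i - 2) ∧ D.H G (i + 1) ≠ G (i - 1) := by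
  obtain ⟨e, L⟩ := hD.exists_isLift
  obtain ⟨n, hn⟩ := ZMod.intCast_surjective i
  constructor
  · obtain ⟨h, γ, -, -, -, -, h1, h2, h3, h4⟩ := L.exists_H_G hD hg hG (n := n + 1) (m := n - 2)
      (by push_cast; rw [hn]) (by push_cast; rw [hn]) (by omega) (by omega)
    rw [← h3, ← h4]
    exact exp_ne_of_lt h1 h2
  · obtain ⟨h, γ, -, -, -, -, h1, h2, h3, h4⟩ := L.exists_H_G hD hg hG (n := n + 1) (m := n - 1)
      (by push_cast; rw [hn]) (by push_cast; rw [hn]) (by omega) (by omega)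
    rw [← h3, ← h4]
    exact exp_ne_of_lt h1 h2

theorem IsFundamentalPolygon.closure_OmegaAHalf (hD : D.IsFundamentalPolygon) (hg : 2 ≤ g)
    {G : ZMod (8 * g - 4) → Circle} (hG : ∀ i, G i ∈ arcIcc (D.P i) (D.P (i + 1))) :
    closure (D.OmegaAHalf G) = D.OmegaA G := by
  have := finite_index hg
  unfold OmegaAHalf OmegaA
  rw [closure_iUnion_of_finite]
  refine iUnion_congr fun i ↦ ?_
  rw [closure_union, closure_prod_eq, closure_prod_eq, closure_arcIco (hD.H_ne_G hg hG i).1,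
    closure_arcIco (hD.H_ne_G hg hG i).2, closure_arcIco (hD.P_ne_Q_self hg i),
    closure_arcIco (hD.Q_ne_P_succ hg i)]

theorem exists_arcIcc_of_mem_OmegaA {G : ZMod (8 * g - 4) → Circle} {u w : Circle}
    (h : (u, w) ∈ D.OmegaA G) : ∃ k, (w ∈ arcIcc (D.P k) (D.Q k) ∧
      u ∈ arcIcc (D.H G (k + 1)) (G (k - 1 - 1))) ∨ (w ∈ arcIcc (D.Q k) (D.P (k + 1)) ∧
      u ∈ arcIcc (D.H G (k + 1)) (G (k - 1))) := by
  simp only [OmegaA, mem_iUnion, mem_union, mem_prod] at h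
  obtain ⟨k, ⟨hu, hw⟩ | ⟨hu, hw⟩⟩ := h
  · exact ⟨k, .inl ⟨hw, by rwa [sub_sub, one_add_one_eq_two]⟩⟩
  · exact ⟨k, .inr ⟨hw, hu⟩⟩

theorem arcIcc_subset_insert (a b : Circle) : arcIcc a b ⊆ insert b (arcIco a b) := by
  intro x hx
  by_cases hb : x = b
  · exact .inl hb
  · exact .inr ⟨hb, hx.imp_right fun h ↦ h.resolve_left hb⟩

theorem exp_mem_closure {x y t : ℝ} (h0 : x < y) (h1 : x ≤ t) (h2 : t ≤ y) {S : Set Circle}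
    (h : ∀ s, x < s → s < y → Circle.exp s ∈ S) : Circle.exp t ∈ closure S := by
  have ht : t ∈ closure (Ioo x y) := by
    rw [closure_Ioo h0.ne]
    exact ⟨h1, h2⟩
  refine closure_mono ?_ (image_closure_subset_closure_image Circle.exp.continuous ⟨t, ht, rfl⟩)
  rintro _ ⟨s, hs, rfl⟩
  exact h s hs.1 hs.2

theorem mem_closure_compl_arcIcc {a b x : Circle} (h : x ∉ arcIco a b) :
    x ∈ closure (arcIcc a b)ᶜ := by
  obtain ⟨s, -, -, rfl⟩ := exists_lift a 0
  obtain ⟨t, h1, h2, rfl⟩ := exists_lift b s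
  obtain ⟨y, h3, h4, rfl⟩ := exists_lift x s
  refine exp_mem_closure (x := t) (y := s + 2 * Real.pi) h2 ?_ h4.le fun z hz1 hz2 hz' ↦ ?_
  · by_contra hn
    exact h ((mem_arcIco_exp h1 h2 _).2 ⟨y, h3, not_le.1 hn, rfl⟩)
  · obtain ⟨z', a1, a2, a3⟩ := (mem_arcIcc_exp h1 h2 _).1 hz'
    have := exp_inj_of_lt a3 (by linarith) (by linarith)
    linarith

theorem left_mem_arcIco {a b : Circle} (hab : a ≠ b) : a ∈ arcIco a b := ⟨hab, .inl rfl⟩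

theorem IsFundamentalPolygon.cell_unique (hD : D.IsFundamentalPolygon) (hg : 2 ≤ g)
    {i j : ZMod (8 * g - 4)} {w : Circle} (hi : w ∈ arcIco (D.P i) (D.P (i + 1)))
    (hj : w ∈ arcIco (D.Q j) (D.Q (j + 1))) (h : w ≠ D.P i) (h' : w ≠ D.Q j)
    {k : ZMod (8 * g - 4)} : (w ∈ arcIcc (D.P k) (D.Q k) → k = i ∧ k - 1 = j) ∧
      (w ∈ arcIcc (D.Q k) (D.P (k + 1)) → k = i ∧ k = j) := by
  constructor
  · intro hw
    rcases arcIcc_subset_insert _ _ hw with hw | hw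
    · have := (hD.QP_subset hg (left_mem_arcIco (hD.Q_ne_P_succ hg k))).2
      have h1 := hD.QQ_unique (i := k) (j := j) hg this (by rwa [hw] at hj)
      rw [h1] at hw
      exact absurd hw h'
    · have := hD.PQ_subset hg hw
      exact ⟨hD.PP_unique hg this.1 hi, hD.QQ_unique hg this.2 hj⟩
  · intro hw
    rcases arcIcc_subset_insert _ _ hw with hw | hw
    · have := (hD.PQ_subset hg (left_mem_arcIco (hD.P_ne_Q_self hg (k + 1)))).1
      have h1 := hD.PP_unique (i := k + 1) (j := i) hg this (by rwa [hw] at hi)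
      rw [h1] at hw
      exact absurd hw h
    · have := hD.QP_subset hg hw
      exact ⟨hD.PP_unique hg this.1 hi, hD.QQ_unique hg this.2 hj⟩

/-- Every `w` is a limit of points interior to its cell, over which only one of the closed
rectangles lies (`cell_unique`). -/
theorem IsFundamentalPolygon.mem_closure_cell (hD : D.IsFundamentalPolygon) (hg : 2 ≤ g)
    {i j : ZMod (8 * g - 4)} {w : Circle} (hi : w ∈ arcIco (D.P i) (D.P (i + 1)))
    (hj : w ∈ arcIco (D.Q j) (D.Q (j + 1))) : w ∈ closure {w | w ∈ arcIco (D.P i) (D.P (i + 1)) ∧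
      w ∈ arcIco (D.Q j) (D.Q (j + 1)) ∧ w ≠ D.P i ∧ w ≠ D.Q j} := by
  obtain ⟨e, L⟩ := hD.exists_isLift
  obtain ⟨n, hn⟩ := ZMod.intCast_surjective i
  rcases hD.cell_cases hg hi hj with ⟨rfl, h⟩ | ⟨rfl, h⟩
  · obtain ⟨t, h1, h2, rfl⟩ := (L.mem_PQ' hg hn _).1 h
    refine exp_mem_closure (h1.trans_lt h2) h1 h2.le fun s hs hs' ↦ ?_
    have := hD.PQ_subset hg ((L.mem_PQ' hg hn _).2 ⟨s, hs.le, hs', rfl⟩)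
    refine ⟨this.1, this.2, ?_, ?_⟩
    · rw [L.P_at n hn]
      exact (exp_ne_of_lt hs (hs'.trans (L.lt_per (by omega)))).symm
    · rw [L.Q_at (n - 1) (by push_cast; rw [hn])]
      exact (exp_ne_of_lt ((L.mono (by omega)).trans hs) (hs'.trans (L.lt_per (by omega)))).symm
  · obtain ⟨t, h1, h2, rfl⟩ := (L.mem_QP' hg hn _).1 h
    refine exp_mem_closure (h1.trans_lt h2) h1 h2.le fun s hs hs' ↦ ?_
    have := hD.QP_subset hg ((L.mem_QP' hg hn _).2 ⟨s, hs.le, hs', rfl⟩)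
    refine ⟨this.1, this.2, ?_, ?_⟩
    · rw [L.P_at n hn]
      exact (exp_ne_of_lt ((L.mono (by omega)).trans hs) (hs'.trans (L.lt_per (by omega)))).symm
    · rw [L.Q_at n hn]
      exact (exp_ne_of_lt hs (hs'.trans (L.lt_per (by omega)))).symm

/-- A point outside the half-open domain is a limit of points outside the closed one: move `w` into
the interior of its cell and `u` off the closed arc. -/
theorem IsFundamentalPolygon.interior_OmegaA (hD : D.IsFundamentalPolygon) (hg : 2 ≤ g)
    (G : ZMod (8 * g - 4) → Circle) :
    interior (D.OmegaA G) ⊆ D.OmegaAHalf G := by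
  rw [← compl_subset_compl, ← closure_compl]
  rintro ⟨u, w⟩ h
  obtain ⟨i, j, hi, hj⟩ := hD.exists_cells hg w
  rw [mem_compl_iff, hD.mem_OmegaAHalf_iff hg hi hj] at h
  have h1 := mk_mem_prod (mem_closure_compl_arcIcc h) (hD.mem_closure_cell hg hi hj)
  rw [← closure_prod_eq] at h1
  refine closure_mono ?_ h1
  rintro ⟨u', w'⟩ ⟨hu, hi', hj', h2, h3⟩ hA
  obtain ⟨k, ⟨hw, hu'⟩ | ⟨hw, hu'⟩⟩ := exists_arcIcc_of_mem_OmegaA hA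
  · obtain ⟨rfl, rfl⟩ := (hD.cell_unique hg hi' hj' h2 h3).1 hw
    exact hu hu'
  · obtain ⟨rfl, rfl⟩ := (hD.cell_unique hg hi' hj' h2 h3).2 hw
    exact hu hu'

/-! ### Closures and interiors of the geometric domain -/

/-- The extension of side `i` passes through `V (i + 1)` and ends at `Q (i + 1)`; a geodesic
starting before that point would have the vertex on its right. With `le_of_dt_nonpos` this confines
`u` to `[Q (i + 1), P j]`. -/
theorem IsLift.le_of_dt_nonneg {e : ℤ → ℝ} (L : IsLift D e) (hD : D.IsFundamentalPolygon)
    (hg : 2 ≤ g) {i : ZMod (8 * g - 4)} {n : ℤ} (hn : (n : ZMod (8 * g - 4)) = i) {s t : ℝ}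
    (ht : e (2 * n) ≤ t) (hts : t < s)
    (h : 0 ≤ dt (Circle.exp s) (Circle.exp t) (D.V (i + 1))) : e (2 * n + 3) ≤ s := by
  by_contra hn'
  have hl := hD.line_end_exp L (i := i + 1) (n := n + 1) (by push_cast; rw [hn])
  rw [show 2 * (n + 1) - 2 = 2 * n by ring, show 2 * (n + 1) + 1 = 2 * n + 3 by ring] at hl
  have := dt_pos_of_line (hD.vertex_mem _) hl (L.lt_per (by omega)) ht hts (not_le.1 hn').le
    (.inr (not_le.1 hn'))
  rw [dt_swap] at this
  linarith

theorem IsLift.le_of_dt_nonpos {e : ℤ → ℝ} (L : IsLift D e) (hD : D.IsFundamentalPolygon)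
    (hg : 2 ≤ g) {j : ZMod (8 * g - 4)} {m : ℤ} (hm : (m : ZMod (8 * g - 4)) = j) {s t : ℝ}
    (ht : t ≤ e (2 * m + 3)) (hst : s < t + 2 * Real.pi)
    (h : dt (Circle.exp s) (Circle.exp t) (D.V j) ≤ 0) : s ≤ e (2 * m) + 2 * Real.pi := by
  by_contra hn'
  have hl := hD.line_start_exp L hm
  have := dt_pos_of_line (s := s - 2 * Real.pi) (t := t) (hD.vertex_mem _) hl (L.lt_per (by omega))
    (by linarith) (by linarith) ht (.inl (by linarith))
  rw [Circle.exp_sub_two_pi] at this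
  linarith

theorem exists_lift_Ioo {u : Circle} {t : ℝ} (h : u ≠ Circle.exp t) :
    ∃ s, t < s ∧ s < t + 2 * Real.pi ∧ Circle.exp s = u := by
  obtain ⟨s, h1, h2, rfl⟩ := exists_lift u t
  exact ⟨s, h1.lt_of_ne fun h' ↦ h (by rw [h']), h2, rfl⟩

theorem IsFundamentalPolygon.interior_OmegaGeo (hD : D.IsFundamentalPolygon) (hg : 2 ≤ g) :
    interior D.OmegaGeo ⊆ D.OmegaGeoHalf := by
  rw [← compl_subset_compl, ← closure_compl]
  rintro ⟨u, w⟩ h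
  by_cases hgeo : (u, w) ∈ D.OmegaGeo
  swap
  · exact subset_closure hgeo
  have huw : u ≠ w := hgeo.1
  obtain ⟨i, j, hi, hj⟩ := hD.exists_cells hg w
  replace hi := arcIco_subset_arcIcc _ _ hi
  replace hj := arcIco_subset_arcIcc _ _ hj
  rw [mem_compl_iff, hD.mem_OmegaGeoHalf_iff hg hi hj huw] at h
  rw [hD.mem_OmegaGeo_iff hg hi hj huw] at hgeo
  have h0 : dt u w (D.V (i + 1)) = 0 := by
    by_contra hne
    exact h ⟨hgeo.1.lt_of_ne' hne, hgeo.2⟩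
  obtain ⟨t, -, -, rfl⟩ := exists_lift w 0
  obtain ⟨s, h1, h2, rfl⟩ := exists_lift_Ioo huw
  rw [dt_swap, neg_eq_zero] at h0
  -- Moving the starting point back towards `t` puts `V (i + 1)` strictly on the right, hence leaves
  -- the closed domain.
  have hs : Circle.exp s ∈ closure {u | (u, Circle.exp t) ∈ (D.OmegaGeo)ᶜ} := by
    refine exp_mem_closure h1 h1.le le_rfl fun s' hs' hs'' ↦ ?_
    have hlt := dt_pos_of_line (hD.vertex_mem _) h0 h2 le_rfl hs' hs''.le (.inr hs'')
    rw [mem_ofPred_eq, mem_compl_iff,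
      hD.mem_OmegaGeo_iff hg hi hj (exp_ne_of_lt hs' (by linarith)).symm, dt_swap]
    rintro ⟨h3, -⟩
    linarith
  have := mk_mem_prod hs (subset_closure (mem_singleton (Circle.exp t)))
  rw [← closure_prod_eq] at this
  refine closure_mono ?_ this
  rintro ⟨u', w'⟩ ⟨hu', rfl⟩
  exact hu'

theorem continuous_dt (v : ℂ) : Continuous fun p : Circle × Circle ↦ dt p.1 p.2 v := by
  unfold dt
  have h1 : Continuous fun p : Circle × Circle ↦ (p.1 : ℂ).re :=
    Complex.continuous_re.comp (continuous_subtype_val.comp continuous_fst)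
  have h2 : Continuous fun p : Circle × Circle ↦ (p.1 : ℂ).im :=
    Complex.continuous_im.comp (continuous_subtype_val.comp continuous_fst)
  have h3 : Continuous fun p : Circle × Circle ↦ (p.2 : ℂ).re :=
    Complex.continuous_re.comp (continuous_subtype_val.comp continuous_snd)
  have h4 : Continuous fun p : Circle × Circle ↦ (p.2 : ℂ).im :=
    Complex.continuous_im.comp (continuous_subtype_val.comp continuous_snd)
  fun_prop

/-- The condition `u ≠ w` is not closed. It becomes harmless when `u` is confined to a closed set
disjoint from that of `w`. -/
theorem IsFundamentalPolygon.isClosed_cell (hD : D.IsFundamentalPolygon) (hg : 2 ≤ g)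
    {i j : ZMod (8 * g - 4)} {C K : Set Circle} (hC : IsClosed C) (hK : IsClosed K)
    (hi : C ⊆ arcIcc (D.P i) (D.P (i + 1))) (hj : C ⊆ arcIcc (D.Q j) (D.Q (j + 1)))
    (hd : Disjoint K C)
    (h : ∀ u, ∀ w ∈ C, u ≠ w → 0 ≤ dt u w (D.V (i + 1)) → dt u w (D.V j) ≤ 0 → u ∈ K) :
    IsClosed {p ∈ D.OmegaGeo | p.2 ∈ C} := by
  have : {p ∈ D.OmegaGeo | p.2 ∈ C} = (K ×ˢ C) ∩
      {p : Circle × Circle | 0 ≤ dt p.1 p.2 (D.V (i + 1)) ∧ dt p.1 p.2 (D.V j) ≤ 0} := by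
    ext ⟨u, w⟩
    constructor
    · rintro ⟨h1, h2⟩
      have h3 := (hD.mem_OmegaGeo_iff hg (hi h2) (hj h2) h1.1).1 h1
      exact ⟨⟨h u w h2 h1.1 h3.1 h3.2, h2⟩, h3⟩
    · rintro ⟨⟨h1, h2⟩, h3⟩
      exact ⟨(hD.mem_OmegaGeo_iff hg (hi h2) (hj h2) (hd.ne_of_mem h1 h2)).2 h3, h2⟩
  rw [this]
  exact (hK.prod hC).inter ((isClosed_le continuous_const (continuous_dt _)).inter
    (isClosed_le (continuous_dt _) continuous_const))

theorem IsFundamentalPolygon.isClosed_OmegaGeo (hD : D.IsFundamentalPolygon) (hg : 2 ≤ g) :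
    IsClosed D.OmegaGeo := by
  have := finite_index hg
  obtain ⟨e, L⟩ := hD.exists_isLift
  have : D.OmegaGeo = ⋃ i, ({p ∈ D.OmegaGeo | p.2 ∈ arcIcc (D.P i) (D.Q i)} ∪
      {p ∈ D.OmegaGeo | p.2 ∈ arcIcc (D.Q i) (D.P (i + 1))}) := by
    apply subset_antisymm
    · intro p hp
      rw [mem_iUnion]
      obtain ⟨i, h | h⟩ := hD.exists_cell hg p.2
      · exact ⟨i, .inl ⟨hp, arcIco_subset_arcIcc _ _ h⟩⟩
      · exact ⟨i, .inr ⟨hp, arcIco_subset_arcIcc _ _ h⟩⟩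
    · refine iUnion_subset fun i ↦ union_subset (sep_subset _ _) (sep_subset _ _)
  rw [this]
  refine isClosed_iUnion_of_finite fun i ↦ ?_
  obtain ⟨n, hn⟩ := ZMod.intCast_surjective i
  have hn1 : ((n - 1 : ℤ) : ZMod (8 * g - 4)) = i - 1 := by push_cast; rw [hn]
  have hQ : D.Q (i + 1) = Circle.exp (e (2 * n + 3)) := by
    rw [L.Q_at (n + 1) (by push_cast; rw [hn]), show 2 * (n + 1) + 1 = 2 * n + 3 by ring]
  have hPs : D.P (i + 1) = Circle.exp (e (2 * n + 2)) := by
    rw [L.P_at (n + 1) (by push_cast; rw [hn]), show 2 * (n + 1) = 2 * n + 2 by ring]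
  have e1 := L.lt_per (show 2 * n + 3 < 2 * (n - 1) + 2 * (8 * (g : ℤ) - 4) by omega)
  have e2 := L.lt_per (show 2 * n + 3 < 2 * n + 2 * (8 * (g : ℤ) - 4) by omega)
  have e3 := L.mono (show 2 * (n - 1) < 2 * n by omega)
  have e4 := L.mono (show 2 * n < 2 * n + 1 by omega)
  have e5 := L.mono (show 2 * n + 1 < 2 * n + 2 by omega)
  have e6 := L.mono (show 2 * n + 2 < 2 * n + 3 by omega)
  refine IsClosed.union ?_ ?_
  · have hC : ∀ w, w ∈ arcIcc (D.P i) (D.Q i) ↔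
        ∃ t, e (2 * n) ≤ t ∧ t ≤ e (2 * n + 1) ∧ Circle.exp t = w := fun w ↦ by
      rw [L.P_at n hn, L.Q_at n hn, mem_arcIcc_exp e4.le (L.lt_per (by omega))]
    have hK : ∀ u, u ∈ arcIcc (D.Q (i + 1)) (D.P (i - 1)) ↔
        ∃ s, e (2 * n + 3) ≤ s ∧ s ≤ e (2 * (n - 1)) + 2 * Real.pi ∧ Circle.exp s = u := fun w ↦ by
      rw [hQ, L.P_at (n - 1) hn1, ← Circle.exp_add_two_pi (e (2 * (n - 1))),
        mem_arcIcc_exp e1.le (by linarith)]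
    refine hD.isClosed_cell hg (isClosed_arcIcc _ _) (isClosed_arcIcc _ _) (i := i) (j := i - 1)
      (K := arcIcc (D.Q (i + 1)) (D.P (i - 1))) ?_ ?_ ?_ ?_
    · intro w hw
      obtain ⟨t, h1, h2, h3⟩ := (hC w).1 hw
      exact (L.mem_PP hg hn _).2 ⟨t, h1, by linarith, h3⟩
    · intro w hw
      obtain ⟨t, h1, h2, h3⟩ := (hC w).1 hw
      exact (L.mem_QQ hg hn1 _).2 ⟨t, (L.mono (by omega)).le.trans h1, by
        rwa [show 2 * (n - 1) + 3 = 2 * n + 1 by ring], h3⟩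
    · rw [Set.disjoint_iff_forall_ne]
      intro u hu w hw
      obtain ⟨t, h1, h2, rfl⟩ := (hC w).1 hw
      obtain ⟨s, h3, h4, rfl⟩ := (hK u).1 hu
      exact (exp_ne_of_lt (by linarith) (by linarith)).symm
    · intro u w hw huw h1 h2
      obtain ⟨t, h3, h4, rfl⟩ := (hC w).1 hw
      obtain ⟨s, h5, h6, rfl⟩ := exists_lift_Ioo huw
      exact (hK _).2 ⟨s, L.le_of_dt_nonneg hD hg hn h3 h5 h1,
        L.le_of_dt_nonpos hD hg hn1 (by rwa [show 2 * (n - 1) + 3 = 2 * n + 1 by ring]) h6 h2, rfl⟩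
  · have hC : ∀ w, w ∈ arcIcc (D.Q i) (D.P (i + 1)) ↔
        ∃ t, e (2 * n + 1) ≤ t ∧ t ≤ e (2 * n + 2) ∧ Circle.exp t = w := fun w ↦ by
      rw [hPs, L.Q_at n hn, mem_arcIcc_exp e5.le (L.lt_per (by omega))]
    have hK : ∀ u, u ∈ arcIcc (D.Q (i + 1)) (D.P i) ↔
        ∃ s, e (2 * n + 3) ≤ s ∧ s ≤ e (2 * n) + 2 * Real.pi ∧ Circle.exp s = u := fun w ↦ by
      rw [hQ, L.P_at n hn, ← Circle.exp_add_two_pi (e (2 * n)),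
        mem_arcIcc_exp e2.le (by linarith)]
    refine hD.isClosed_cell hg (isClosed_arcIcc _ _) (isClosed_arcIcc _ _) (i := i) (j := i)
      (K := arcIcc (D.Q (i + 1)) (D.P i)) ?_ ?_ ?_ ?_
    · intro w hw
      obtain ⟨t, h1, h2, h3⟩ := (hC w).1 hw
      exact (L.mem_PP hg hn _).2 ⟨t, by linarith, h2, h3⟩
    · intro w hw
      obtain ⟨t, h1, h2, h3⟩ := (hC w).1 hw
      exact (L.mem_QQ hg hn _).2 ⟨t, h1, by linarith, h3⟩
    · rw [Set.disjoint_iff_forall_ne]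
      intro u hu w hw
      obtain ⟨t, h1, h2, rfl⟩ := (hC w).1 hw
      obtain ⟨s, h3, h4, rfl⟩ := (hK u).1 hu
      exact (exp_ne_of_lt (by linarith) (by linarith)).symm
    · intro u w hw huw h1 h2
      obtain ⟨t, h3, h4, rfl⟩ := (hC w).1 hw
      obtain ⟨s, h5, h6, rfl⟩ := exists_lift_Ioo huw
      exact (hK _).2 ⟨s, L.le_of_dt_nonneg hD hg hn (by linarith) h5 h1,
        L.le_of_dt_nonpos hD hg hn (by linarith) h6 h2, rfl⟩

/-- The polygon has interior points, so seen from `w` its two extreme vertices are not aligned. This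
gives room for a perturbation. -/
theorem IsFundamentalPolygon.dt_left_neg_of_right_eq_zero (hD : D.IsFundamentalPolygon)
    (hg : 2 ≤ g) {i j : ZMod (8 * g - 4)} {u w : Circle} (hi : w ∈ arcIcc (D.P i) (D.P (i + 1)))
    (hj : w ∈ arcIcc (D.Q j) (D.Q (j + 1))) (huw : u ≠ w) (h : dt u w (D.V (i + 1)) = 0) :
    dt u w (D.V j) < 0 := by
  obtain ⟨z, hz⟩ := hD.openPolygon_nonempty hg
  have hNu := dist_pos w (z := u) (fun h ↦ huw (Subtype.ext h))
  have hNv (k) := dist_pos w (ne_coe_of_norm_lt w (hD.vertex_mem k))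
  have hNz := dist_pos w (ne_coe_of_norm_lt w hz.1)
  have h1 := dt_cocycle u (D.V (i + 1)) z w
  rw [h, zero_mul, zero_add] at h1
  have h2 := mul_neg_of_neg_of_pos (hD.dt_right_neg hg hi hz) hNu
  rw [h1] at h2
  have h3 := neg_of_mul_neg_left h2 (hNv _).le
  have h4 := dt_cocycle u (D.V j) z w
  have h5 := mul_nonneg (hD.dt_left_nonneg hg hj (openPolygon_subset hz)) hNu.le
  have h6 := mul_neg_of_neg_of_pos h3 (hNv j)
  by_contra hn
  linarith [mul_nonneg (not_lt.1 hn) hNz.le]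

theorem IsFundamentalPolygon.closure_OmegaGeoHalf (hD : D.IsFundamentalPolygon) (hg : 2 ≤ g) :
    closure D.OmegaGeoHalf = D.OmegaGeo := by
  apply subset_antisymm
  · exact closure_minimal OmegaGeoHalf_subset (hD.isClosed_OmegaGeo hg)
  rintro ⟨u, w⟩ hgeo
  have huw : u ≠ w := hgeo.1
  obtain ⟨i, j, hi, hj⟩ := hD.exists_cells hg w
  replace hi := arcIco_subset_arcIcc _ _ hi
  replace hj := arcIco_subset_arcIcc _ _ hj
  rw [hD.mem_OmegaGeo_iff hg hi hj huw] at hgeo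
  rcases hgeo.1.eq_or_lt with h0 | h0
  swap
  · exact subset_closure ((hD.mem_OmegaGeoHalf_iff hg hi hj huw).2 ⟨h0, hgeo.2⟩)
  have hneg := hD.dt_left_neg_of_right_eq_zero hg hi hj huw h0.symm
  obtain ⟨t, -, -, rfl⟩ := exists_lift w 0
  obtain ⟨s, h1, h2, rfl⟩ := exists_lift_Ioo huw
  have hc : Continuous fun x : ℝ ↦ (Circle.exp x, Circle.exp t) :=
    Circle.exp.continuous.prodMk continuous_const
  refine mem_closure_of_tendsto (f := fun x : ℝ ↦ (Circle.exp x, Circle.exp t)) (b := 𝓝[>] s)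
    (hc.tendsto s |>.mono_left nhdsWithin_le_nhds) ?_
  -- Moving the starting point slightly forward puts `V (i + 1)` strictly on the left, while `V j`
  -- stays on the right by continuity.
  have ev1 : ∀ᶠ x in 𝓝[>] s, dt (Circle.exp x) (Circle.exp t) (D.V j) < 0 :=
    nhdsWithin_le_nhds (((continuous_dt (D.V j)).comp hc).continuousAt.eventually_lt
      continuousAt_const hneg)
  filter_upwards [ev1, Ioo_mem_nhdsGT h2] with x hx hx'
  have h3 : dt (Circle.exp s) (Circle.exp (t + 2 * Real.pi)) (D.V (i + 1)) = 0 := by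
    rw [Circle.exp_add_two_pi, h0]
  have h4 := dt_pos_of_line (hD.vertex_mem _) h3 (by linarith) hx'.1.le hx'.2 le_rfl (.inl hx'.1)
  rw [Circle.exp_add_two_pi] at h4
  exact (hD.mem_OmegaGeoHalf_iff hg hi hj (exp_ne_of_lt (h1.trans hx'.1) hx'.2).symm).2 ⟨h4, hx.le⟩

/-! ### The two domains in terms of lifts -/

namespace IsLift

variable {e : ℤ → ℝ}

/-- `t` lies in the cell `[P i, P (i + 1)) ∩ [Q j, Q (j + 1))`, where `n` and `m` lift `i`, `j`. -/
structure InCell (L : IsLift D e) (i j : ZMod (8 * g - 4)) (n m : ℤ) (t : ℝ) : Prop where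
  cast_n : (n : ZMod (8 * g - 4)) = i
  cast_m : (m : ZMod (8 * g - 4)) = j
  m_le : m ≤ n
  le_m : n ≤ m + 1
  P_le : e (2 * n) ≤ t
  lt_P : t < e (2 * n + 2)
  Q_le : e (2 * m + 1) ≤ t
  lt_Q : t < e (2 * m + 3)

theorem exists_inCell_of_P (L : IsLift D e) {i : ZMod (8 * g - 4)} {n : ℤ}
    (hn : (n : ZMod (8 * g - 4)) = i) {t : ℝ} (h1 : e (2 * n) ≤ t) (h2 : t < e (2 * n + 2)) :
    ∃ j m, L.InCell i j n m t := by
  rcases lt_or_ge t (e (2 * n + 1)) with h | h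
  · refine ⟨i - 1, n - 1, hn, by push_cast; rw [hn], by omega, by omega, h1, h2,
      (L.mono (by omega)).le.trans h1, ?_⟩
    rwa [show 2 * (n - 1) + 3 = 2 * n + 1 by ring]
  · exact ⟨i, n, hn, hn, le_rfl, by omega, h1, h2, h, h2.trans (L.mono (by omega))⟩

theorem exists_inCell_of_Q (L : IsLift D e) {j : ZMod (8 * g - 4)} {m : ℤ}
    (hm : (m : ZMod (8 * g - 4)) = j) {t : ℝ} (h1 : e (2 * m + 1) ≤ t) (h2 : t < e (2 * m + 3)) :
    ∃ i n, L.InCell i j n m t := by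
  rcases lt_or_ge t (e (2 * m + 2)) with h | h
  · exact ⟨j, m, hm, hm, le_rfl, by omega, (L.mono (by omega)).le.trans h1, h, h1, h2⟩
  · refine ⟨j + 1, m + 1, by push_cast; rw [hm], hm, by omega, by omega, ?_,
      h2.trans (L.mono (by omega)), h1, h2⟩
    rwa [show 2 * (m + 1) = 2 * m + 2 by ring]

variable {L : IsLift D e} {i j : ZMod (8 * g - 4)} {n m : ℤ} {t : ℝ}

namespace InCell

theorem mem_P (C : L.InCell i j n m t) (hg : 2 ≤ g) :
    Circle.exp t ∈ arcIco (D.P i) (D.P (i + 1)) :=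
  (L.mem_PP' hg C.cast_n _).2 ⟨t, C.P_le, C.lt_P, rfl⟩

theorem mem_Q (C : L.InCell i j n m t) (hg : 2 ≤ g) :
    Circle.exp t ∈ arcIco (D.Q j) (D.Q (j + 1)) :=
  (L.mem_QQ' hg C.cast_m _).2 ⟨t, C.Q_le, C.lt_Q, rfl⟩

theorem mem_OmegaAHalf (C : L.InCell i j n m t) (hD : D.IsFundamentalPolygon) (hg : 2 ≤ g)
    {G : ZMod (8 * g - 4) → Circle} {h γ s : ℝ} (hh : e (2 * n + 3) ≤ h) (hh' : h ≤ e (2 * n + 5))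
    (hH : Circle.exp h = D.H G (i + 1)) (hγ : e (2 * m - 2) + 2 * Real.pi ≤ γ)
    (hγ' : γ ≤ e (2 * m) + 2 * Real.pi) (hG : Circle.exp γ = G (j - 1))
    (hs : e (2 * n + 3) ≤ s) (hs' : s ≤ e (2 * m) + 2 * Real.pi) :
    (Circle.exp s, Circle.exp t) ∈ D.OmegaAHalf G ↔ h ≤ s ∧ s < γ := by
  have := C.m_le
  have := C.le_m
  have a1 := L.lt_per (show 2 * n + 5 < 2 * m - 2 + 2 * (8 * (g : ℤ) - 4) by omega)
  have a2 := L.mono (show 2 * m < 2 * n + 3 by omega)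
  rw [hD.mem_OmegaAHalf_iff hg (C.mem_P hg) (C.mem_Q hg), ← hH, ← hG,
    mem_arcIco_exp (by linarith) (by linarith)]
  constructor
  · rintro ⟨x, h1, h2, h3⟩
    obtain rfl := exp_inj_of_lt h3 (by linarith) (by linarith)
    exact ⟨h1, h2⟩
  · rintro ⟨h1, h2⟩
    exact ⟨s, h1, h2, rfl⟩

theorem mem_OmegaGeoHalf (C : L.InCell i j n m t) (hD : D.IsFundamentalPolygon) (hg : 2 ≤ g)
    {s : ℝ} (hs : e (2 * n + 3) ≤ s) (hs' : s ≤ e (2 * m) + 2 * Real.pi) :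
    (Circle.exp s, Circle.exp t) ∈ D.OmegaGeoHalf ↔
      0 < dt (Circle.exp s) (Circle.exp t) (D.V (i + 1)) ∧
        dt (Circle.exp s) (Circle.exp t) (D.V j) ≤ 0 := by
  refine hD.mem_OmegaGeoHalf_iff hg (arcIco_subset_arcIcc _ _ (C.mem_P hg))
    (arcIco_subset_arcIcc _ _ (C.mem_Q hg)) (exp_ne_of_lt ?_ ?_).symm
  · exact C.lt_P.trans ((L.mono (by omega)).trans_le hs)
  · linarith [C.Q_le, L.mono (show 2 * m < 2 * m + 1 by omega)]

/-- From `Q (i + 2)` on, the lower geometric condition is automatic, since the extension of side `i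
+ 1` passes through `V (i + 1)`. Likewise `dt_nonpos` makes the upper one automatic up to `P (j -
1)`. -/
theorem dt_pos (C : L.InCell i j n m t) (hD : D.IsFundamentalPolygon) {s : ℝ}
    (hs : e (2 * n + 5) ≤ s) (hs' : s ≤ e (2 * m) + 2 * Real.pi) :
    0 < dt (Circle.exp s) (Circle.exp t) (D.V (i + 1)) := by
  have hl := hD.line_start_exp' L (i := i + 1) (n := n + 1) (by push_cast; rw [C.cast_n])
  rw [show 2 * (n + 1) + 3 = 2 * n + 5 by ring, show 2 * (n + 1) = 2 * n + 2 by ring] at hl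
  rw [← Circle.exp_add_two_pi t]
  have a1 := L.mono (show 2 * n + 2 < 2 * n + 5 by omega)
  have a2 := L.mono (show 2 * m < 2 * m + 1 by omega)
  have a3 := C.lt_P
  have a4 := C.Q_le
  exact dt_pos_of_line (hD.vertex_mem _) hl (by linarith) hs (by linarith) (by linarith)
    (.inr (by linarith))

theorem dt_nonpos (C : L.InCell i j n m t) (hD : D.IsFundamentalPolygon) {s : ℝ}
    (hs : e (2 * n + 3) ≤ s) (hs' : s ≤ e (2 * m - 2) + 2 * Real.pi) :
    dt (Circle.exp s) (Circle.exp t) (D.V j) ≤ 0 := by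
  have hl := hD.line_end_exp' L C.cast_m
  have a1 := L.mono (show 2 * m - 2 < 2 * m + 1 by omega)
  have a2 := L.mono (show 2 * n + 2 < 2 * n + 3 by omega)
  rw [dt_swap, neg_nonpos]
  exact dt_nonneg_of_line (hD.vertex_mem _) hl (by linarith) C.Q_le (by linarith [C.lt_P]) hs'

end InCell

theorem exists_G (L : IsLift D e) (hg : 2 ≤ g) {G : ZMod (8 * g - 4) → Circle}
    (hG : ∀ i, G i ∈ arcIcc (D.P i) (D.P (i + 1))) {k : ZMod (8 * g - 4)} {m : ℤ}
    (hm : (m : ZMod (8 * g - 4)) = k) :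
    ∃ γ, e (2 * m - 2) + 2 * Real.pi ≤ γ ∧ γ ≤ e (2 * m) + 2 * Real.pi ∧
      Circle.exp γ = G (k - 1) := by
  obtain ⟨γ, b1, b2, b3⟩ := (L.mem_PP hg (n := m - 1) (by push_cast; rw [hm]) _).1 (hG (k - 1))
  rw [show 2 * (m - 1) = 2 * m - 2 by ring] at b1
  rw [show 2 * (m - 1) + 2 = 2 * m by ring] at b2
  exact ⟨γ + 2 * Real.pi, by linarith, by linarith, by rw [Circle.exp_add_two_pi, b3]⟩

theorem exists_H_succ (L : IsLift D e) (hD : D.IsFundamentalPolygon) (hg : 2 ≤ g)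
    {G : ZMod (8 * g - 4) → Circle} (hG : ∀ i, G i ∈ arcIcc (D.P i) (D.P (i + 1)))
    {i : ZMod (8 * g - 4)} {n : ℤ} (hn : (n : ZMod (8 * g - 4)) = i) :
    ∃ h, e (2 * n + 3) ≤ h ∧ h ≤ e (2 * n + 5) ∧ Circle.exp h = D.H G (i + 1) := by
  obtain ⟨h, h1, h2, h3⟩ := L.exists_H hD hg hG (i := i + 1) (n := n + 1) (by push_cast; rw [hn])
  rw [show 2 * (n + 1) + 1 = 2 * n + 3 by ring] at h1
  rw [show 2 * (n + 1) + 3 = 2 * n + 5 by ring] at h2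
  exact ⟨h, h1, h2, h3⟩

/-- `Q (i + 2)` comes before `P (j - 1)`, so in the lower box both upper conditions hold and only
the lower ones remain. -/
theorem lower_mem (L : IsLift D e) (hD : D.IsFundamentalPolygon) (hg : 2 ≤ g)
    {G : ZMod (8 * g - 4) → Circle} (hG : ∀ i, G i ∈ arcIcc (D.P i) (D.P (i + 1)))
    (hn : (n : ZMod (8 * g - 4)) = i) {h s : ℝ} (hh : e (2 * n + 3) ≤ h) (hh' : h ≤ e (2 * n + 5))
    (hH : Circle.exp h = D.H G (i + 1)) (ht : e (2 * n) ≤ t) (ht' : t < e (2 * n + 2))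
    (hs : e (2 * n + 3) ≤ s) (hs' : s ≤ e (2 * n + 5)) :
    ((Circle.exp s, Circle.exp t) ∈ D.OmegaAHalf G ↔ h ≤ s) ∧
    ((Circle.exp s, Circle.exp t) ∈ D.OmegaGeoHalf ↔
      0 < dt (Circle.exp s) (Circle.exp t) (D.V (i + 1))) := by
  obtain ⟨j, m, C⟩ := L.exists_inCell_of_P hn ht ht'
  obtain ⟨γ, h1, h2, h3⟩ := L.exists_G hg hG C.cast_m
  have := C.le_m
  have a1 := L.lt_per (show 2 * n + 5 < 2 * m - 2 + 2 * (8 * (g : ℤ) - 4) by omega)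
  have a2 := L.mono (show 2 * m - 2 < 2 * m by omega)
  rw [C.mem_OmegaAHalf hD hg hh hh' hH h1 h2 h3 hs (by linarith),
    C.mem_OmegaGeoHalf hD hg hs (by linarith)]
  exact ⟨and_iff_left (by linarith), and_iff_left (C.dt_nonpos hD hs (by linarith))⟩

/-- The closed box contains the edge `w = P (i + 1)`, which belongs to the next cell. There the
arithmetic fibre starts at `H (i + 2)`, at or after `Q (i + 2)`, so it reaches the box in at most
one corner point. -/
theorem lower_edge (L : IsLift D e) (hD : D.IsFundamentalPolygon) (hg : 2 ≤ g)
    {G : ZMod (8 * g - 4) → Circle} (hG : ∀ i, G i ∈ arcIcc (D.P i) (D.P (i + 1)))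
    (hn : (n : ZMod (8 * g - 4)) = i) {s : ℝ}
    (hs : e (2 * n + 3) ≤ s) (hs' : s ≤ e (2 * n + 5)) :
    ((Circle.exp s, D.P (i + 1)) ∈ D.OmegaAHalf G ↔
      Circle.exp s = D.Q (i + 2) ∧ D.H G (i + 2) = D.Q (i + 2)) ∧
    (Circle.exp s, D.P (i + 1)) ∉ D.OmegaGeoHalf ∧
    dt (Circle.exp s) (D.P (i + 1)) (D.V (i + 1)) ≤ 0 := by
  have hn1 : ((n + 1 : ℤ) : ZMod (8 * g - 4)) = i + 1 := by push_cast; rw [hn]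
  have e1 := L.mono (show 2 * n + 2 < 2 * n + 3 by omega)
  have e2 := L.mono (show 2 * n + 3 < 2 * n + 4 by omega)
  have e3 := L.mono (show 2 * n + 4 < 2 * n + 5 by omega)
  have e4 := L.mono (show 2 * n + 5 < 2 * n + 7 by omega)
  have C : L.InCell (i + 1) i (n + 1) n (e (2 * n + 2)) := by
    refine ⟨hn1, hn, by omega, le_rfl, ?_, L.mono (by omega), (L.mono (by omega)).le,
      L.mono (by omega)⟩
    rw [show 2 * (n + 1) = 2 * n + 2 by ring]
  have hP : D.P (i + 1) = Circle.exp (e (2 * n + 2)) := by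
    rw [L.P_at _ hn1, show 2 * (n + 1) = 2 * n + 2 by ring]
  have hQ : D.Q (i + 2) = Circle.exp (e (2 * n + 5)) := by
    rw [L.Q_at (n + 2) (by push_cast; rw [hn]), show 2 * (n + 2) + 1 = 2 * n + 5 by ring]
  have hl := hD.line_start_exp L hn1
  rw [show 2 * (n + 1) + 3 = 2 * n + 5 by ring, show 2 * (n + 1) = 2 * n + 2 by ring] at hl
  have hdt : dt (Circle.exp s) (D.P (i + 1)) (D.V (i + 1)) ≤ 0 := by
    rw [dt_swap, neg_nonpos, hP]
    exact dt_nonneg_of_line (hD.vertex_mem _) hl (L.lt_per (by omega)) le_rfl (by linarith) hs'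
  refine ⟨?_, fun hX ↦ ?_, hdt⟩
  · obtain ⟨h, a1, a2, a3⟩ := L.exists_H_succ hD hg hG hn1
    obtain ⟨γ, b1, b2, b3⟩ := L.exists_G hg hG hn
    rw [show 2 * (n + 1) + 3 = 2 * n + 5 by ring] at a1
    rw [show 2 * (n + 1) + 5 = 2 * n + 7 by ring] at a2
    have e5 := L.lt_per (show 2 * n + 7 < 2 * n - 2 + 2 * (8 * (g : ℤ) - 4) by omega)
    have e6 := L.mono (show 2 * n - 2 < 2 * n + 2 by omega)
    rw [add_assoc, one_add_one_eq_two] at a3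
    rw [← a3, hQ]
    constructor
    · intro hY
      rw [hP, hD.mem_OmegaAHalf_iff hg (C.mem_P hg) (C.mem_Q hg), add_assoc, one_add_one_eq_two,
        ← a3, ← b3, mem_arcIco_exp (by linarith)
          (by linarith [L.mono (show 2 * n < 2 * n + 5 by omega)])] at hY
      obtain ⟨x, h1, h2, h3⟩ := hY
      obtain rfl := exp_inj_of_lt h3
        (by linarith [L.mono (show 2 * n < 2 * n + 3 by omega)]) (by linarith)
      have : x = e (2 * n + 5) := by linarith
      exact ⟨by rw [this], by rw [show h = e (2 * n + 5) by linarith]⟩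
    · rintro ⟨h1, h2⟩
      rw [hP, hD.mem_OmegaAHalf_iff hg (C.mem_P hg) (C.mem_Q hg), add_assoc, one_add_one_eq_two,
        ← a3, ← b3, h1, ← h2]
      exact left_mem_arcIco (exp_ne_of_lt (by linarith)
        (by linarith [L.mono (show 2 * n < 2 * n + 5 by omega)]))
  · have hne : Circle.exp s ≠ Circle.exp (e (2 * n + 2)) :=
      (exp_ne_of_lt (by linarith) (hs'.trans_lt (L.lt_per (by omega)))).symm
    rw [hP, hD.mem_OmegaGeoHalf_iff hg (arcIco_subset_arcIcc _ _ (C.mem_P hg))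
      (arcIco_subset_arcIcc _ _ (C.mem_Q hg)) hne] at hX
    have := L.le_of_dt_nonneg hD hg hn1 C.P_le (by linarith) hX.1.le
    rw [show 2 * (n + 1) + 3 = 2 * n + 5 by ring] at this
    obtain rfl : s = e (2 * n + 5) := by linarith
    have h0 := hD.line_end_exp L (i := i + 1 + 1) (n := n + 2) (by
      push_cast; rw [hn, add_assoc, one_add_one_eq_two])
    rw [show 2 * (n + 2) - 2 = 2 * n + 2 by ring, show 2 * (n + 2) + 1 = 2 * n + 5 by ring,
      dt_swap, neg_eq_zero] at h0
    exact hX.1.ne' h0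

theorem upper_mem (L : IsLift D e) (hD : D.IsFundamentalPolygon) (hg : 2 ≤ g)
    {G : ZMod (8 * g - 4) → Circle} (hG : ∀ i, G i ∈ arcIcc (D.P i) (D.P (i + 1)))
    (hm : (m : ZMod (8 * g - 4)) = j) {γ s : ℝ} (hγ : e (2 * m - 2) + 2 * Real.pi ≤ γ)
    (hγ' : γ ≤ e (2 * m) + 2 * Real.pi) (hGγ : Circle.exp γ = G (j - 1))
    (ht : e (2 * m + 1) ≤ t) (ht' : t < e (2 * m + 3))
    (hs : e (2 * m - 2) + 2 * Real.pi ≤ s) (hs' : s ≤ e (2 * m) + 2 * Real.pi) :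
    ((Circle.exp s, Circle.exp t) ∈ D.OmegaAHalf G ↔ s < γ) ∧
    ((Circle.exp s, Circle.exp t) ∈ D.OmegaGeoHalf ↔
      dt (Circle.exp s) (Circle.exp t) (D.V j) ≤ 0) := by
  obtain ⟨i, n, C⟩ := L.exists_inCell_of_Q hm ht ht'
  obtain ⟨h, h1, h2, h3⟩ := L.exists_H_succ hD hg hG C.cast_n
  have := C.le_m
  have a1 := L.lt_per (show 2 * n + 5 < 2 * m - 2 + 2 * (8 * (g : ℤ) - 4) by omega)
  have a2 := L.mono (show 2 * n + 3 < 2 * n + 5 by omega)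
  rw [C.mem_OmegaAHalf hD hg h1 h2 h3 hγ hγ' hGγ (by linarith) hs',
    C.mem_OmegaGeoHalf hD hg (by linarith) hs']
  exact ⟨and_iff_right (by linarith), and_iff_right (C.dt_pos hD (by linarith) hs')⟩

/-- The edge `w = Q (j + 1)` belongs to the next cell, whose fibre ends at `G j`, at or after `P j`.
It therefore covers the edge of the box except for one corner point when `G j = P j`. -/
theorem upper_edge (L : IsLift D e) (hD : D.IsFundamentalPolygon) (hg : 2 ≤ g)
    {G : ZMod (8 * g - 4) → Circle} (hG : ∀ i, G i ∈ arcIcc (D.P i) (D.P (i + 1)))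
    (hm : (m : ZMod (8 * g - 4)) = j) {s : ℝ}
    (hs : e (2 * m - 2) + 2 * Real.pi ≤ s) (hs' : s ≤ e (2 * m) + 2 * Real.pi) :
    ((Circle.exp s, D.Q (j + 1)) ∈ D.OmegaAHalf G ↔ ¬(Circle.exp s = D.P j ∧ G j = D.P j)) ∧
    (Circle.exp s, D.Q (j + 1)) ∈ D.OmegaGeoHalf ∧
    dt (Circle.exp s) (D.Q (j + 1)) (D.V j) ≤ 0 := by
  have hm1 : ((m + 1 : ℤ) : ZMod (8 * g - 4)) = j + 1 := by push_cast; rw [hm]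
  have C : L.InCell (j + 1) (j + 1) (m + 1) (m + 1) (e (2 * m + 3)) := by
    refine ⟨hm1, hm1, le_rfl, by omega, (L.mono (by omega)).le, L.mono (by omega), ?_,
      L.mono (by omega)⟩
    rw [show 2 * (m + 1) + 1 = 2 * m + 3 by ring]
  have hQ : D.Q (j + 1) = Circle.exp (e (2 * m + 3)) := by
    rw [L.Q_at _ hm1, show 2 * (m + 1) + 1 = 2 * m + 3 by ring]
  have hP : D.P j = Circle.exp (e (2 * m) + 2 * Real.pi) := by
    rw [L.P_at m hm, Circle.exp_add_two_pi]
  have e1 := L.lt_per (show 2 * m + 7 < 2 * m - 2 + 2 * (8 * (g : ℤ) - 4) by omega)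
  have e2 := L.mono (show 2 * m < 2 * m + 2 by omega)
  have e3 := L.mono (show 2 * m + 3 < 2 * m + 5 by omega)
  have e4 := L.mono (show 2 * m + 5 < 2 * m + 7 by omega)
  have e5 := L.mono (show 2 * m + 2 < 2 * m + 3 by omega)
  have b0 : e (2 * (m + 1) + 3) ≤ s := by rw [show 2 * (m + 1) + 3 = 2 * m + 5 by ring]; linarith
  have b1 : s ≤ e (2 * (m + 1)) + 2 * Real.pi := by
    rw [show 2 * (m + 1) = 2 * m + 2 by ring]; linarith
  refine ⟨?_, ?_, ?_⟩
  · obtain ⟨h, a1, a2, a3⟩ := L.exists_H_succ hD hg hG hm1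
    obtain ⟨γ, c1, c2, c3⟩ := L.exists_G hg hG hm1
    rw [hQ, C.mem_OmegaAHalf hD hg a1 a2 a3 c1 c2 c3 b0 b1]
    rw [show 2 * (m + 1) + 5 = 2 * m + 7 by ring] at a2
    rw [show 2 * (m + 1) - 2 = 2 * m by ring] at c1
    rw [show 2 * (m + 1) = 2 * m + 2 by ring] at c2
    rw [add_sub_cancel_right] at c3
    rw [and_iff_right (by linarith), ← not_le, not_iff_not, ← c3, hP]
    constructor
    · intro h1
      exact ⟨by rw [show s = e (2 * m) + 2 * Real.pi by linarith],
        by rw [show γ = e (2 * m) + 2 * Real.pi by linarith]⟩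
    · rintro ⟨h1, h2⟩
      have h3 := exp_inj_of_lt h1 (by linarith) (by linarith)
      have h4 := exp_inj_of_lt h2 (by linarith [L.mono (show 2 * m + 2 < 2 * m + 7 by omega)])
        (by linarith)
      linarith
  · rw [hQ, C.mem_OmegaGeoHalf hD hg b0 b1]
    refine ⟨C.dt_pos hD ?_ b1, ?_⟩
    · rw [show 2 * (m + 1) + 5 = 2 * m + 7 by ring]; linarith
    · refine C.dt_nonpos hD b0 ?_
      rwa [show 2 * (m + 1) - 2 = 2 * m by ring]
  · rw [hQ, dt_swap, neg_nonpos]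
    exact dt_nonneg_of_line (hD.vertex_mem _) (hD.line_start_exp' L hm) (by linarith) le_rfl
      (by linarith) hs'

end IsLift

/-! ### The bulges and the corners -/

namespace IsLift

variable {e : ℤ → ℝ} {i j : ZMod (8 * g - 4)} {n m : ℤ}

theorem Q_succ (L : IsLift D e) (hn : (n : ZMod (8 * g - 4)) = i) :
    D.Q (i + 1) = Circle.exp (e (2 * n + 3)) := by
  rw [L.Q_at (n + 1) (by push_cast; rw [hn]), show 2 * (n + 1) + 1 = 2 * n + 3 by ring]

theorem Q_add_two (L : IsLift D e) (hn : (n : ZMod (8 * g - 4)) = i) :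
    D.Q (i + 2) = Circle.exp (e (2 * n + 5)) := by
  rw [L.Q_at (n + 2) (by push_cast; rw [hn]), show 2 * (n + 2) + 1 = 2 * n + 5 by ring]

theorem P_succ (L : IsLift D e) (hn : (n : ZMod (8 * g - 4)) = i) :
    D.P (i + 1) = Circle.exp (e (2 * n + 2)) := by
  rw [L.P_at (n + 1) (by push_cast; rw [hn]), show 2 * (n + 1) = 2 * n + 2 by ring]

theorem P_pred (L : IsLift D e) (hn : (n : ZMod (8 * g - 4)) = i) :
    D.P (i - 1) = Circle.exp (e (2 * n - 2) + 2 * Real.pi) := by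
  rw [L.P_at (n - 1) (by push_cast; rw [hn]), show 2 * (n - 1) = 2 * n - 2 by ring,
    Circle.exp_add_two_pi]

theorem mem_QQ_succ (L : IsLift D e) (hg : 2 ≤ g) (hn : (n : ZMod (8 * g - 4)) = i) (u : Circle) :
    u ∈ arcIcc (D.Q (i + 1)) (D.Q (i + 2)) ↔
      ∃ s, e (2 * n + 3) ≤ s ∧ s ≤ e (2 * n + 5) ∧ Circle.exp s = u := by
  rw [L.Q_succ hn, L.Q_add_two hn, mem_arcIcc_exp (L.mono (by omega)).le (L.lt_per (by omega))]

theorem mem_PP_pred (L : IsLift D e) (hg : 2 ≤ g) (hn : (n : ZMod (8 * g - 4)) = i) (u : Circle) :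
    u ∈ arcIcc (D.P (i - 1)) (D.P i) ↔
      ∃ s, e (2 * n - 2) + 2 * Real.pi ≤ s ∧ s ≤ e (2 * n) + 2 * Real.pi ∧ Circle.exp s = u := by
  have := L.mono (show 2 * n - 2 < 2 * n by omega)
  have := L.lt_per (show 2 * n < 2 * n - 2 + 2 * (8 * (g : ℤ) - 4) by omega)
  rw [L.P_pred hn, L.P_at n hn, ← Circle.exp_add_two_pi (e (2 * n)),
    mem_arcIcc_exp (by linarith) (by linarith)]

end IsLift

theorem IsFundamentalPolygon.mem_lowerBulge_iff (hD : D.IsFundamentalPolygon) (hg : 2 ≤ g)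
    {G : ZMod (8 * g - 4) → Circle} (hG : ∀ i, G i ∈ arcIcc (D.P i) (D.P (i + 1)))
    (i : ZMod (8 * g - 4)) (u w : Circle) :
    (u, w) ∈ D.lowerBulge D.OmegaGeoHalf (D.OmegaAHalf G) i ↔
      u ∈ arcIco (D.Q (i + 1)) (D.H G (i + 1)) ∧ w ∈ arcIcc (D.P i) (D.P (i + 1)) ∧
        0 < dt u w (D.V (i + 1)) := by
  obtain ⟨e, L⟩ := hD.exists_isLift
  obtain ⟨n, hn⟩ := ZMod.intCast_surjective i
  obtain ⟨h, h1, h2, h3⟩ := L.exists_H_succ hD hg hG hn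
  have e1 := L.lt_per (show 2 * n + 5 < 2 * n + 3 + 2 * (8 * (g : ℤ) - 4) by omega)
  have hu : u ∈ arcIco (D.Q (i + 1)) (D.H G (i + 1)) ↔
      ∃ s, e (2 * n + 3) ≤ s ∧ s < h ∧ Circle.exp s = u := by
    rw [L.Q_succ hn, ← h3, mem_arcIco_exp h1 (by linarith)]
  simp only [lowerBulge, lowerBox, mem_inter_iff, mem_sdiff, mem_prod]
  rw [hu, L.mem_PP hg hn, L.mem_QQ_succ hg hn]
  constructor
  · rintro ⟨⟨hX, hY⟩, ⟨s, s1, s2, rfl⟩, ⟨t, t1, t2, rfl⟩⟩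
    rcases t2.eq_or_lt with rfl | t3
    · rw [← L.P_succ hn] at hX
      exact absurd hX (L.lower_edge hD hg hG hn s1 s2).2.1
    · have := L.lower_mem hD hg hG hn h1 h2 h3 t1 t3 s1 s2
      exact ⟨⟨s, s1, not_le.1 fun h ↦ hY (this.1.2 h), rfl⟩, ⟨t, t1, t2, rfl⟩, this.2.1 hX⟩
  · rintro ⟨⟨s, s1, s2, rfl⟩, ⟨t, t1, t2, rfl⟩, hdt⟩
    refine ⟨?_, ⟨s, s1, by linarith, rfl⟩, ⟨t, t1, t2, rfl⟩⟩
    rcases t2.eq_or_lt with rfl | t3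
    · rw [← L.P_succ hn] at hdt
      exact absurd (L.lower_edge hD hg hG hn s1 (by linarith)).2.2 (not_le.2 hdt)
    · have := L.lower_mem hD hg hG hn h1 h2 h3 t1 t3 s1 (by linarith)
      exact ⟨this.2.2 hdt, fun h ↦ (this.1.1 h).not_gt s2⟩

/-- The second alternative is the isolated point left by the half-open conventions (`lower_edge`);
it corresponds to that of `mem_upperBulge_iff`. -/
theorem IsFundamentalPolygon.mem_lowerCorner_iff (hD : D.IsFundamentalPolygon) (hg : 2 ≤ g)
    {G : ZMod (8 * g - 4) → Circle} (hG : ∀ i, G i ∈ arcIcc (D.P i) (D.P (i + 1)))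
    (i : ZMod (8 * g - 4)) (u w : Circle) :
    (u, w) ∈ D.lowerCorner D.OmegaGeoHalf (D.OmegaAHalf G) i ↔
      (u ∈ arcIcc (D.H G (i + 1)) (D.Q (i + 2)) ∧ w ∈ arcIco (D.P i) (D.P (i + 1)) ∧
        dt u w (D.V (i + 1)) ≤ 0) ∨
      (u = D.Q (i + 2) ∧ w = D.P (i + 1) ∧ D.H G (i + 2) = D.Q (i + 2)) := by
  obtain ⟨e, L⟩ := hD.exists_isLift
  obtain ⟨n, hn⟩ := ZMod.intCast_surjective i
  obtain ⟨h, h1, h2, h3⟩ := L.exists_H_succ hD hg hG hn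
  have e0 := L.mono (show 2 * n + 3 < 2 * n + 5 by omega)
  have e1 := L.lt_per (show 2 * n + 5 < 2 * n + 3 + 2 * (8 * (g : ℤ) - 4) by omega)
  have e2 := L.mono (show 2 * n < 2 * n + 2 by omega)
  have hu : u ∈ arcIcc (D.H G (i + 1)) (D.Q (i + 2)) ↔
      ∃ s, h ≤ s ∧ s ≤ e (2 * n + 5) ∧ Circle.exp s = u := by
    rw [L.Q_add_two hn, ← h3, mem_arcIcc_exp h2 (by linarith)]
  simp only [lowerCorner, lowerBox, mem_inter_iff, mem_sdiff, mem_prod]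
  rw [hu, L.mem_PP hg hn, L.mem_QQ_succ hg hn, L.mem_PP' hg hn]
  constructor
  · rintro ⟨⟨hY, hX⟩, ⟨s, s1, s2, rfl⟩, ⟨t, t1, t2, rfl⟩⟩
    rcases t2.eq_or_lt with rfl | t3
    · rw [← L.P_succ hn] at hX hY ⊢
      obtain ⟨h4, h5⟩ := (L.lower_edge hD hg hG hn s1 s2).1.1 hY
      exact .inr ⟨h4, rfl, h5⟩
    · have := L.lower_mem hD hg hG hn h1 h2 h3 t1 t3 s1 s2
      exact .inl ⟨⟨s, this.1.1 hY, s2, rfl⟩, ⟨t, t1, t3, rfl⟩, not_lt.1 fun h ↦ hX (this.2.2 h)⟩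
  · rintro (⟨⟨s, s1, s2, rfl⟩, ⟨t, t1, t2, rfl⟩, hdt⟩ | ⟨rfl, rfl, hH⟩)
    · refine ⟨?_, ⟨s, by linarith, s2, rfl⟩, ⟨t, t1, t2.le, rfl⟩⟩
      have := L.lower_mem hD hg hG hn h1 h2 h3 t1 t2 (by linarith) s2
      exact ⟨this.1.2 s1, fun h ↦ (this.2.1 h).not_ge hdt⟩
    · have := L.lower_edge hD hg hG hn e0.le le_rfl
      rw [← L.Q_add_two hn] at this
      exact ⟨⟨this.1.2 ⟨rfl, hH⟩, this.2.1⟩, ⟨_, e0.le, le_rfl, (L.Q_add_two hn).symm⟩,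
        ⟨_, e2.le, le_rfl, (L.P_succ hn).symm⟩⟩

theorem IsFundamentalPolygon.mem_upperCorner_iff (hD : D.IsFundamentalPolygon) (hg : 2 ≤ g)
    {G : ZMod (8 * g - 4) → Circle} (hG : ∀ i, G i ∈ arcIcc (D.P i) (D.P (i + 1)))
    (j : ZMod (8 * g - 4)) (u w : Circle) :
    (u, w) ∈ D.upperCorner D.OmegaGeoHalf (D.OmegaAHalf G) j ↔
      u ∈ arcIco (D.P (j - 1)) (G (j - 1)) ∧ w ∈ arcIcc (D.Q j) (D.Q (j + 1)) ∧
        0 < dt u w (D.V j) := by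
  obtain ⟨e, L⟩ := hD.exists_isLift
  obtain ⟨m, hm⟩ := ZMod.intCast_surjective j
  obtain ⟨γ, h1, h2, h3⟩ := L.exists_G hg hG hm
  have e1 := L.lt_per (show 2 * m < 2 * m - 2 + 2 * (8 * (g : ℤ) - 4) by omega)
  have hu : u ∈ arcIco (D.P (j - 1)) (G (j - 1)) ↔
      ∃ s, e (2 * m - 2) + 2 * Real.pi ≤ s ∧ s < γ ∧ Circle.exp s = u := by
    rw [L.P_pred hm, ← h3, mem_arcIco_exp h1 (by linarith)]
  simp only [upperCorner, upperBox, mem_inter_iff, mem_sdiff, mem_prod]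
  rw [hu, L.mem_QQ hg hm, L.mem_PP_pred hg hm]
  constructor
  · rintro ⟨⟨hY, hX⟩, ⟨s, s1, s2, rfl⟩, ⟨t, t1, t2, rfl⟩⟩
    rcases t2.eq_or_lt with rfl | t3
    · rw [← L.Q_succ hm] at hX
      exact absurd (L.upper_edge hD hg hG hm s1 s2).2.1 hX
    · have := L.upper_mem hD hg hG hm h1 h2 h3 t1 t3 s1 s2
      exact ⟨⟨s, s1, this.1.1 hY, rfl⟩, ⟨t, t1, t2, rfl⟩, not_le.1 fun h ↦ hX (this.2.2 h)⟩
  · rintro ⟨⟨s, s1, s2, rfl⟩, ⟨t, t1, t2, rfl⟩, hdt⟩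
    refine ⟨?_, ⟨s, s1, by linarith, rfl⟩, ⟨t, t1, t2, rfl⟩⟩
    rcases t2.eq_or_lt with rfl | t3
    · rw [← L.Q_succ hm] at hdt
      exact absurd (L.upper_edge hD hg hG hm s1 (by linarith)).2.2 (not_le.2 hdt)
    · have := L.upper_mem hD hg hG hm h1 h2 h3 t1 t3 s1 (by linarith)
      exact ⟨this.1.2 s2, fun h ↦ (this.2.1 h).not_gt hdt⟩

theorem IsFundamentalPolygon.mem_upperBulge_iff (hD : D.IsFundamentalPolygon) (hg : 2 ≤ g)
    {G : ZMod (8 * g - 4) → Circle} (hG : ∀ i, G i ∈ arcIcc (D.P i) (D.P (i + 1)))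
    (j : ZMod (8 * g - 4)) (u w : Circle) :
    (u, w) ∈ D.upperBulge D.OmegaGeoHalf (D.OmegaAHalf G) j ↔
      (u ∈ arcIcc (G (j - 1)) (D.P j) ∧ w ∈ arcIco (D.Q j) (D.Q (j + 1)) ∧
        dt u w (D.V j) ≤ 0) ∨
      (u = D.P j ∧ w = D.Q (j + 1) ∧ G j = D.P j) := by
  obtain ⟨e, L⟩ := hD.exists_isLift
  obtain ⟨m, hm⟩ := ZMod.intCast_surjective j
  obtain ⟨γ, h1, h2, h3⟩ := L.exists_G hg hG hm
  have e0 := L.mono (show 2 * m - 2 < 2 * m by omega)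
  have e1 := L.lt_per (show 2 * m < 2 * m - 2 + 2 * (8 * (g : ℤ) - 4) by omega)
  have e2 := L.mono (show 2 * m + 1 < 2 * m + 3 by omega)
  have hP : D.P j = Circle.exp (e (2 * m) + 2 * Real.pi) := by
    rw [Circle.exp_add_two_pi, L.P_at m hm]
  have hu : u ∈ arcIcc (G (j - 1)) (D.P j) ↔
      ∃ s, γ ≤ s ∧ s ≤ e (2 * m) + 2 * Real.pi ∧ Circle.exp s = u := by
    rw [hP, ← h3, mem_arcIcc_exp h2 (by linarith)]
  simp only [upperBulge, upperBox, mem_inter_iff, mem_sdiff, mem_prod]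
  rw [hu, L.mem_QQ hg hm, L.mem_QQ' hg hm, L.mem_PP_pred hg hm]
  constructor
  · rintro ⟨⟨hX, hY⟩, ⟨s, s1, s2, rfl⟩, ⟨t, t1, t2, rfl⟩⟩
    rcases t2.eq_or_lt with rfl | t3
    · rw [← L.Q_succ hm] at hX hY ⊢
      rw [(L.upper_edge hD hg hG hm s1 s2).1, not_not] at hY
      exact .inr ⟨hY.1, rfl, hY.2⟩
    · have := L.upper_mem hD hg hG hm h1 h2 h3 t1 t3 s1 s2
      exact .inl ⟨⟨s, not_lt.1 fun h ↦ hY (this.1.2 h), s2, rfl⟩, ⟨t, t1, t3, rfl⟩, this.2.1 hX⟩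
  · rintro (⟨⟨s, s1, s2, rfl⟩, ⟨t, t1, t2, rfl⟩, hdt⟩ | ⟨rfl, rfl, hH⟩)
    · refine ⟨?_, ⟨s, by linarith, s2, rfl⟩, ⟨t, t1, t2.le, rfl⟩⟩
      have := L.upper_mem hD hg hG hm h1 h2 h3 t1 t2 (by linarith) s2
      exact ⟨this.2.2 hdt, fun h ↦ (this.1.1 h).not_ge s1⟩
    · have := L.upper_edge hD hg hG hm (s := e (2 * m) + 2 * Real.pi) (by linarith) le_rfl
      rw [← hP] at this
      exact ⟨⟨this.2.1, fun h ↦ this.1.1 h ⟨rfl, hH⟩⟩, ⟨_, by linarith, le_rfl, hP.symm⟩,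
        ⟨_, e2.le, le_rfl, (L.Q_succ hm).symm⟩⟩

end PolygonData

theorem side_mob_pos_iff_dt (M : SU11) (u w : Circle) {z : ℂ} (hz : ‖z‖ < 1) :
    0 < dt (mobCircle M u) (mobCircle M w) (mob M z) ↔ 0 < dt u w z := by
  have h := side_mob_pos M u w hz
  rw [side_eq, side_eq] at h
  constructor
  · intro h1
    linarith [h.1 (by linarith)]
  · intro h1
    linarith [h.2 (by linarith)]

/-- An open set disjoint from `Y` is disjoint from its closure `Y'`, and an open set inside `X'`
lies inside `X`. -/
theorem interior_sdiff_eq {α : Type*} [TopologicalSpace α] {X Y X' Y' : Set α}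
    (h1 : interior X' ⊆ X) (h2 : X ⊆ X') (h3 : closure Y = Y') :
    interior (X' \ Y') = interior (X \ Y) := by
  subst h3
  apply subset_antisymm
  · refine interior_maximal (fun x hx ↦ ⟨h1 (interior_mono sdiff_subset hx), fun hy ↦ ?_⟩)
      isOpen_interior
    exact (interior_subset hx).2 (subset_closure hy)
  · refine interior_maximal (fun x hx ↦ ⟨h2 (interior_subset hx).1, fun hy ↦ ?_⟩) isOpen_interior
    obtain ⟨y, hy1, hy2⟩ := mem_closure_iff.1 hy _ isOpen_interior hx
    exact (interior_subset hy1).2 hy2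

namespace PolygonData

variable {g : ℕ} {D : PolygonData g}

/-! ### The maps between bulges and corners -/

theorem IsFundamentalPolygon.U_H (hD : D.IsFundamentalPolygon) (hg : 2 ≤ g)
    (G : ZMod (8 * g - 4) → Circle) (k : ZMod (8 * g - 4)) :
    mobCircle (D.U k) (D.H G (tau k)) = G (k - 1) := by
  rw [H, hD.U_U_tau hg, tau_tau hg]

/-- `U k` carries every arc and the vertex describing the lower bulge to those describing the upper
corner, and preserves cyclic order and sides. -/
theorem IsFundamentalPolygon.mobPair_mem_upperCorner (hD : D.IsFundamentalPolygon) (hg : 2 ≤ g)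
    {G : ZMod (8 * g - 4) → Circle} (hG : ∀ i, G i ∈ arcIcc (D.P i) (D.P (i + 1)))
    (k : ZMod (8 * g - 4)) (p : Circle × Circle) :
    mobPair (D.U k) p ∈ D.upperCorner D.OmegaGeoHalf (D.OmegaAHalf G) k ↔
      p ∈ D.lowerBulge D.OmegaGeoHalf (D.OmegaAHalf G) (tau k - 1) := by
  obtain ⟨u, w⟩ := p
  rw [mobPair, hD.mem_upperCorner_iff hg hG, hD.mem_lowerBulge_iff hg hG, sub_add_cancel,
    ← hD.U_Q hg k, ← hD.U_H hg G k, ← hD.U_P_pred hg k, ← hD.U_P hg k, ← hD.U_V hg k,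
    mobCircle_image_arcIco, mobCircle_image_arcIcc, side_mob_pos_iff_dt _ _ _ (hD.vertex_mem _)]

theorem IsFundamentalPolygon.mobPair_mem_lowerCorner (hD : D.IsFundamentalPolygon) (hg : 2 ≤ g)
    {G : ZMod (8 * g - 4) → Circle} (hG : ∀ i, G i ∈ arcIcc (D.P i) (D.P (i + 1)))
    (k : ZMod (8 * g - 4)) (p : Circle × Circle) :
    mobPair (D.U k) p ∈ D.lowerCorner D.OmegaGeoHalf (D.OmegaAHalf G) (k - 1) ↔
      p ∈ D.upperBulge D.OmegaGeoHalf (D.OmegaAHalf G) (tau k) := by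
  obtain ⟨u, w⟩ := p
  have hH : D.H G k = mobCircle (D.U k) (G (tau k - 1)) := rfl
  have hQ := hD.U_P hg k
  have hQ' := hD.U_P_pred hg (k + 1)
  have hH' : D.H G (k + 1) = mobCircle (D.U (k + 1)) (G (tau (k + 1) - 1)) := rfl
  rw [tau_add_one, add_sub_cancel_right] at hQ' hH'
  -- In the alternative for the isolated point, `H (k + 1) = Q (k + 1)` has to be pulled back by `U
  -- (k + 1)`, where it reads `G (τ k) = P (τ k)`; all else is pulled back by `U k`.
  rw [mobPair, hD.mem_lowerCorner_iff hg hG, hD.mem_upperBulge_iff hg hG, sub_add_cancel,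
    show k - 1 + 2 = k + 1 by ring, hH', ← hQ', (mobCircle_injective _).eq_iff, hQ', hH, ← hQ,
    ← hD.U_Q hg k, ← hD.U_Q_succ hg k, ← hD.U_V hg k, mobCircle_image_arcIcc, mobCircle_image_arcIco,
    ← not_lt, side_mob_pos_iff_dt _ _ _ (hD.vertex_mem _), (mobCircle_injective _).eq_iff,
    (mobCircle_injective _).eq_iff, not_lt]

theorem IsFundamentalPolygon.image_lowerBulge (hD : D.IsFundamentalPolygon) (hg : 2 ≤ g)
    {G : ZMod (8 * g - 4) → Circle} (hG : ∀ i, G i ∈ arcIcc (D.P i) (D.P (i + 1)))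
    (i : ZMod (8 * g - 4)) :
    mobPairHomeo (D.U (tau i + 1)) '' D.lowerBulge D.OmegaGeoHalf (D.OmegaAHalf G) i =
      D.upperCorner D.OmegaGeoHalf (D.OmegaAHalf G) (tau i + 1) := by
  have h := hD.mobPair_mem_upperCorner hg hG (tau i + 1)
  rw [← tau_add_one, tau_tau hg, add_sub_cancel_right] at h
  rw [← tau_add_one]
  apply subset_antisymm
  · rintro _ ⟨p, hp, rfl⟩
    exact (h p).2 hp
  · intro q hq
    obtain ⟨p, rfl⟩ := (mobPairHomeo (D.U (tau (i + 1)))).surjective q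
    exact ⟨p, (h p).1 hq, rfl⟩

theorem IsFundamentalPolygon.image_upperBulge (hD : D.IsFundamentalPolygon) (hg : 2 ≤ g)
    {G : ZMod (8 * g - 4) → Circle} (hG : ∀ i, G i ∈ arcIcc (D.P i) (D.P (i + 1)))
    (i : ZMod (8 * g - 4)) :
    mobPairHomeo (D.U (tau i)) '' D.upperBulge D.OmegaGeoHalf (D.OmegaAHalf G) i =
      D.lowerCorner D.OmegaGeoHalf (D.OmegaAHalf G) (tau i - 1) := by
  have h := hD.mobPair_mem_lowerCorner hg hG (tau i)
  rw [tau_tau hg] at h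
  apply subset_antisymm
  · rintro _ ⟨p, hp, rfl⟩
    exact (h p).2 hp
  · intro q hq
    obtain ⟨p, rfl⟩ := (mobPairHomeo (D.U (tau i))).surjective q
    exact ⟨p, (h p).1 hq, rfl⟩

/-! ### Overlaps of bulges and corners -/

/-- A common `w` forces `j` to be `i - 1` or `i`, and then `[Q (i + 1), Q (i + 2)]` ends before `[P
(j - 1), P j]` begins. -/
theorem IsFundamentalPolygon.disjoint_boxes (hD : D.IsFundamentalPolygon) (hg : 2 ≤ g)
    (i j : ZMod (8 * g - 4)) : Disjoint (D.lowerBox i) (D.upperBox j) := by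
  obtain ⟨e, L⟩ := hD.exists_isLift
  obtain ⟨n, hn⟩ := ZMod.intCast_surjective i
  obtain ⟨m, hm1, hm2, hm⟩ := exists_int_rep hg j (n - 6)
  rw [Set.disjoint_left]
  rintro ⟨u, w⟩ ⟨hu, hw⟩ ⟨hu', hw'⟩
  obtain ⟨s, s1, s2, rfl⟩ := (L.mem_QQ_succ hg hn _).1 hu
  obtain ⟨t, t1, t2, rfl⟩ := (L.mem_PP hg hn _).1 hw
  obtain ⟨s', s3, s4, hs⟩ := (L.mem_PP_pred hg hm _).1 hu'
  obtain ⟨t', t3, t4, ht⟩ := (L.mem_QQ hg hm _).1 hw'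
  obtain rfl := exp_inj_of_lt ht
    (by linarith [L.lt_per (show 2 * m + 3 < 2 * n + 2 * (8 * (g : ℤ) - 4) by omega)])
    (by linarith [L.lt_per (show 2 * n + 2 < 2 * m + 1 + 2 * (8 * (g : ℤ) - 4) by omega)])
  have a1 := L.mono.le_iff_le.1 (t3.trans t2)
  have a2 := L.mono.le_iff_le.1 (t1.trans t4)
  have a3 := L.lt_per (show 2 * n + 5 < 2 * m - 2 + 2 * (8 * (g : ℤ) - 4) by omega)
  obtain rfl := exp_inj_of_lt hs
    (by linarith [L.mono (show 2 * m < 2 * n + 3 by omega)]) (by linarith [Real.two_pi_pos])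
  linarith

theorem IsFundamentalPolygon.lowerBulge_unique (hD : D.IsFundamentalPolygon) (hg : 2 ≤ g)
    {G : ZMod (8 * g - 4) → Circle} (hG : ∀ i, G i ∈ arcIcc (D.P i) (D.P (i + 1)))
    {i j : ZMod (8 * g - 4)} {p : Circle × Circle}
    (hi : p ∈ D.lowerBulge D.OmegaGeoHalf (D.OmegaAHalf G) i)
    (hj : p ∈ D.lowerBulge D.OmegaGeoHalf (D.OmegaAHalf G) j) : i = j := by
  have key (i) (h : p ∈ D.lowerBulge D.OmegaGeoHalf (D.OmegaAHalf G) i) :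
      p.2 ∈ arcIco (D.P i) (D.P (i + 1)) := by
    obtain ⟨u, w⟩ := p
    refine (arcIcc_subset_insert _ _ h.2.2).resolve_left fun hw ↦ ?_
    obtain rfl : w = D.P (i + 1) := hw
    obtain ⟨e, L⟩ := hD.exists_isLift
    obtain ⟨n, hn⟩ := ZMod.intCast_surjective i
    obtain ⟨s, s1, s2, rfl⟩ := (L.mem_QQ_succ hg hn _).1 h.2.1
    exact (L.lower_edge hD hg hG hn s1 s2).2.1 h.1.1
  exact hD.PP_unique hg (key i hi) (key j hj)

theorem IsFundamentalPolygon.upperCorner_unique (hD : D.IsFundamentalPolygon) (hg : 2 ≤ g)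
    {G : ZMod (8 * g - 4) → Circle} (hG : ∀ i, G i ∈ arcIcc (D.P i) (D.P (i + 1)))
    {i j : ZMod (8 * g - 4)} {p : Circle × Circle}
    (hi : p ∈ D.upperCorner D.OmegaGeoHalf (D.OmegaAHalf G) i)
    (hj : p ∈ D.upperCorner D.OmegaGeoHalf (D.OmegaAHalf G) j) : i = j := by
  have key (i) (h : p ∈ D.upperCorner D.OmegaGeoHalf (D.OmegaAHalf G) i) :
      p.2 ∈ arcIco (D.Q i) (D.Q (i + 1)) := by
    obtain ⟨u, w⟩ := p
    refine (arcIcc_subset_insert _ _ h.2.2).resolve_left fun hw ↦ ?_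
    obtain rfl : w = D.Q (i + 1) := hw
    obtain ⟨e, L⟩ := hD.exists_isLift
    obtain ⟨n, hn⟩ := ZMod.intCast_surjective i
    obtain ⟨s, s1, s2, rfl⟩ := (L.mem_PP_pred hg hn _).1 h.2.1
    exact h.1.2 (L.upper_edge hD hg hG hn s1 s2).2.1
  exact hD.QQ_unique hg (key i hi) (key j hj)

theorem IsFundamentalPolygon.PP_left_mem (hD : D.IsFundamentalPolygon) (hg : 2 ≤ g)
    (i : ZMod (8 * g - 4)) : D.P i ∈ arcIco (D.P i) (D.P (i + 1)) :=
  (hD.PQ_subset hg (left_mem_arcIco (hD.P_ne_Q_self hg i))).1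

theorem IsFundamentalPolygon.QQ_left_mem (hD : D.IsFundamentalPolygon) (hg : 2 ≤ g)
    (i : ZMod (8 * g - 4)) : D.Q i ∈ arcIco (D.Q i) (D.Q (i + 1)) :=
  (hD.QP_subset hg (left_mem_arcIco (hD.Q_ne_P_succ hg i))).2

/-- Neighbouring upper bulges can share only a point `(P k, Q (k + 1))`, and both maps send it to
`(Q (τ k + 1), P (τ k))`. -/
theorem IsFundamentalPolygon.upperBulge_agree (hD : D.IsFundamentalPolygon) (hg : 2 ≤ g)
    {G : ZMod (8 * g - 4) → Circle} (hG : ∀ i, G i ∈ arcIcc (D.P i) (D.P (i + 1)))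
    {i j : ZMod (8 * g - 4)} {p : Circle × Circle}
    (hi : p ∈ D.upperBulge D.OmegaGeoHalf (D.OmegaAHalf G) i)
    (hj : p ∈ D.upperBulge D.OmegaGeoHalf (D.OmegaAHalf G) j) :
    mobPair (D.U (tau i)) p = mobPair (D.U (tau j)) p := by
  obtain ⟨u, w⟩ := p
  have key (k : ZMod (8 * g - 4)) : mobPair (D.U (tau k)) (D.P k, D.Q (k + 1)) =
      mobPair (D.U (tau (k + 1))) (D.P k, D.Q (k + 1)) := by
    have h1 := hD.U_P hg (tau k)
    have h2 := hD.U_Q_succ hg (tau k)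
    have h3 := hD.U_P_pred hg (tau (k + 1))
    have h4 := hD.U_Q hg (tau (k + 1))
    rw [tau_tau hg] at h1 h2 h3 h4
    rw [add_sub_cancel_right] at h3
    rw [mobPair, mobPair, h1, h2, h3, h4, tau_add_one, add_sub_cancel_right]
  rw [hD.mem_upperBulge_iff hg hG] at hi hj
  rcases hi with ⟨-, hi, -⟩ | ⟨rfl, rfl, -⟩
  · rcases hj with ⟨-, hj, -⟩ | ⟨rfl, rfl, -⟩
    · rw [hD.QQ_unique hg hi hj]
    · rw [hD.QQ_unique hg hi (hD.QQ_left_mem hg _), key]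
  · rcases hj with ⟨-, hj, -⟩ | ⟨-, hj, -⟩
    · rw [key, hD.QQ_unique hg (hD.QQ_left_mem hg _) hj]
    · have h := hD.QQ_left_mem hg (i + 1)
      have := hD.QQ_unique (i := i + 1) (j := j + 1) hg h (by
        rw [hj]; exact hD.QQ_left_mem hg (j + 1))
      rw [add_right_cancel this]

/-- The counterpart on the image side: neighbouring lower corners can share one point, where the
inverse maps agree. Injectivity needs this. -/
theorem IsFundamentalPolygon.lowerCorner_agree (hD : D.IsFundamentalPolygon) (hg : 2 ≤ g)
    {G : ZMod (8 * g - 4) → Circle} (hG : ∀ i, G i ∈ arcIcc (D.P i) (D.P (i + 1)))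
    {i j : ZMod (8 * g - 4)} {p : Circle × Circle}
    (hi : p ∈ D.lowerCorner D.OmegaGeoHalf (D.OmegaAHalf G) (tau i - 1))
    (hj : p ∈ D.lowerCorner D.OmegaGeoHalf (D.OmegaAHalf G) (tau j - 1)) :
    mobPair (D.U i) p = mobPair (D.U j) p := by
  obtain ⟨u, w⟩ := p
  have key (k : ZMod (8 * g - 4)) : mobPair (D.U k) (D.Q (tau k + 1), D.P (tau k)) =
      mobPair (D.U (k + 1)) (D.Q (tau k + 1), D.P (tau k)) := by
    have h1 := hD.U_P hg k
    have h2 := hD.U_Q_succ hg k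
    have h3 := hD.U_P_pred hg (k + 1)
    have h4 := hD.U_Q hg (k + 1)
    rw [tau_add_one, add_sub_cancel_right] at h3
    rw [tau_add_one, add_sub_cancel_right] at h4
    rw [mobPair, mobPair, h1, h2, h3, h4]
  rw [hD.mem_lowerCorner_iff hg hG, sub_add_cancel, show tau i - 1 + 2 = tau i + 1 by ring] at hi
  rw [hD.mem_lowerCorner_iff hg hG, sub_add_cancel, show tau j - 1 + 2 = tau j + 1 by ring] at hj
  have hP (k : ZMod (8 * g - 4)) := sub_add_cancel (tau k) 1
  have hinj {k l : ZMod (8 * g - 4)} (h : tau k = tau l) : k = l := by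
    rw [← tau_tau hg k, h, tau_tau hg]
  have hcell (k : ZMod (8 * g - 4)) {w : Circle} (h : w ∈ arcIco (D.P (tau k - 1)) (D.P (tau k))) :
      w ∈ arcIco (D.P (tau k - 1)) (D.P (tau k - 1 + 1)) := by rwa [hP]
  rcases hi with ⟨-, hi, -⟩ | ⟨rfl, rfl, -⟩
  · rcases hj with ⟨-, hj, -⟩ | ⟨rfl, rfl, -⟩
    · rw [hinj (sub_left_injective (hD.PP_unique hg (hcell _ hi) (hcell _ hj)))]
    · have h := hD.PP_unique hg (hcell _ hi) (hD.PP_left_mem hg _)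
      rw [key, ← hinj (k := i) (l := j + 1) (by rw [tau_add_one, ← h]; ring)]
  · rcases hj with ⟨-, hj, -⟩ | ⟨-, hj, -⟩
    · have h := hD.PP_unique hg (hcell _ hj) (hD.PP_left_mem hg _)
      rw [key, ← hinj (k := j) (l := i + 1) (by rw [tau_add_one, ← h]; ring)]
    · have h := hD.PP_left_mem hg (tau i)
      have := hD.PP_unique (i := tau i) (j := tau j) hg h (by
        rw [hj]; exact hD.PP_left_mem hg (tau j))
      rw [hinj this]

/-! ### Bulges and corners exhaust the differences of the domains -/

theorem IsLift.mem_boxes {e : ℤ → ℝ} {L : IsLift D e} {i j : ZMod (8 * g - 4)} {n m : ℤ} {t s : ℝ}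
    (C : L.InCell i j n m t) (hg : 2 ≤ g) (hs : e (2 * n + 3) ≤ s)
    (hs' : s ≤ e (2 * m) + 2 * Real.pi) :
    (s ≤ e (2 * n + 5) → (Circle.exp s, Circle.exp t) ∈ D.lowerBox i) ∧
    (e (2 * m - 2) + 2 * Real.pi ≤ s → (Circle.exp s, Circle.exp t) ∈ D.upperBox j) :=
  ⟨fun h ↦ ⟨(L.mem_QQ_succ hg C.cast_n _).2 ⟨s, hs, h, rfl⟩,
    arcIco_subset_arcIcc _ _ (C.mem_P hg)⟩,
  fun h ↦ ⟨(L.mem_PP_pred hg C.cast_m _).2 ⟨s, h, hs', rfl⟩,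
    arcIco_subset_arcIcc _ _ (C.mem_Q hg)⟩⟩

theorem IsLift.exists_inCell {e : ℤ → ℝ} (L : IsLift D e) (hD : D.IsFundamentalPolygon)
    (hg : 2 ≤ g) (w : Circle) : ∃ i j n m t, L.InCell i j n m t ∧ Circle.exp t = w := by
  obtain ⟨i, -, hi, -⟩ := hD.exists_cells hg w
  obtain ⟨n, hn⟩ := ZMod.intCast_surjective i
  obtain ⟨t, t1, t2, rfl⟩ := (L.mem_PP' hg hn _).1 hi
  obtain ⟨j, m, C⟩ := L.exists_inCell_of_P hn t1 t2
  exact ⟨i, j, n, m, t, C, rfl⟩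

/-- The geometric conditions confine `u` to `[Q (i + 1), P j]`. Failing the arithmetic ones means
coming before `H (i + 1)`, hence in the lower box, or not before `G (j - 1)`, hence in the upper
box. -/
theorem IsFundamentalPolygon.exists_bulge (hD : D.IsFundamentalPolygon) (hg : 2 ≤ g)
    {G : ZMod (8 * g - 4) → Circle} (hG : ∀ i, G i ∈ arcIcc (D.P i) (D.P (i + 1)))
    {p : Circle × Circle} (hX : p ∈ D.OmegaGeoHalf) (hY : p ∉ D.OmegaAHalf G) :
    ∃ i, p ∈ D.lowerBulge D.OmegaGeoHalf (D.OmegaAHalf G) i ∨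
      p ∈ D.upperBulge D.OmegaGeoHalf (D.OmegaAHalf G) i := by
  obtain ⟨u, w⟩ := p
  obtain ⟨e, L⟩ := hD.exists_isLift
  obtain ⟨i, j, n, m, t, C, rfl⟩ := L.exists_inCell hD hg w
  obtain ⟨s, s1, s2, rfl⟩ := exists_lift_Ioo (u := u) (t := t) hX.1
  have hX' := (hD.mem_OmegaGeoHalf_iff hg (arcIco_subset_arcIcc _ _ (C.mem_P hg))
    (arcIco_subset_arcIcc _ _ (C.mem_Q hg)) hX.1).1 hX
  have s3 := L.le_of_dt_nonneg hD hg C.cast_n C.P_le s1 hX'.1.le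
  have s4 := L.le_of_dt_nonpos hD hg C.cast_m C.lt_Q.le s2 hX'.2
  obtain ⟨h, h1, h2, h3⟩ := L.exists_H_succ hD hg hG C.cast_n
  obtain ⟨γ, c1, c2, c3⟩ := L.exists_G hg hG C.cast_m
  have B := IsLift.mem_boxes C hg s3 s4
  have hY' := hY
  rw [C.mem_OmegaAHalf hD hg h1 h2 h3 c1 c2 c3 s3 s4, not_and_or, not_le, not_lt] at hY'
  rcases hY' with h | h
  · exact ⟨i, .inl ⟨⟨hX, hY⟩, B.1 (by linarith)⟩⟩
  · exact ⟨j, .inr ⟨⟨hX, hY⟩, B.2 (by linarith)⟩⟩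

/-- Between the two boxes both geometric conditions are automatic, so a point missing from the
geometric domain lies in one of the boxes. -/
theorem IsFundamentalPolygon.exists_corner (hD : D.IsFundamentalPolygon) (hg : 2 ≤ g)
    {G : ZMod (8 * g - 4) → Circle} (hG : ∀ i, G i ∈ arcIcc (D.P i) (D.P (i + 1)))
    {p : Circle × Circle} (hY : p ∈ D.OmegaAHalf G) (hX : p ∉ D.OmegaGeoHalf) :
    ∃ i, p ∈ D.lowerCorner D.OmegaGeoHalf (D.OmegaAHalf G) i ∨
      p ∈ D.upperCorner D.OmegaGeoHalf (D.OmegaAHalf G) i := by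
  obtain ⟨u, w⟩ := p
  obtain ⟨e, L⟩ := hD.exists_isLift
  obtain ⟨i, j, n, m, t, C, rfl⟩ := L.exists_inCell hD hg w
  obtain ⟨h, h1, h2, h3⟩ := L.exists_H_succ hD hg hG C.cast_n
  obtain ⟨γ, c1, c2, c3⟩ := L.exists_G hg hG C.cast_m
  have := C.m_le
  have := C.le_m
  have a1 := L.lt_per (show 2 * n + 5 < 2 * m - 2 + 2 * (8 * (g : ℤ) - 4) by omega)
  have a2 := L.mono (show 2 * m < 2 * n + 3 by omega)
  obtain ⟨s, s1, s2, rfl⟩ : ∃ s, h ≤ s ∧ s < γ ∧ Circle.exp s = u := by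
    have := (hD.mem_OmegaAHalf_iff hg (C.mem_P hg) (C.mem_Q hg) G u).1 hY
    rwa [← h3, ← c3, mem_arcIco_exp (by linarith) (by linarith)] at this
  have s3 : e (2 * n + 3) ≤ s := by linarith
  have s4 : s ≤ e (2 * m) + 2 * Real.pi := by linarith
  have B := IsLift.mem_boxes C hg s3 s4
  by_cases hl : s ≤ e (2 * n + 5)
  · exact ⟨i, .inl ⟨⟨hY, hX⟩, B.1 hl⟩⟩
  by_cases hu : e (2 * m - 2) + 2 * Real.pi ≤ s
  · exact ⟨j, .inr ⟨⟨hY, hX⟩, B.2 hu⟩⟩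
  rw [C.mem_OmegaGeoHalf hD hg s3 s4] at hX
  exact absurd ⟨C.dt_pos hD (not_le.1 hl).le s4, C.dt_nonpos hD s3 (not_le.1 hu).le⟩ hX

/-! ### The map `Phi` -/

theorem Phi_eq_self {X Y : Set (Circle × Circle)} {p : Circle × Circle} (hY : p ∈ Y) :
    D.Phi X Y p = p := by
  have h1 : ¬ ∃ i, p ∈ D.lowerBulge X Y i := fun ⟨_, h⟩ ↦ h.1.2 hY
  have h2 : ¬ ∃ i, p ∈ D.upperBulge X Y i := fun ⟨_, h⟩ ↦ h.1.2 hY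
  rw [Phi, dif_neg h1, dif_neg h2]

theorem IsFundamentalPolygon.Phi_lowerBulge (hD : D.IsFundamentalPolygon) (hg : 2 ≤ g)
    {G : ZMod (8 * g - 4) → Circle} (hG : ∀ i, G i ∈ arcIcc (D.P i) (D.P (i + 1)))
    (i : ZMod (8 * g - 4)) : EqOn (D.Phi D.OmegaGeoHalf (D.OmegaAHalf G))
      (mobPair (D.U (tau i + 1))) (D.lowerBulge D.OmegaGeoHalf (D.OmegaAHalf G) i) := by
  intro p hp
  have h : ∃ i, p ∈ D.lowerBulge D.OmegaGeoHalf (D.OmegaAHalf G) i := ⟨i, hp⟩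
  rw [Phi, dif_pos h, hD.lowerBulge_unique hg hG h.choose_spec hp]

theorem IsFundamentalPolygon.Phi_upperBulge (hD : D.IsFundamentalPolygon) (hg : 2 ≤ g)
    {G : ZMod (8 * g - 4) → Circle} (hG : ∀ i, G i ∈ arcIcc (D.P i) (D.P (i + 1)))
    (i : ZMod (8 * g - 4)) : EqOn (D.Phi D.OmegaGeoHalf (D.OmegaAHalf G))
      (mobPair (D.U (tau i))) (D.upperBulge D.OmegaGeoHalf (D.OmegaAHalf G) i) := by
  intro p hp
  have h1 : ¬ ∃ i, p ∈ D.lowerBulge D.OmegaGeoHalf (D.OmegaAHalf G) i :=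
    fun ⟨j, h⟩ ↦ Set.disjoint_left.1 (hD.disjoint_boxes hg j i) h.2 hp.2
  have h : ∃ i, p ∈ D.upperBulge D.OmegaGeoHalf (D.OmegaAHalf G) i := ⟨i, hp⟩
  rw [Phi, dif_neg h1, dif_pos h]
  exact hD.upperBulge_agree hg hG h.choose_spec hp

theorem IsFundamentalPolygon.Phi_image_lowerBulge (hD : D.IsFundamentalPolygon) (hg : 2 ≤ g)
    {G : ZMod (8 * g - 4) → Circle} (hG : ∀ i, G i ∈ arcIcc (D.P i) (D.P (i + 1)))
    (i : ZMod (8 * g - 4)) : D.Phi D.OmegaGeoHalf (D.OmegaAHalf G) ''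
        D.lowerBulge D.OmegaGeoHalf (D.OmegaAHalf G) i =
      D.upperCorner D.OmegaGeoHalf (D.OmegaAHalf G) (tau i + 1) := by
  rw [(hD.Phi_lowerBulge hg hG i).image_eq]
  exact hD.image_lowerBulge hg hG i

theorem IsFundamentalPolygon.Phi_image_upperBulge (hD : D.IsFundamentalPolygon) (hg : 2 ≤ g)
    {G : ZMod (8 * g - 4) → Circle} (hG : ∀ i, G i ∈ arcIcc (D.P i) (D.P (i + 1)))
    (i : ZMod (8 * g - 4)) : D.Phi D.OmegaGeoHalf (D.OmegaAHalf G) ''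
        D.upperBulge D.OmegaGeoHalf (D.OmegaAHalf G) i =
      D.lowerCorner D.OmegaGeoHalf (D.OmegaAHalf G) (tau i - 1) := by
  rw [(hD.Phi_upperBulge hg hG i).image_eq]
  exact hD.image_upperBulge hg hG i

theorem IsFundamentalPolygon.Phi_cases (hD : D.IsFundamentalPolygon) (hg : 2 ≤ g)
    {G : ZMod (8 * g - 4) → Circle} (hG : ∀ i, G i ∈ arcIcc (D.P i) (D.P (i + 1)))
    {p : Circle × Circle} (hp : p ∈ D.OmegaGeoHalf) :
    (p ∈ D.OmegaAHalf G ∧ D.Phi D.OmegaGeoHalf (D.OmegaAHalf G) p = p) ∨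
    (∃ i, D.Phi D.OmegaGeoHalf (D.OmegaAHalf G) p = mobPair (D.U (tau i + 1)) p ∧
      mobPair (D.U (tau i + 1)) p ∈ D.upperCorner D.OmegaGeoHalf (D.OmegaAHalf G) (tau i + 1)) ∨
    (∃ i, D.Phi D.OmegaGeoHalf (D.OmegaAHalf G) p = mobPair (D.U (tau i)) p ∧
      mobPair (D.U (tau i)) p ∈ D.lowerCorner D.OmegaGeoHalf (D.OmegaAHalf G) (tau i - 1)) := by
  by_cases hY : p ∈ D.OmegaAHalf G
  · exact .inl ⟨hY, Phi_eq_self hY⟩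
  obtain ⟨i, hi | hi⟩ := hD.exists_bulge hg hG hp hY
  · refine .inr (.inl ⟨i, hD.Phi_lowerBulge hg hG i hi, ?_⟩)
    rw [← hD.image_lowerBulge hg hG]
    exact mem_image_of_mem _ hi
  · refine .inr (.inr ⟨i, hD.Phi_upperBulge hg hG i hi, ?_⟩)
    rw [← hD.image_upperBulge hg hG]
    exact mem_image_of_mem _ hi

theorem IsFundamentalPolygon.Phi_injOn (hD : D.IsFundamentalPolygon) (hg : 2 ≤ g)
    {G : ZMod (8 * g - 4) → Circle} (hG : ∀ i, G i ∈ arcIcc (D.P i) (D.P (i + 1))) :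
    InjOn (D.Phi D.OmegaGeoHalf (D.OmegaAHalf G)) D.OmegaGeoHalf := by
  intro p hp q hq hpq
  rcases hD.Phi_cases hg hG hp with ⟨hp1, hp2⟩ | ⟨i, hp1, hp2⟩ | ⟨i, hp1, hp2⟩ <;>
    rcases hD.Phi_cases hg hG hq with ⟨hq1, hq2⟩ | ⟨j, hq1, hq2⟩ | ⟨j, hq1, hq2⟩
  · rwa [hp2, hq2] at hpq
  · rw [hp2, hq1] at hpq
    exact absurd hp (hpq ▸ hq2.1.2)
  · rw [hp2, hq1] at hpq
    exact absurd hp (hpq ▸ hq2.1.2)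
  · rw [hp1, hq2] at hpq
    exact absurd hq (hpq ▸ hp2.1.2)
  · rw [hp1, hq1] at hpq
    rw [← hpq] at hq2
    rw [← hD.upperCorner_unique hg hG hp2 hq2] at hpq
    exact (mobPairHomeo _).injective hpq
  · rw [hp1, hq1] at hpq
    rw [← hpq] at hq2
    exact absurd hp2.2 (Set.disjoint_left.1 (hD.disjoint_boxes hg _ _) hq2.2)
  · rw [hp1, hq2] at hpq
    exact absurd hq (hpq ▸ hp2.1.2)
  · rw [hp1, hq1] at hpq
    rw [← hpq] at hq2
    exact absurd hq2.2 (Set.disjoint_left.1 (hD.disjoint_boxes hg _ _) hp2.2)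
  · rw [hp1, hq1] at hpq
    have hq3 := hq2
    rw [← hpq] at hq3
    -- The image may lie in two lower corners, so the indices need not coincide; the inverse maps `U
    -- i` and `U j` agree there all the same.
    have hagree := hD.lowerCorner_agree hg hG (i := i) (j := j) (p := mobPair (D.U (tau i)) p)
    have hUU (k : ZMod (8 * g - 4)) (r : Circle × Circle) :
        mobPair (D.U k) (mobPair (D.U (tau k)) r) = r :=
      Prod.ext (hD.U_U_tau hg k r.1) (hD.U_U_tau hg k r.2)
    have := hagree hp2 hq3
    rwa [hUU, hpq, hUU] at this

theorem IsFundamentalPolygon.Phi_bijOn (hD : D.IsFundamentalPolygon) (hg : 2 ≤ g)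
    {G : ZMod (8 * g - 4) → Circle} (hG : ∀ i, G i ∈ arcIcc (D.P i) (D.P (i + 1))) :
    BijOn (D.Phi D.OmegaGeoHalf (D.OmegaAHalf G)) D.OmegaGeoHalf (D.OmegaAHalf G) := by
  refine ⟨fun p hp ↦ ?_, hD.Phi_injOn hg hG, fun r hr ↦ ?_⟩
  · rcases hD.Phi_cases hg hG hp with ⟨hp1, hp2⟩ | ⟨i, hp1, hp2⟩ | ⟨i, hp1, hp2⟩
    · rwa [hp2]
    · rw [hp1]; exact hp2.1.1
    · rw [hp1]; exact hp2.1.1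
  · by_cases hX : r ∈ D.OmegaGeoHalf
    · exact ⟨r, hX, Phi_eq_self hr⟩
    obtain ⟨k, hk | hk⟩ := hD.exists_corner hg hG hr hX
    · have h := hD.Phi_image_upperBulge hg hG (tau (k + 1))
      rw [tau_tau hg, add_sub_cancel_right] at h
      rw [← h] at hk
      exact image_mono (fun _ h ↦ h.1.1) hk
    · have h := hD.Phi_image_lowerBulge hg hG (tau (k - 1))
      rw [tau_tau hg, sub_add_cancel] at h
      rw [← h] at hk
      exact image_mono (fun _ h ↦ h.1.1) hk

/-! ### The closed domains -/

theorem IsFundamentalPolygon.interior_bulge (hD : D.IsFundamentalPolygon) (hg : 2 ≤ g)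
    {G : ZMod (8 * g - 4) → Circle} (hG : ∀ i, G i ∈ arcIcc (D.P i) (D.P (i + 1))) :
    interior (D.OmegaGeo \ D.OmegaA G) = interior (D.OmegaGeoHalf \ D.OmegaAHalf G) :=
  interior_sdiff_eq (hD.interior_OmegaGeo hg) OmegaGeoHalf_subset (hD.closure_OmegaAHalf hg hG)

theorem IsFundamentalPolygon.interior_corner (hD : D.IsFundamentalPolygon) (hg : 2 ≤ g)
    {G : ZMod (8 * g - 4) → Circle} (hG : ∀ i, G i ∈ arcIcc (D.P i) (D.P (i + 1))) :
    interior (D.OmegaA G \ D.OmegaGeo) = interior (D.OmegaAHalf G \ D.OmegaGeoHalf) :=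
  interior_sdiff_eq (hD.interior_OmegaA hg G)
    (by rw [← hD.closure_OmegaAHalf hg hG]; exact subset_closure) (hD.closure_OmegaGeoHalf hg)

theorem IsFundamentalPolygon.image_interior_lowerBulge (hD : D.IsFundamentalPolygon) (hg : 2 ≤ g)
    {G : ZMod (8 * g - 4) → Circle} (hG : ∀ i, G i ∈ arcIcc (D.P i) (D.P (i + 1)))
    (i : ZMod (8 * g - 4)) :
    mobPair (D.U (tau i + 1)) '' interior (D.lowerBulge D.OmegaGeo (D.OmegaA G) i) =
      interior (D.upperCorner D.OmegaGeo (D.OmegaA G) (tau i + 1)) := by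
  rw [lowerBulge, upperCorner, interior_inter, interior_inter, hD.interior_bulge hg hG,
    hD.interior_corner hg hG, ← interior_inter, ← interior_inter]
  have h := hD.image_lowerBulge hg hG i
  rw [lowerBulge, upperCorner] at h
  rw [← h, ← (mobPairHomeo _).image_interior]
  rfl

theorem IsFundamentalPolygon.image_interior_upperBulge (hD : D.IsFundamentalPolygon) (hg : 2 ≤ g)
    {G : ZMod (8 * g - 4) → Circle} (hG : ∀ i, G i ∈ arcIcc (D.P i) (D.P (i + 1)))
    (i : ZMod (8 * g - 4)) :
    mobPair (D.U (tau i)) '' interior (D.upperBulge D.OmegaGeo (D.OmegaA G) i) =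
      interior (D.lowerCorner D.OmegaGeo (D.OmegaA G) (tau i - 1)) := by
  rw [upperBulge, lowerCorner, interior_inter, interior_inter, hD.interior_bulge hg hG,
    hD.interior_corner hg hG, ← interior_inter, ← interior_inter]
  have h := hD.image_upperBulge hg hG i
  rw [upperBulge, lowerCorner] at h
  rw [← h, ← (mobPairHomeo _).image_interior]
  rfl

end PolygonData

end BowenSeries

theorem mainTheorem5 (g : ℕ) (hg : 2 ≤ g) (D : BowenSeries.PolygonData g)
    (hD : D.IsFundamentalPolygon)
    (A : ZMod (8 * g - 4) → Circle) (hA : ∀ i, A i = D.P i ∨ A i = D.Q i)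
    (G : ZMod (8 * g - 4) → Circle) (hG : D.IsSystemSolution A G) :
    -- the half-open domains are the closed ones with some boundary points removed
    (interior D.OmegaGeo ⊆ D.OmegaGeoHalf ∧ closure D.OmegaGeoHalf = D.OmegaGeo) ∧
    (interior (D.OmegaA G) ⊆ D.OmegaAHalf G ∧ closure (D.OmegaAHalf G) = D.OmegaA G) ∧
    -- `Phi` is well defined by its three formulas
    Set.EqOn (D.Phi D.OmegaGeoHalf (D.OmegaAHalf G)) id (D.OmegaGeoHalf ∩ D.OmegaAHalf G) ∧
    (∀ i, Set.EqOn (D.Phi D.OmegaGeoHalf (D.OmegaAHalf G))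
      (BowenSeries.mobPair (D.U (BowenSeries.tau i + 1)))
      (D.lowerBulge D.OmegaGeoHalf (D.OmegaAHalf G) i)) ∧
    (∀ i, Set.EqOn (D.Phi D.OmegaGeoHalf (D.OmegaAHalf G))
      (BowenSeries.mobPair (D.U (BowenSeries.tau i)))
      (D.upperBulge D.OmegaGeoHalf (D.OmegaAHalf G) i)) ∧
    -- the bijection, and the images of the bulges
    Set.BijOn (D.Phi D.OmegaGeoHalf (D.OmegaAHalf G)) D.OmegaGeoHalf (D.OmegaAHalf G) ∧
    (∀ i, D.Phi D.OmegaGeoHalf (D.OmegaAHalf G) ''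
        D.lowerBulge D.OmegaGeoHalf (D.OmegaAHalf G) i =
      D.upperCorner D.OmegaGeoHalf (D.OmegaAHalf G) (BowenSeries.tau i + 1)) ∧
    (∀ i, D.Phi D.OmegaGeoHalf (D.OmegaAHalf G) ''
        D.upperBulge D.OmegaGeoHalf (D.OmegaAHalf G) i =
      D.lowerCorner D.OmegaGeoHalf (D.OmegaAHalf G) (BowenSeries.tau i - 1)) ∧
    -- for the closed domains the images agree up to boundary points
    (∀ i, BowenSeries.mobPair (D.U (BowenSeries.tau i + 1)) ''
        interior (D.lowerBulge D.OmegaGeo (D.OmegaA G) i) =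
      interior (D.upperCorner D.OmegaGeo (D.OmegaA G) (BowenSeries.tau i + 1))) ∧
    (∀ i, BowenSeries.mobPair (D.U (BowenSeries.tau i)) ''
        interior (D.upperBulge D.OmegaGeo (D.OmegaA G) i) =
      interior (D.lowerCorner D.OmegaGeo (D.OmegaA G) (BowenSeries.tau i - 1))) := by
  have hG' (i) := (hG i).1
  exact ⟨⟨hD.interior_OmegaGeo hg, hD.closure_OmegaGeoHalf hg⟩,
    ⟨hD.interior_OmegaA hg G, hD.closure_OmegaAHalf hg hG'⟩,
    fun p hp ↦ BowenSeries.PolygonData.Phi_eq_self hp.2,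
    hD.Phi_lowerBulge hg hG', hD.Phi_upperBulge hg hG', hD.Phi_bijOn hg hG',
    hD.Phi_image_lowerBulge hg hG', hD.Phi_image_upperBulge hg hG',
    hD.image_interior_lowerBulge hg hG', hD.image_interior_upperBulge hg hG'⟩
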